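/- Fix positive integers $m,k,T$, an integer $d\ge 2$, a real $\beta>-1$ and $p_1,\dots,p_T\in(0,1)$ with $\sum_i p_i=1$. Consider random multigraphs $G_1,G_2,\dots$, where $G_n$ has vertices $v_1,\dots,v_n$, and $v_j$ carries a random type $X_j$; the types are i.i.d. with $\Pr(X_j=i)=p_i$. $G_1$ is the vertex $v_1$ without edges. Given $G_n$, the graph $G_{n+1}$ is obtained by adding $v_{n+1}$ (with its type) and then edges as follows. *Vertex step:* $m$ edges are drawn independently from $v_{n+1}$ to vertices of $G_n$, each to $v_j$ with probability $\frac{\deg_{G_n}(v_j)+\beta}{\sum_{s\le n}(\deg_{G_n}(v_s)+\beta)}$. *Edge step:* independently for $l=1,\dots,k$, a vertex $w$ is chosen uniformly from $v_1,\dots,v_{n+1}$; then $d$ vertices are sampled independently (with replacement) from the vertices other than $w$ of the same type as $w$ (from all vertices other than $w$, if there are no others of that type), each candidate $v_j$ with probability proportional to $\deg_{G_n}(v_j)+\beta$ if $j\le n$, and to $0$ if $j=n+1$ (unless $v_{n+1}$ is the only candidate, in which case it is chosen); an edge is drawn from $w$ to the sampled vertex with the highest degree in $G_n$, ties being broken uniformly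 at random. (For $n=1$ there is only one candidate for every choice made with these weights, and it is chosen.) Let $M_i(n)$ be the maximum degree in $G_n$ among vertices of type $i$ ($0$ if there are none), $S=2m+2k+\beta$, $r=\frac{m+dk}{S}$, and $$f(x)=\frac{m}{S}x+k\Bigl(1-\bigl(1-\tfrac{x}{S}\bigr)^d\Bigr).$$ Then for every type $i$: 1. If $r<1$, then for every $\varepsilon>0$, $\Pr\bigl(\forall n>n_0:\ n^{r-\varepsilon}<M_i(n)<n^{r+\varepsilon}\bigr)\to1$ as $n_0\to\infty$. 2. If $r=1$, then almost surely $\displaystyle\liminf_{n\to\infty}\frac{M_i(n)\ln n}{n}=\frac{2p_iS^2}{kd(d-1)}$. 3. If $r>1$, then the equation $f(x)=x$ has a unique root $x^*$ in $(0,S]$ (and, if $d$ is even, no other positive root), and almost surely $\displaystyle\liminf_{n\to\infty}\frac{M_i(n)}{n}=p_ix^*$. -/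

import Mathlib

open MeasureTheory Filter Topology
open scoped ENNReal NNReal

noncomputable section

namespace ChoiceEdgeStep

/-- The parameters of the model: `T` vertex types with probabilities `p`, `m` edges per vertex
step, `k` edges per edge step, samples of size `d`, and the additive weight `β`. -/
structure Params where
  T : ℕ
  m : ℕ
  k : ℕ
  d : ℕ
  β : ℝ
  p : Fin T → ℝ
  m_pos : 0 < m
  k_pos : 0 < k
  one_lt_d : 1 < d
  neg_one_lt_β : -1 < β
  p_pos : ∀ i, 0 < p i
  p_lt_one : ∀ i, p i < 1
  p_sum : ∑ i, p i = 1

/-- A finite loop-allowing multigraph on the vertices `v₁, …, vₙ` (indexed by `Fin n`), each vertex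
carrying a type in `Fin T`. -/
@[ext]
structure TypedGraph (T n : ℕ) where
  vtype : Fin n → Fin T
  edges : Multiset (Sym2 (Fin n))

/-- The space of graphs is countable; every set of graphs is measurable. -/
instance (T n : ℕ) : MeasurableSpace (TypedGraph T n) := ⊤

namespace TypedGraph

variable {T n : ℕ}

/-- The degree of `v`: the number of edge ends at `v`, with multiplicity. -/
def deg (g : TypedGraph T n) (v : Fin n) : ℕ :=
  (g.edges.map fun e => e.toMultiset.count v).sum

/-- The highest degree among the vertices of type `i` (`0` if there are none). -/
def maxDegree (g : TypedGraph T n) (i : Fin T) : ℕ :=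
  (Finset.univ.filter fun v => g.vtype v = i).sup g.deg

/-- The graph with one vertex, of type `t`, and no edges. -/
def single (t : Fin T) : TypedGraph T 1 where
  vtype := fun _ => t
  edges := 0

/-- Add a new vertex (`Fin.last n`) of type `t`, an edge from it to each of the old vertices
`a 0, …, a (m-1)`, and the `k` edges whose pairs of ends are `e 0, …, e (k-1)`. -/
def extend (g : TypedGraph T n) {m k : ℕ} (t : Fin T) (a : Fin m → Fin n)
    (e : Fin k → Fin (n + 1) × Fin (n + 1)) : TypedGraph T (n + 1) where
  vtype := Fin.snoc (α := fun _ => Fin T) g.vtype t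
  edges := g.edges.map (Sym2.map Fin.castSucc)
    + (Finset.univ : Finset (Fin m)).val.map (fun j => s(Fin.last n, (a j).castSucc))
    + (Finset.univ : Finset (Fin k)).val.map (fun j => s((e j).1, (e j).2))

end TypedGraph

/-- The law of a random element of `C` chosen with probability proportional to `wt`; it is uniform
on `C` if all weights vanish on `C`. -/
def weightedChoice {α : Type*} [DecidableEq α] (C : Finset α) (hC : C.Nonempty) (wt : α → ℝ≥0) :
    PMF α :=
  if h : ∑ b ∈ C, wt b = 0 then PMF.uniformOfFinset C hC
  else PMF.ofFinset (fun a => if a ∈ C then ((wt a / ∑ b ∈ C, wt b : ℝ≥0) : ℝ≥0∞) else 0) C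
    (by
      rw [Finset.sum_congr rfl (fun a ha => if_pos ha), ← ENNReal.ofNNReal_finsetSum,
        ← Finset.sum_div, div_self h, ENNReal.coe_one])
    (fun a ha => if_neg ha)

/-- The joint law of `r` independent random elements with law `μ`. -/
def iid {α : Type*} [Fintype α] (μ : PMF α) (r : ℕ) : PMF (Fin r → α) :=
  PMF.ofFintype (fun y => ∏ j, μ (y j)) (by
    have h := Finset.prod_univ_sum (fun _ : Fin r => (Finset.univ : Finset α)) (fun _ a => μ a)
    rw [Fintype.piFinset_univ] at h
    rw [← h]
    have h1 : ∑ a, μ a = 1 := by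
      have h2 := μ.tsum_coe
      rwa [tsum_fintype] at h2
    simp [h1])

namespace Params

variable (P : Params)

/-- The law of the type of a vertex. -/
def typeLaw : PMF (Fin P.T) :=
  PMF.ofFintype (fun i => ENNReal.ofReal (P.p i)) (by
    rw [← ENNReal.ofReal_sum_of_nonneg (fun i _ => (P.p_pos i).le), P.p_sum, ENNReal.ofReal_one])

variable {n : ℕ}

/-- The degrees in the old graph, extended by `0` to the new vertex. -/
def oldDeg (g : TypedGraph P.T n) : Fin (n + 1) → ℕ := Fin.snoc (α := fun _ => ℕ) g.deg 0

/-- The vertices of the sample `y` with the highest degree in the old graph. -/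
def best (g : TypedGraph P.T n) (y : Fin P.d → Fin (n + 1)) : Finset (Fin (n + 1)) :=
  (Finset.univ.image y).filter fun v => ∀ j, P.oldDeg g (y j) ≤ P.oldDeg g v

theorem best_nonempty (g : TypedGraph P.T n) (y : Fin P.d → Fin (n + 1)) :
    (P.best g y).Nonempty := by
  have : Nonempty (Fin P.d) := ⟨⟨0, lt_trans one_pos P.one_lt_d⟩⟩
  obtain ⟨j, hj⟩ := Finite.exists_max fun j => P.oldDeg g (y j)
  exact ⟨y j, by simpa [best] using hj⟩

/-- The weight `deg v + β` of a vertex. It is positive in every graph that the process reaches,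
except for the graph with a single vertex (where every choice made with these weights is forced). -/
def weight (g : TypedGraph P.T n) (v : Fin n) : ℝ≥0 := Real.toNNReal (g.deg v + P.β)

variable [NeZero n]

/-- The law of the old end of one edge drawn in the vertex step. -/
def attachLaw (g : TypedGraph P.T n) : PMF (Fin n) :=
  weightedChoice Finset.univ Finset.univ_nonempty (P.weight g)

/-- The vertices from which the sample is taken, when the first end is `w` and `x` gives the types:
the vertices other than `w` with the type of `w`, or all vertices other than `w` if there are no
others of that type. -/
def candidates (x : Fin (n + 1) → Fin P.T) (w : Fin (n + 1)) : Finset (Fin (n + 1)) :=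
  if (Finset.univ.filter fun v => v ≠ w ∧ x v = x w).Nonempty then
    Finset.univ.filter fun v => v ≠ w ∧ x v = x w
  else Finset.univ.filter fun v => v ≠ w

theorem candidates_nonempty (x : Fin (n + 1) → Fin P.T) (w : Fin (n + 1)) :
    (P.candidates x w).Nonempty := by
  unfold candidates
  split_ifs with h
  · exact h
  · have : Nontrivial (Fin (n + 1)) := Fin.nontrivial_iff_two_le.2 (by
      have := NeZero.pos n; omega)
    obtain ⟨v, hv⟩ := exists_ne w
    exact ⟨v, by simpa using hv⟩

/-- The law of one element of the sample, when the new vertex has type `t` and the first end is `w`: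
a candidate chosen proportionally to its weight in the old graph, the new vertex (which is not in
the old graph) having weight `0`; if the new vertex is the only candidate, it is chosen. -/
def sampleLaw (g : TypedGraph P.T n) (t : Fin P.T) (w : Fin (n + 1)) : PMF (Fin (n + 1)) :=
  weightedChoice (P.candidates (Fin.snoc (α := fun _ => Fin P.T) g.vtype t) w)
    (P.candidates_nonempty _ w) (Fin.snoc (α := fun _ => ℝ≥0) (P.weight g) 0)

/-- The law of the pair `(w, u)` of ends of one edge drawn in the edge step, when the new vertex has
type `t`: `w` is uniform on all vertices, and `u` is a vertex of highest degree (ties broken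
uniformly) in a sample of `d` independent vertices. -/
def edgeLaw (g : TypedGraph P.T n) (t : Fin P.T) : PMF (Fin (n + 1) × Fin (n + 1)) :=
  (PMF.uniformOfFintype (Fin (n + 1))).bind fun w =>
    (iid (P.sampleLaw g t w) P.d).bind fun y =>
      (PMF.uniformOfFinset (P.best g y) (P.best_nonempty g y)).map fun u => (w, u)

/-- The conditional law of `Gₙ₊₁` given `Gₙ = g`. -/
def step (g : TypedGraph P.T n) : PMF (TypedGraph P.T (n + 1)) :=
  P.typeLaw.bind fun t =>
    (iid (P.attachLaw g) P.m).bind fun a =>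
      (iid (P.edgeLaw g t) P.k).map fun e => g.extend t a e

/-- `G 1, G 2, …` is the random graph process with parameters `P`: the Markov chain that starts from
a single vertex of random type and has the transition probabilities `step`. (`G 0` is the graph
without vertices.) -/
structure IsGraphSequence {Ω : Type*} [MeasurableSpace Ω] (μ : Measure Ω)
    (G : (n : ℕ) → Ω → TypedGraph P.T n) : Prop where
  measurable : ∀ n, Measurable (G n)
  init : ∀ t, μ {ω | G 1 ω = TypedGraph.single t} = P.typeLaw t
  markov : ∀ (n : ℕ) [NeZero n] (g : (j : ℕ) → TypedGraph P.T j),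
    μ {ω | ∀ j ≤ n + 1, G j ω = g j} = μ {ω | ∀ j ≤ n, G j ω = g j} * P.step (g n) (g (n + 1))

/-- `S = 2m + 2k + β`. -/
def S : ℝ := 2 * P.m + 2 * P.k + P.β

/-- `r = (m + dk) / (2m + 2k + β)`. -/
def r : ℝ := (P.m + P.d * P.k) / P.S

/-- `f x = m x / (2m + 2k + β) + k (1 - (1 - x / (2m + 2k + β)) ^ d)`. -/
def f (x : ℝ) : ℝ := P.m / P.S * x + P.k * (1 - (1 - x / P.S) ^ P.d)

end Params

end ChoiceEdgeStep

end

/-!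
Let `M` be the highest degree among the vertices of type `i` in the graph with `n` vertices. The
argument compares `M` with deterministic sequences.

*Types.* The number of vertices of type `i` is about `p i * n`, and their total weight is about
`p i * S * n`, with errors of lower order (`Params.IsGraphSequence.ae_typical`). The second claim
holds since the ends of an edge of the edge step have the same type.

*Drift.* A single leader, that is a vertex of degree `M` which beats all others of its type, is hit
by an edge of the edge step whose first end has type `i` whenever it is in the sample. With
`y = M / (p i * S * n)`, its share in the weight of its type, this has probability
`1 - (1 - y) ^ d`, so that the expected increment of `M` is about `growth y * M / n`, where
`growth y = (m + k * (1 - (1 - y) ^ d) / y) / S` decreases from `growth 0 = r`. No other vertex of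
degree `M` does better (`Params.eventually_mean_deg_sub_le`). If there are several leaders, they
share the hits, but as long as `M` is small in comparison with `n` the highest degree increases
almost with the total of their rates, and the lower bound for its drift persists
(`Params.eventually_le_mean_maxDegree_sub`).

*A leader of linear degree is eventually unique.* If `M` is at least a positive multiple of `n`, then
`M - deg v` has a drift bounded below by a positive constant for every `v` but one leader: the
leaders are preferred to all others, and ties are broken. Hence the sum of `exp (-l * (M - deg v))`
over these `v` is contracted, for small `l`, and tends to `0`
(`Params.IsGraphSequence.eventually_card_leaders`).

*Comparison.* If the relative growth of a sequence `τ` is less than `growth` at the share of a vertex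
of degree `τ`, then `M` is eventually at least `(1 - ε) * τ`, because `(τ / M - 1)₊ ^ 2` is a
supermartingale up to summable errors (`Params.IsGraphSequence.eventually_le_maxDegree`). Conversely,
if the relative growth of `τ` is larger, then `M` is eventually at most `(1 + ε) * τ`; here the
functional is the sum of `(deg v / τ - 1)₊ ^ 2` over all vertices `v` of type `i`
(`Params.IsGraphSequence.eventually_maxDegree_le`). Both rest on the Robbins–Siegmund theorem,
restricted to the event that the graph is typical. The divergence of the sum of the differences of
the rates makes these functionals tend to `0`, not only converge.

*The three cases.* For `r < 1`, `τ = n ^ s` with `s < r` gives the lower bound, and the upper bound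
follows from high moments of the degrees. For `r = 1`, `τ = θ * n / log n` has relative growth about
`(1 - 1 / log n) / n`, while `growth y` is about `1 - k * d * (d - 1) / (2 * S) * y`; the two balance
for one value of `θ`. For `r > 1`, `τ = θ * n` has relative growth `1 / n`, and `growth y = 1` is the
equation `f x = x` with `x = S * y`. In the last two cases the sequences converge, so that the lower
limits are limits.
-/

noncomputable section

namespace ChoiceEdgeStep

/-! ### A local form of the Robbins–Siegmund theorem -/

theorem ae_exists_tendsto_of_nonneg_supermartingale {Ω : Type*} {m0 : MeasurableSpace Ω}
    {μ : Measure Ω} [IsFiniteMeasure μ] {ℱ : Filtration ℕ m0} {V : ℕ → Ω → ℝ}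
    (hV : Supermartingale V ℱ μ) (h0 : ∀ n ω, 0 ≤ V n ω) :
    ∀ᵐ ω ∂μ, ∃ l, Tendsto (fun n => V n ω) atTop (𝓝 l) := by
  have hb : ∀ n, eLpNorm ((-V) n) 1 μ ≤ ((∫ ω, V 0 ω ∂μ).toNNReal : ℝ≥0∞) := by
    intro n
    have e1 : eLpNorm ((-V) n) 1 μ = ENNReal.ofReal (∫ ω, V n ω ∂μ) := by
      rw [Pi.neg_apply, eLpNorm_neg, eLpNorm_one_eq_lintegral_enorm,
        ofReal_integral_eq_lintegral_ofReal (hV.integrable n) (ae_of_all _ (h0 n))]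
      exact lintegral_congr fun ω => Real.enorm_of_nonneg (h0 n ω)
    rw [e1]
    refine ENNReal.ofReal_le_ofReal ?_
    have := hV.setIntegral_le (Nat.zero_le n) MeasurableSet.univ
    simpa using this
  filter_upwards [hV.neg.exists_ae_tendsto_of_bdd hb] with ω ⟨l, hl⟩
  exact ⟨-l, by simpa using hl.neg⟩

/-- **Robbins–Siegmund, localized.** A nonnegative process whose conditional drift is at most
`-Z n + c n` on the event `A n`, with `c` summable, converges, and `Z` is summable, almost surely on
the event that `A n` holds for all large `n`. -/
theorem robbins_siegmund {Ω : Type*} {m0 : MeasurableSpace Ω}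
    {μ : Measure Ω} [IsFiniteMeasure μ] (ℱ : Filtration ℕ m0) {X Z : ℕ → Ω → ℝ} {A : ℕ → Set Ω}
    {c : ℕ → ℝ} {n₀ : ℕ}
    (hX : ∀ n, StronglyMeasurable[ℱ n] (X n)) (hZ : ∀ n, StronglyMeasurable[ℱ n] (Z n))
    (hA : ∀ n, MeasurableSet[ℱ n] (A n)) (hX0 : ∀ n ω, 0 ≤ X n ω) (hZ0 : ∀ n ω, 0 ≤ Z n ω)
    (hc0 : ∀ n, 0 ≤ c n) (hc : Summable c) (hXi : ∀ n, Integrable (X n) μ)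
    (hZi : ∀ n, Integrable (Z n) μ)
    (h : ∀ n, n₀ ≤ n → ∀ᵐ ω ∂μ, ω ∈ A n → (μ[X (n + 1)|ℱ n]) ω ≤ X n ω - Z n ω + c n) :
    ∀ᵐ ω ∂μ, (∀ᶠ n in atTop, ω ∈ A n) →
      (∃ l, Tendsto (fun n => X n ω) atTop (𝓝 l)) ∧ Summable (fun n => Z n ω) := by
  suffices H : ∀ N, n₀ ≤ N → ∀ᵐ ω ∂μ, (∀ n, N ≤ n → ω ∈ A n) →
      (∃ l, Tendsto (fun n => X n ω) atTop (𝓝 l)) ∧ Summable (fun n => Z n ω) by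
    have H' : ∀ᵐ ω ∂μ, ∀ N, n₀ ≤ N → (∀ n, N ≤ n → ω ∈ A n) →
      (∃ l, Tendsto (fun n => X n ω) atTop (𝓝 l)) ∧ Summable (fun n => Z n ω) :=
      ae_all_iff.2 fun N => by
        by_cases hN : n₀ ≤ N
        · simpa [hN] using H N hN
        · simp [hN]
    filter_upwards [H'] with ω hω hev
    obtain ⟨N, hN⟩ := eventually_atTop.1 hev
    exact hω (max N n₀) (le_max_right _ _) fun n hn => hN n ((le_max_left _ _).trans hn)
  intro N hN
  -- `I k` indicates that `A` holds at the times `N, …, N + k - 1`, and `R k` compensates the drift.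
  -- Stopping at the first failure of `A` makes `V` a nonnegative supermartingale.
  let 𝒢 : Filtration ℕ m0 := ⟨fun k => ℱ (N + k), fun i j hij => ℱ.mono (by omega),
    fun k => ℱ.le _⟩
  let I : ℕ → Ω → ℝ := fun k ω => ∏ j ∈ Finset.range k, (A (N + j)).indicator 1 ω
  let R : ℕ → Ω → ℝ := fun k ω => ∑ j ∈ Finset.range k, Z (N + j) ω + ∑' j, c (j + (N + k))
  let V : ℕ → Ω → ℝ := fun k => I k * (X (N + k) + R k)
  have hI01 : ∀ k ω, I k ω = 0 ∨ I k ω = 1 := by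
    intro k ω
    induction k with
    | zero => simp [I]
    | succ k ih =>
      simp only [I, Finset.prod_range_succ] at ih ⊢
      by_cases hk : ω ∈ A (N + k) <;> simp [hk, ih]
  have hI0 : ∀ k ω, 0 ≤ I k ω := fun k ω => by rcases hI01 k ω with h | h <;> simp [h]
  have hIm : ∀ k l, k ≤ l + 1 → StronglyMeasurable[ℱ (N + l)] (I k) := by
    intro k l hk
    refine Finset.stronglyMeasurable_fun_prod _ fun j hj => ?_
    have hj' := Finset.mem_range.1 hj
    exact (stronglyMeasurable_one.indicator (ℱ.mono (by omega) _ (hA (N + j))))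
  have hRm : ∀ k l, k ≤ l + 1 → StronglyMeasurable[ℱ (N + l)] (R k) := by
    intro k l hk
    refine StronglyMeasurable.add ?_ stronglyMeasurable_const
    refine Finset.stronglyMeasurable_fun_sum _ fun j hj => ?_
    have hj' := Finset.mem_range.1 hj
    exact (hZ _).mono (ℱ.mono (by omega))
  have hR0 : ∀ k ω, 0 ≤ R k ω := fun k ω =>
    add_nonneg (Finset.sum_nonneg fun j _ => hZ0 _ _) (tsum_nonneg fun j => hc0 _)
  have hRi : ∀ k, Integrable (R k) μ := fun k =>
    (integrable_finsetSum _ fun j _ => hZi _).add (integrable_const _)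
  have hmulI : ∀ k l (f : Ω → ℝ), k ≤ l + 1 → Integrable f μ → Integrable (I k * f) μ := by
    intro k l f hk hf
    refine hf.bdd_mul (c := 1) (((hIm k l hk).mono (ℱ.le _)).aestronglyMeasurable) ?_
    exact ae_of_all _ fun ω => by rcases hI01 k ω with h | h <;> simp [h]
  have hVi : ∀ k, Integrable (V k) μ := fun k =>
    hmulI k k _ (by omega) ((hXi _).add (hRi k))
  have hVs : Supermartingale V 𝒢 μ := by
    refine supermartingale_nat ?_ hVi ?_
    · intro k
      exact (hIm k k (by omega)).mul ((hX _).add (hRm k k (by omega)))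
    · intro k
      have hm : 𝒢 k ≤ m0 := 𝒢.le k
      have e : V (k + 1) = I (k + 1) * X (N + k + 1) + I (k + 1) * R (k + 1) := by
        simp only [V, mul_add]; rfl
      have c1 : μ[V (k + 1)|𝒢 k] =ᵐ[μ] μ[I (k + 1) * X (N + k + 1)|𝒢 k]
          + μ[I (k + 1) * R (k + 1)|𝒢 k] := by
        rw [e]
        exact condExp_add (hmulI _ k _ le_rfl (hXi _)) (hmulI _ k _ le_rfl (hRi _)) _
      have c2 : μ[I (k + 1) * X (N + k + 1)|𝒢 k] =ᵐ[μ] I (k + 1) * μ[X (N + k + 1)|𝒢 k] :=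
        condExp_mul_of_stronglyMeasurable_left (hIm _ k le_rfl) (hmulI _ k _ le_rfl (hXi _))
          (hXi _)
      have c3 : μ[I (k + 1) * R (k + 1)|𝒢 k] = I (k + 1) * R (k + 1) :=
        condExp_of_stronglyMeasurable hm ((hIm _ k le_rfl).mul (hRm _ k le_rfl))
          (hmulI _ k _ le_rfl (hRi _))
      filter_upwards [c1, c2, h (N + k) (by omega)] with ω h1 h2 h3
      rw [h1, Pi.add_apply, h2, c3]
      simp only [V, Pi.mul_apply, Pi.add_apply]
      have hIs : I (k + 1) ω = I k ω * (A (N + k)).indicator 1 ω := by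
        simp only [I, Finset.prod_range_succ]
      by_cases hk : ω ∈ A (N + k)
      · have h4 := h3 hk
        have h5 : R (k + 1) ω = R k ω + Z (N + k) ω - c (N + k) := by
          simp only [R, Finset.sum_range_succ]
          have := ((summable_nat_add_iff (N + k)).2 hc).tsum_eq_zero_add
          have e2 : ∀ b, c (b + 1 + (N + k)) = c (b + (N + (k + 1))) := fun b => by
            congr 1; omega
          simp only [e2, zero_add] at this
          rw [this]; ring
        rw [hIs]
        simp only [hk, Set.indicator_of_mem, Pi.one_apply, mul_one]
        rw [← mul_add]
        refine mul_le_mul_of_nonneg_left ?_ (hI0 k ω)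
        have h6 : (μ[X (N + k + 1)|𝒢 k]) ω ≤ X (N + k) ω - Z (N + k) ω + c (N + k) := h4
        linarith
      · rw [hIs]
        simp only [hk, not_false_eq_true, Set.indicator_of_notMem, mul_zero, zero_mul, add_zero]
        exact mul_nonneg (hI0 k ω) (add_nonneg (hX0 _ _) (hR0 _ _))
  filter_upwards [ae_exists_tendsto_of_nonneg_supermartingale hVs fun k ω =>
    mul_nonneg (hI0 k ω) (add_nonneg (hX0 _ _) (hR0 _ _))] with ω ⟨l, hl⟩ hω
  have hI1 : ∀ k, I k ω = 1 := fun k => by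
    refine Finset.prod_eq_one fun j _ => ?_
    simp [hω (N + j) (by omega)]
  have hVe : ∀ k, V k ω = X (N + k) ω + R k ω := fun k => by simp [V, hI1]
  have htail : Tendsto (fun k => ∑' j, c (j + (N + k))) atTop (𝓝 0) :=
    (tendsto_sum_nat_add c).comp (tendsto_add_atTop_nat N |>.congr fun k => by omega)
  obtain ⟨B, hB⟩ := hl.bddAbove_range
  have hZs : Summable fun j => Z (N + j) ω := by
    refine summable_of_sum_range_le (c := B) (fun j => hZ0 _ _) fun k => ?_
    refine le_trans ?_ (hB ⟨k, rfl⟩)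
    simp only [hVe, R]
    have := hX0 (N + k) ω
    have : 0 ≤ ∑' j, c (j + (N + k)) := tsum_nonneg fun j => hc0 _
    linarith
  have hZs' : Summable fun n => Z n ω := by
    refine (summable_nat_add_iff N).1 ?_
    simpa [add_comm] using hZs
  refine ⟨⟨l - ∑' j, Z (N + j) ω, ?_⟩, hZs'⟩
  have h7 : Tendsto (fun k => X (N + k) ω) atTop (𝓝 (l - ∑' j, Z (N + j) ω)) := by
    have := (hl.sub hZs.hasSum.tendsto_sum_nat).sub htail
    rw [sub_zero] at this
    refine this.congr fun k => ?_
    rw [hVe]; simp only [R]; ring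
  rw [← tendsto_add_atTop_iff_nat N]
  simpa [add_comm] using h7

/-! ### Degrees in an extended graph -/

namespace TypedGraph

variable {T n : ℕ}

theorem count_toMultiset_mk {α : Type*} [DecidableEq α] (x y v : α) :
    (s(x, y) : Sym2 α).toMultiset.count v = (if x = v then 1 else 0) + (if y = v then 1 else 0) := by
  have : (s(x, y) : Sym2 α).toMultiset = {x, y} := rfl
  rw [this, Multiset.insert_eq_cons, Multiset.count_cons, Multiset.count_singleton, add_comm]
  simp only [eq_comm]

theorem count_toMultiset_map {α γ : Type*} [DecidableEq α] [DecidableEq γ] (f : α → γ)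
    (e : Sym2 α) (v : γ) : (Sym2.map f e).toMultiset.count v = (e.toMultiset.map f).count v := by
  induction e with
  | h x y => rfl

/-- The number of ends at `v` of the edges with pairs of ends `e 0, …, e (k-1)`. -/
def edgeHits {k N : ℕ} (e : Fin k → Fin N × Fin N) (v : Fin N) : ℕ :=
  ∑ l, ((if (e l).1 = v then 1 else 0) + (if (e l).2 = v then 1 else 0))

/-- The number of indices with `a j = v`. -/
def attachHits {m N : ℕ} (a : Fin m → Fin N) (v : Fin N) : ℕ := ∑ j, if a j = v then 1 else 0

theorem deg_extend (g : TypedGraph T n) {m k : ℕ} (t : Fin T) (a : Fin m → Fin n)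
    (e : Fin k → Fin (n + 1) × Fin (n + 1)) (v : Fin (n + 1)) :
    (g.extend t a e).deg v
      = (g.edges.map fun e => (e.toMultiset.map Fin.castSucc).count v).sum
        + ∑ j, ((if Fin.last n = v then 1 else 0) + (if (a j).castSucc = v then 1 else 0))
        + edgeHits e v := by
  simp only [deg, extend, Multiset.map_add, Multiset.sum_add, Multiset.map_map, Function.comp_def,
    count_toMultiset_map, count_toMultiset_mk, edgeHits]
  rfl

theorem deg_extend_castSucc (g : TypedGraph T n) {m k : ℕ} (t : Fin T) (a : Fin m → Fin n)
    (e : Fin k → Fin (n + 1) × Fin (n + 1)) (v : Fin n) :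
    (g.extend t a e).deg v.castSucc = g.deg v + attachHits a v + edgeHits e v.castSucc := by
  rw [deg_extend]
  congr 1
  congr 1
  · simp only [deg]
    congr 2
    funext e
    exact Multiset.count_map_eq_count' _ _ (Fin.castSucc_injective n) v
  · simp [attachHits, (Fin.castSucc_lt_last v).ne']

theorem deg_extend_last (g : TypedGraph T n) {m k : ℕ} (t : Fin T) (a : Fin m → Fin n)
    (e : Fin k → Fin (n + 1) × Fin (n + 1)) :
    (g.extend t a e).deg (Fin.last n) = m + edgeHits e (Fin.last n) := by
  rw [deg_extend]
  congr 1
  have h1 : (g.edges.map fun e => (e.toMultiset.map Fin.castSucc).count (Fin.last n)).sum = 0 := by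
    refine Multiset.sum_eq_zero fun x hx => ?_
    obtain ⟨e, -, rfl⟩ := Multiset.mem_map.1 hx
    refine Multiset.count_eq_zero.2 fun h => ?_
    obtain ⟨u, -, hu⟩ := Multiset.mem_map.1 h
    exact (Fin.castSucc_lt_last u).ne hu
  rw [h1]
  simp [(Fin.castSucc_lt_last _).ne]

theorem card_edges_extend (g : TypedGraph T n) {m k : ℕ} (t : Fin T) (a : Fin m → Fin n)
    (e : Fin k → Fin (n + 1) × Fin (n + 1)) :
    (g.extend t a e).edges.card = g.edges.card + m + k := by
  simp [extend]

theorem vtype_extend_castSucc (g : TypedGraph T n) {m k : ℕ} (t : Fin T) (a : Fin m → Fin n)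
    (e : Fin k → Fin (n + 1) × Fin (n + 1)) (v : Fin n) :
    (g.extend t a e).vtype v.castSucc = g.vtype v := by
  simp [extend]

theorem vtype_extend_last (g : TypedGraph T n) {m k : ℕ} (t : Fin T) (a : Fin m → Fin n)
    (e : Fin k → Fin (n + 1) × Fin (n + 1)) : (g.extend t a e).vtype (Fin.last n) = t := by
  simp [extend]

theorem sum_deg (g : TypedGraph T n) : ∑ v, g.deg v = 2 * g.edges.card := by
  simp only [deg]
  obtain ⟨vt, E⟩ := g
  dsimp only
  induction E using Multiset.induction_on with
  | empty => simp
  | cons a s ih =>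
    simp only [Multiset.map_cons, Multiset.sum_cons, Finset.sum_add_distrib, ih, Multiset.card_cons]
    rw [Multiset.sum_count_eq_card (by simp), Sym2.card_toMultiset]
    ring

theorem finite_setOf_card_edges (N : ℕ) : {g : TypedGraph T n | g.edges.card = N}.Finite := by
  have : Finite (Fin n → Fin T) := inferInstance
  let F : (Fin n → Fin T) × Sym (Sym2 (Fin n)) N → TypedGraph T n := fun x => ⟨x.1, x.2.1⟩
  refine (Set.finite_range F).subset fun g hg => ⟨⟨g.vtype, ⟨g.edges, hg⟩⟩, rfl⟩

instance : Countable (TypedGraph T n) := by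
  let F : TypedGraph T n → (Fin n → Fin T) × Multiset (Sym2 (Fin n)) := fun g => (g.vtype, g.edges)
  have hF : Function.Injective F := fun g h e => by
    simp only [F, Prod.mk.injEq] at e
    exact TypedGraph.ext e.1 e.2
  have : Countable (Multiset (Sym2 (Fin n))) := by
    unfold Multiset; infer_instance
  exact hF.countable

instance : MeasurableSingletonClass (TypedGraph T n) := ⟨fun _ => trivial⟩

theorem attachHits_le {m N : ℕ} (a : Fin m → Fin N) (v : Fin N) : attachHits a v ≤ m := by
  refine (Finset.sum_le_sum (g := fun _ => 1) fun j _ => by split_ifs <;> simp).trans ?_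
  simp

theorem edgeHits_le {k N : ℕ} (e : Fin k → Fin N × Fin N) (v : Fin N) : edgeHits e v ≤ 2 * k := by
  refine (Finset.sum_le_sum (g := fun _ => 2) fun j _ => by split_ifs <;> simp).trans ?_
  simp [mul_comm]

theorem sum_attachHits {m N : ℕ} (a : Fin m → Fin N) : ∑ v, attachHits a v = m := by
  simp only [attachHits]
  rw [Finset.sum_comm]
  simp

theorem sum_edgeHits {k N : ℕ} (e : Fin k → Fin N × Fin N) : ∑ v, edgeHits e v = 2 * k := by
  simp only [edgeHits]
  rw [Finset.sum_comm]
  simp [Finset.sum_add_distrib, mul_comm]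

end TypedGraph

/-! ### The process as a Markov chain with finitely many outcomes in each step -/

namespace Params

variable (P : Params)

/-- The choices made in one step: the type of the new vertex, the old ends of the edges of the
vertex step, and the pairs of ends of the edges of the edge step. -/
abbrev Outcome (n : ℕ) : Type :=
  Fin P.T × (Fin P.m → Fin n) × (Fin P.k → Fin (n + 1) × Fin (n + 1))

/-- The graph resulting from the choices `o`. -/
def next {n : ℕ} (g : TypedGraph P.T n) (o : P.Outcome n) : TypedGraph P.T (n + 1) :=
  g.extend o.1 o.2.1 o.2.2

/-- Deterministic properties of the graphs reached by the process: the number of edges, and the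
positivity of the degrees (hence of the weights), which fails only for a graph with one vertex. -/
def Regular {n : ℕ} (g : TypedGraph P.T n) : Prop :=
  g.edges.card = (P.m + P.k) * (n - 1) ∧ (2 ≤ n → ∀ v, 1 ≤ g.deg v)

theorem Regular.next {n : ℕ} [NeZero n] {g : TypedGraph P.T n} (hg : P.Regular g)
    (o : P.Outcome n) : P.Regular (P.next g o) := by
  have hn := NeZero.pos n
  refine ⟨?_, fun _ v => ?_⟩
  · rw [Params.next, TypedGraph.card_edges_extend, hg.1]
    obtain ⟨l, rfl⟩ : ∃ l, n = l + 1 := ⟨n - 1, by omega⟩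
    simp only [Nat.add_sub_cancel]; ring
  · have hm := P.m_pos
    refine Fin.lastCases ?_ (fun v => ?_) v
    · rw [Params.next, TypedGraph.deg_extend_last]; omega
    · rw [Params.next, TypedGraph.deg_extend_castSucc]
      by_cases h2 : 2 ≤ n
      · have := hg.2 h2 v; omega
      · have h1 : n = 1 := by omega
        subst h1
        have : TypedGraph.attachHits o.2.1 v = P.m := by
          simp [TypedGraph.attachHits, Subsingleton.elim _ v]
        omega

variable {n : ℕ} [NeZero n]

/-- The law of the choices made in one step. -/
def outcomeLaw (g : TypedGraph P.T n) : PMF (P.Outcome n) :=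
  P.typeLaw.bind fun t => (iid (P.attachLaw g) P.m).bind fun a =>
    (iid (P.edgeLaw g t) P.k).map fun e => (t, a, e)

theorem step_eq_map (g : TypedGraph P.T n) : P.step g = (P.outcomeLaw g).map (P.next g) := by
  simp only [step, outcomeLaw, PMF.map_bind, PMF.map_comp]
  rfl

theorem outcomeLaw_apply (g : TypedGraph P.T n) (o : P.Outcome n) :
    P.outcomeLaw g o = P.typeLaw o.1 * ((∏ j, P.attachLaw g (o.2.1 j))
      * ∏ l, P.edgeLaw g o.1 (o.2.2 l)) := by
  obtain ⟨t, a, e⟩ := o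
  rw [outcomeLaw, PMF.bind_apply, tsum_eq_single t, PMF.bind_apply, tsum_eq_single a,
    PMF.map_apply, tsum_eq_single e]
  · simp [iid]
  · intro e' he'
    simp [he'.symm]
  · intro a' ha'
    simp only [PMF.map_apply, mul_eq_zero, ENNReal.tsum_eq_zero]
    right; intro e'; simp [ha'.symm]
  · intro t' ht'
    simp only [PMF.bind_apply, PMF.map_apply, mul_eq_zero, ENNReal.tsum_eq_zero]
    right; intro e'; right; intro e''; simp [ht'.symm]

theorem sum_toReal_eq_one {α : Type*} [Fintype α] (q : PMF α) : ∑ a, (q a).toReal = 1 := by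
  have h := q.tsum_coe
  rw [tsum_fintype] at h
  rw [← ENNReal.toReal_sum fun o _ => PMF.apply_ne_top _ _, h, ENNReal.toReal_one]

/-- The expectation of a function of the choices made in one step from `g`. -/
def mean (g : TypedGraph P.T n) (ψ : P.Outcome n → ℝ) : ℝ :=
  ∑ o, (P.outcomeLaw g o).toReal * ψ o

theorem sum_outcomeLaw (g : TypedGraph P.T n) : ∑ o, (P.outcomeLaw g o).toReal = 1 :=
  sum_toReal_eq_one _

theorem integral_step (g : TypedGraph P.T n) (φ : TypedGraph P.T (n + 1) → ℝ) :
    ∫ x, φ x ∂(P.step g).toMeasure = P.mean g fun o => φ (P.next g o) := by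
  let _ : MeasurableSpace (P.Outcome n) := ⊤
  have : MeasurableSingletonClass (P.Outcome n) := ⟨fun _ => trivial⟩
  have hf : Measurable (P.next g) := fun _ _ => trivial
  rw [step_eq_map, ← PMF.toMeasure_map _ _ hf, integral_map hf.aemeasurable
    (Measurable.of_discrete.aestronglyMeasurable), PMF.integral_eq_sum]
  rfl

variable {P : Params} {Ω : Type*}

/-- The first `n + 1` graphs of the sequence. -/
def path (G : (n : ℕ) → Ω → TypedGraph P.T n) (n : ℕ) (ω : Ω) (j : Fin (n + 1)) :
    TypedGraph P.T j := G j ω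

theorem path_eq_iff {G : (n : ℕ) → Ω → TypedGraph P.T n} {n : ℕ} {ω ω' : Ω} :
    path G n ω = path G n ω' ↔ ∀ j ≤ n, G j ω = G j ω' := by
  constructor
  · intro h j hj
    exact congrFun h ⟨j, by omega⟩
  · intro h
    funext j
    exact h j (by omega)

variable [mΩ : MeasurableSpace Ω] {μ : Measure Ω} {G : (n : ℕ) → Ω → TypedGraph P.T n}

theorem IsGraphSequence.measurableSet_path (hG : P.IsGraphSequence μ G) (n : ℕ)
    (B : Set ((j : Fin (n + 1)) → TypedGraph P.T j)) : MeasurableSet (path G n ⁻¹' B) := by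
  have e : path G n ⁻¹' B = ⋃ b ∈ B, path G n ⁻¹' {b} := by
    ext ω; simp
  rw [e]
  refine MeasurableSet.biUnion B.to_countable fun b _ => ?_
  have e2 : path G n ⁻¹' {b} = ⋂ j : Fin (n + 1), G j ⁻¹' {b j} := by
    ext ω
    simp only [Set.mem_preimage, Set.mem_singleton_iff, Set.mem_iInter]
    exact funext_iff
  rw [e2]
  exact MeasurableSet.iInter fun j => hG.measurable _ (measurableSet_singleton _)

/-- The filtration generated by the graph sequence. -/
def graphFiltration (hG : P.IsGraphSequence μ G) : Filtration ℕ mΩ where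
  seq n := MeasurableSpace.comap (path G n) ⊤
  mono' := by
    rintro i j hij s ⟨B, -, rfl⟩
    refine ⟨{b | (fun l : Fin (i + 1) => b ⟨l, by omega⟩) ∈ B}, trivial, ?_⟩
    rfl
  le' := by
    rintro n s ⟨B, -, rfl⟩
    exact hG.measurableSet_path n B

theorem IsGraphSequence.stronglyMeasurable (hG : P.IsGraphSequence μ G) (n : ℕ)
    (φ : TypedGraph P.T n → ℝ) :
    StronglyMeasurable[graphFiltration hG n] (fun ω => φ (G n ω)) := by
  have : Measurable[graphFiltration hG n] (fun ω => φ (G n ω)) := by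
    intro s _
    refine ⟨{b | φ (b (Fin.last n)) ∈ s}, trivial, rfl⟩
  exact this.stronglyMeasurable

theorem IsGraphSequence.measure_path_inter (hG : P.IsGraphSequence μ G) (n : ℕ) [NeZero n]
    (ω₀ : Ω) (g' : TypedGraph P.T (n + 1)) :
    μ (path G n ⁻¹' {path G n ω₀} ∩ G (n + 1) ⁻¹' {g'})
      = μ (path G n ⁻¹' {path G n ω₀}) * P.step (G n ω₀) g' := by
  have h := hG.markov n (Function.update (fun j => G j ω₀) (n + 1) g')
  have e0 : ∀ j ≤ n, Function.update (fun j => G j ω₀) (n + 1) g' j = G j ω₀ := fun j hj =>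
    Function.update_of_ne (by omega) _ _
  have e1 : {ω | ∀ j ≤ n + 1, G j ω = Function.update (fun j => G j ω₀) (n + 1) g' j}
      = path G n ⁻¹' {path G n ω₀} ∩ G (n + 1) ⁻¹' {g'} := by
    ext ω
    simp only [Set.mem_ofPred_eq, Set.mem_inter_iff, Set.mem_preimage, Set.mem_singleton_iff,
      path_eq_iff]
    constructor
    · intro hω
      refine ⟨fun j hj => (hω j (by omega)).trans (e0 j hj), ?_⟩
      rw [hω (n + 1) le_rfl, Function.update_self]
    · rintro ⟨h1, h2⟩ j hj
      rcases Nat.lt_or_ge n j with h3 | h3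
      · obtain rfl : j = n + 1 := by omega
        rw [h2, Function.update_self]
      · rw [h1 j h3, e0 j h3]
  have e2 : {ω | ∀ j ≤ n, G j ω = Function.update (fun j => G j ω₀) (n + 1) g' j}
      = path G n ⁻¹' {path G n ω₀} := by
    ext ω
    simp only [Set.mem_ofPred_eq, Set.mem_preimage, Set.mem_singleton_iff, path_eq_iff]
    exact forall₂_congr fun j hj => by rw [e0 j hj]
  rw [e1, e2, e0 n le_rfl, Function.update_self] at h
  exact h

theorem IsGraphSequence.setIntegral_path (hG : P.IsGraphSequence μ G) [IsFiniteMeasure μ] (n : ℕ)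
    [NeZero n] (ω₀ : Ω) (φ : TypedGraph P.T (n + 1) → ℝ) :
    ∫ ω in path G n ⁻¹' {path G n ω₀}, φ (G (n + 1) ω) ∂μ
      = ∫ ω in path G n ⁻¹' {path G n ω₀}, P.mean (G n ω) (fun o => φ (P.next (G n ω) o)) ∂μ := by
  set C := path G n ⁻¹' {path G n ω₀} with hC
  have hCm : MeasurableSet C := hG.measurableSet_path n _
  have e1 : (μ.restrict C).map (G (n + 1)) = μ C • (P.step (G n ω₀)).toMeasure := by
    refine Measure.ext_of_singleton fun g' => ?_
    rw [Measure.map_apply (hG.measurable _) (measurableSet_singleton _),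
      Measure.restrict_apply (hG.measurable _ (measurableSet_singleton _)), Set.inter_comm,
      hG.measure_path_inter, Measure.smul_apply, PMF.toMeasure_apply_singleton _ _
      (measurableSet_singleton _), smul_eq_mul]
  have e2 : ∫ ω in C, P.mean (G n ω) (fun o => φ (P.next (G n ω) o)) ∂μ
      = ∫ ω in C, P.mean (G n ω₀) (fun o => φ (P.next (G n ω₀) o)) ∂μ := by
    refine setIntegral_congr_fun hCm fun ω hω => ?_
    have : G n ω = G n ω₀ := path_eq_iff.1 hω n le_rfl
    simp only [this]
  rw [e2, ← integral_map (φ := G (n + 1)) (f := φ) (hG.measurable _).aemeasurable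
    Measurable.of_discrete.aestronglyMeasurable, e1, integral_smul_measure, integral_step]
  simp [Measure.real]

theorem IsGraphSequence.ae_exists_next (hG : P.IsGraphSequence μ G) :
    ∀ᵐ ω ∂μ, ∀ (n : ℕ) [NeZero n], ∃ o : P.Outcome n, G (n + 1) ω = P.next (G n ω) o := by
  refine ae_all_iff.2 fun n => ?_
  rcases Nat.eq_zero_or_pos n with rfl | hn
  · exact ae_of_all _ fun ω h => absurd rfl h.out
  have : NeZero n := ⟨hn.ne'⟩
  suffices H : ∀ᵐ ω ∂μ, ∃ o : P.Outcome n, G (n + 1) ω = P.next (G n ω) o by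
    filter_upwards [H] with ω hω _ using hω
  rw [ae_iff]
  set N := {ω | ¬ ∃ o : P.Outcome n, G (n + 1) ω = P.next (G n ω) o} with hN
  have e : N ⊆ ⋃ b : {x : ((j : Fin (n + 1)) → TypedGraph P.T j) × TypedGraph P.T (n + 1) |
      ∃ ω₀ ∈ N, x = (path G n ω₀, G (n + 1) ω₀)}, path G n ⁻¹' {b.1.1} ∩ G (n + 1) ⁻¹' {b.1.2} := by
    intro ω hω
    exact Set.mem_iUnion.2 ⟨⟨_, ω, hω, rfl⟩, rfl, rfl⟩
  refine measure_mono_null e (measure_iUnion_null ?_)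
  rintro ⟨-, ω₀, hω₀, rfl⟩
  rw [hG.measure_path_inter, P.step_eq_map]
  refine mul_eq_zero_of_right _ ?_
  rw [PMF.apply_eq_zero_iff, PMF.support_map]
  rintro ⟨o, -, ho⟩
  exact hω₀ ⟨o, ho.symm⟩

theorem IsGraphSequence.ae_regular [IsProbabilityMeasure μ] (hG : P.IsGraphSequence μ G) :
    ∀ᵐ ω ∂μ, ∀ n, P.Regular (G n ω) := by
  have h1 : ∀ᵐ ω ∂μ, ∃ t, G 1 ω = TypedGraph.single t := by
    have hm : ∀ t, MeasurableSet {ω | G 1 ω = TypedGraph.single t} := fun t =>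
      hG.measurable 1 (measurableSet_singleton _)
    have hd : Pairwise (Function.onFun Disjoint fun t => {ω | G 1 ω = TypedGraph.single t}) := by
      intro s t hst
      refine Set.disjoint_left.2 fun ω h1 h2 => hst ?_
      have h3 : (TypedGraph.single s) = TypedGraph.single t := h1.symm.trans h2
      exact congrFun (congrArg TypedGraph.vtype h3) 0
    have e := measure_iUnion (μ := μ) hd hm
    simp only [hG.init] at e
    rw [PMF.tsum_coe] at e
    have e2 : {ω | ∃ t, G 1 ω = TypedGraph.single t} = ⋃ t, {ω | G 1 ω = TypedGraph.single t} := by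
      ext; simp
    have := (prob_compl_eq_zero_iff (μ := μ) (MeasurableSet.iUnion hm)).2 e
    rw [ae_iff, ← Set.compl_ofPred, e2]
    exact this
  filter_upwards [h1, hG.ae_exists_next] with ω ⟨t, ht⟩ h2 n
  induction n with
  | zero =>
    have : IsEmpty (Sym2 (Fin 0)) := ⟨fun e => by induction e with | h x y => exact x.elim0⟩
    refine ⟨?_, by simp⟩
    simp [Subsingleton.elim (G 0 ω).edges 0]
  | succ n ih =>
    rcases Nat.eq_zero_or_pos n with rfl | hn
    · have e : G (0 + 1) ω = TypedGraph.single t := ht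
      rw [e]
      exact ⟨by simp [TypedGraph.single], by simp⟩
    · have : NeZero n := ⟨hn.ne'⟩
      obtain ⟨o, ho⟩ := h2 n
      rw [ho]
      exact Regular.next P ih o

/-- Only finitely many graphs are reached in `n` steps, so every function of `G n` is integrable. -/
theorem IsGraphSequence.integrable [IsProbabilityMeasure μ] (hG : P.IsGraphSequence μ G) (n : ℕ)
    (φ : TypedGraph P.T n → ℝ) : Integrable (fun ω => φ (G n ω)) μ := by
  obtain ⟨B, hB⟩ := ((TypedGraph.finite_setOf_card_edges (T := P.T) (n := n)
    ((P.m + P.k) * (n - 1))).image fun g => ‖φ g‖).bddAbove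
  refine Integrable.of_bound (C := B)
    ((Measurable.of_discrete (f := φ)).comp (hG.measurable n)).aestronglyMeasurable ?_
  filter_upwards [hG.ae_regular] with ω hω
  exact hB ⟨_, (hω n).1, rfl⟩

/-- Conditional expectations given the past are the averages `mean`. As there are only countably many
possible pasts, it suffices to integrate over the event that the past is a given one. -/
theorem IsGraphSequence.condExp_ae_eq [IsProbabilityMeasure μ] (hG : P.IsGraphSequence μ G)
    (n : ℕ) [NeZero n] (φ : TypedGraph P.T (n + 1) → ℝ) :
    μ[fun ω => φ (G (n + 1) ω)|graphFiltration hG n]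
      =ᵐ[μ] fun ω => P.mean (G n ω) (fun o => φ (P.next (G n ω) o)) := by
  have hi := hG.integrable n fun g => P.mean g (fun o => φ (P.next g o))
  refine (ae_eq_condExp_of_forall_setIntegral_eq ((graphFiltration hG).le n)
    (hG.integrable (n + 1) φ) (fun s _ _ => hi.integrableOn) ?_
    (hG.stronglyMeasurable n fun g =>
      P.mean g (fun o => φ (P.next g o))).aestronglyMeasurable).symm
  rintro s ⟨B, -, rfl⟩ -
  have e : path G n ⁻¹' B = ⋃ b : B, path G n ⁻¹' {b.1} := by
    ext ω; simp
  have hd : Pairwise (Function.onFun Disjoint fun b : B => path G n ⁻¹' {b.1}) := by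
    intro b b' hb
    refine Set.disjoint_left.2 fun ω h1 h2 => hb ?_
    exact Subtype.ext (h1.symm.trans h2)
  rw [e, integral_iUnion (fun b => hG.measurableSet_path n _) hd hi.integrableOn,
    integral_iUnion (fun b => hG.measurableSet_path n _) hd (hG.integrable (n + 1) φ).integrableOn]
  refine tsum_congr fun b => ?_
  by_cases hb : ∃ ω₀, path G n ω₀ = b.1
  · obtain ⟨ω₀, h0⟩ := hb
    rw [← h0, hG.setIntegral_path]
  · have : path G n ⁻¹' {b.1} = ∅ := by
      ext ω
      simp only [Set.mem_preimage, Set.mem_singleton_iff, Set.mem_empty_iff_false, iff_false]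
      exact fun h => hb ⟨ω, h⟩
    rw [this]; simp

/-- The local Robbins–Siegmund theorem for functions of the graphs of the sequence. -/
theorem IsGraphSequence.robbins_siegmund [IsProbabilityMeasure μ] (hG : P.IsGraphSequence μ G)
    (X Z : (n : ℕ) → TypedGraph P.T n → ℝ) (A : (n : ℕ) → Set (TypedGraph P.T n)) {c : ℕ → ℝ}
    (n₀ : ℕ) (hX0 : ∀ n g, 0 ≤ X n g) (hZ0 : ∀ n g, 0 ≤ Z n g)
    (hc0 : ∀ n, 0 ≤ c n) (hc : Summable c)
    (h : ∀ (n : ℕ) [NeZero n], n₀ ≤ n → ∀ g ∈ A n, P.Regular g →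
      P.mean g (fun o => X (n + 1) (P.next g o)) ≤ X n g - Z n g + c n) :
    ∀ᵐ ω ∂μ, (∀ᶠ n in atTop, G n ω ∈ A n) →
      (∃ l, Tendsto (fun n => X n (G n ω)) atTop (𝓝 l)) ∧ Summable (fun n => Z n (G n ω)) := by
  refine ChoiceEdgeStep.robbins_siegmund (graphFiltration hG) (X := fun n ω => X n (G n ω))
    (Z := fun n ω => Z n (G n ω)) (A := fun n => {ω | G n ω ∈ A n}) (c := c) (n₀ := n₀ + 1)
    (fun n => hG.stronglyMeasurable n (X n)) (fun n => hG.stronglyMeasurable n (Z n))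
    (fun n => ⟨{b | b (Fin.last n) ∈ A n}, trivial, rfl⟩) (fun n ω => hX0 _ _)
    (fun n ω => hZ0 _ _) hc0 hc (fun n => hG.integrable n (X n)) (fun n => hG.integrable n (Z n))
    fun n hn => ?_
  have : NeZero n := ⟨by omega⟩
  filter_upwards [hG.condExp_ae_eq n (X (n + 1)), hG.ae_regular] with ω h1 h2 h3
  rw [h1]
  exact h n (by omega) _ h3 (h2 n)

end Params

/-! ### Expectations of functions of the choices made in one step -/

section Iid

variable {α : Type*} [Fintype α] {r : ℕ} (w : α → ℝ)

theorem sum_prod_mul_prod (ρ : Fin r → α → ℝ) :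
    ∑ y : Fin r → α, (∏ j, w (y j)) * ∏ j, ρ j (y j) = ∏ j, ∑ a, w a * ρ j a := by
  have h := Finset.prod_univ_sum (fun _ : Fin r => (Finset.univ : Finset α))
    (fun j a => w a * ρ j a)
  rw [Fintype.piFinset_univ] at h
  rw [h]
  exact Finset.sum_congr rfl fun y _ => Finset.prod_mul_distrib.symm

theorem sum_prod_mul_prod_const (ρ : α → ℝ) :
    ∑ y : Fin r → α, (∏ j, w (y j)) * ∏ j, ρ (y j) = (∑ a, w a * ρ a) ^ r := by
  rw [sum_prod_mul_prod w fun _ => ρ]; simp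

variable {w}

theorem sum_prod_eq_one (hw : ∑ a, w a = 1) : ∑ y : Fin r → α, ∏ j, w (y j) = 1 := by
  have := sum_prod_mul_prod_const (r := r) w (fun _ => 1)
  simpa [hw] using this

theorem sum_prod_mul_sum (hw : ∑ a, w a = 1) (ψ : α → ℝ) :
    ∑ y : Fin r → α, (∏ j, w (y j)) * ∑ j, ψ (y j) = r * ∑ a, w a * ψ a := by
  simp only [Finset.mul_sum (s := (Finset.univ : Finset (Fin r)))]
  rw [Finset.sum_comm]
  have h : ∀ j : Fin r, ∑ y : Fin r → α, (∏ i, w (y i)) * ψ (y j) = ∑ a, w a * ψ a := by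
    intro j
    have h1 := sum_prod_mul_prod w fun i a => if i = j then ψ a else 1
    have h2 : ∀ y : Fin r → α, ∏ i, (if i = j then ψ (y i) else 1) = ψ (y j) := fun y => by
      simp
    simp only [h2] at h1
    rw [h1, Finset.prod_eq_single j]
    · simp
    · intro i _ hi; simp [hi, hw]
    · simp
  simp [h]

/-- The probability that an iid sample avoids the complement of `C`. -/
theorem sum_prod_mul_indicator [DecidableEq α] (C : Finset α) :
    ∑ y : Fin r → α, (∏ j, w (y j)) * (if ∀ j, y j ∈ C then 1 else 0) = (∑ a ∈ C, w a) ^ r := by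
  have h := sum_prod_mul_prod_const (r := r) w (fun a => if a ∈ C then 1 else 0)
  have h2 : ∀ y : Fin r → α, ∏ j, (if y j ∈ C then (1 : ℝ) else 0)
      = if ∀ j, y j ∈ C then 1 else 0 := fun y => by
    rw [Finset.prod_ite_zero]; simp
  simp only [h2] at h
  rw [h]
  congr 1
  simp [Finset.sum_ite_mem]

end Iid

namespace Params

theorem card_best_pos {P : Params} {n : ℕ} (g : TypedGraph P.T n) (y : Fin P.d → Fin (n + 1)) :
    (0 : ℝ) < (P.best g y).card :=
  Nat.cast_pos.2 (P.best_nonempty g y).card_pos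

variable {P : Params} {n : ℕ} [NeZero n] (g : TypedGraph P.T n)

theorem mean_mono {ψ ρ : P.Outcome n → ℝ} (h : ∀ o, ψ o ≤ ρ o) : P.mean g ψ ≤ P.mean g ρ :=
  Finset.sum_le_sum fun o _ => mul_le_mul_of_nonneg_left (h o) ENNReal.toReal_nonneg

theorem mean_add (ψ ρ : P.Outcome n → ℝ) :
    P.mean g (fun o => ψ o + ρ o) = P.mean g ψ + P.mean g ρ := by
  simp only [mean, mul_add, Finset.sum_add_distrib]

theorem mean_sub (ψ ρ : P.Outcome n → ℝ) :
    P.mean g (fun o => ψ o - ρ o) = P.mean g ψ - P.mean g ρ := by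
  simp only [mean, mul_sub, Finset.sum_sub_distrib]

theorem mean_const (c : ℝ) : P.mean g (fun _ => c) = c := by
  simp only [mean, ← Finset.sum_mul, sum_outcomeLaw, one_mul]

theorem mean_mul (c : ℝ) (ψ : P.Outcome n → ℝ) :
    P.mean g (fun o => c * ψ o) = c * P.mean g ψ := by
  simp only [mean, Finset.mul_sum, mul_left_comm]

theorem mean_sum {ι : Type*} (s : Finset ι) (ψ : ι → P.Outcome n → ℝ) :
    P.mean g (fun o => ∑ i ∈ s, ψ i o) = ∑ i ∈ s, P.mean g (ψ i) := by
  simp only [mean, Finset.mul_sum]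
  exact Finset.sum_comm

/-- The probability that an edge of the vertex step ends in `v`. -/
def attachProb (v : Fin n) : ℝ := (P.attachLaw g v).toReal

/-- The probability that `x` is the pair of ends of an edge of the edge step, when the new vertex
has type `t`. -/
def edgeProb (t : Fin P.T) (x : Fin (n + 1) × Fin (n + 1)) : ℝ := (P.edgeLaw g t x).toReal

/-- The probability that an element of the sample is `v`, when the new vertex has type `t` and the
first end of the edge is `w`. -/
def sampleProb (t : Fin P.T) (w v : Fin (n + 1)) : ℝ := (P.sampleLaw g t w v).toReal

theorem attachProb_nonneg (v : Fin n) : 0 ≤ attachProb g v := ENNReal.toReal_nonneg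

theorem edgeProb_nonneg (t : Fin P.T) (x) : 0 ≤ edgeProb g t x := ENNReal.toReal_nonneg

theorem sampleProb_nonneg (t : Fin P.T) (w v) : 0 ≤ sampleProb g t w v := ENNReal.toReal_nonneg

theorem sum_attachProb : ∑ v, attachProb g v = 1 := sum_toReal_eq_one _

theorem sum_edgeProb (t : Fin P.T) : ∑ x, edgeProb g t x = 1 := sum_toReal_eq_one _

theorem sum_sampleProb (t : Fin P.T) (w) : ∑ v, sampleProb g t w v = 1 := sum_toReal_eq_one _

theorem mean_eq (ψ : P.Outcome n → ℝ) :
    P.mean g ψ = ∑ t, P.p t * ∑ a : Fin P.m → Fin n, (∏ j, attachProb g (a j)) *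
      ∑ e : Fin P.k → Fin (n + 1) × Fin (n + 1), (∏ l, edgeProb g t (e l)) * ψ (t, a, e) := by
  rw [mean, Fintype.sum_prod_type]
  refine Finset.sum_congr rfl fun t _ => ?_
  rw [Fintype.sum_prod_type, Finset.mul_sum]
  refine Finset.sum_congr rfl fun a _ => ?_
  rw [Finset.mul_sum, Finset.mul_sum]
  refine Finset.sum_congr rfl fun e _ => ?_
  have h1 : (P.typeLaw t).toReal = P.p t := by
    simp only [typeLaw, PMF.ofFintype_apply]
    exact ENNReal.toReal_ofReal (P.p_pos t).le
  rw [outcomeLaw_apply, ENNReal.toReal_mul, ENNReal.toReal_mul, ENNReal.toReal_prod,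
    ENNReal.toReal_prod, h1]
  simp only [attachProb, edgeProb]
  ring

theorem mean_prod (ψ : Fin n → ℝ) (ρ : Fin P.T → Fin (n + 1) × Fin (n + 1) → ℝ) :
    P.mean g (fun o => (∏ j, ψ (o.2.1 j)) * ∏ l, ρ o.1 (o.2.2 l))
      = ∑ t, P.p t * ((∑ v, attachProb g v * ψ v) ^ P.m
        * (∑ x, edgeProb g t x * ρ t x) ^ P.k) := by
  rw [mean_eq]
  refine Finset.sum_congr rfl fun t _ => ?_
  congr 1
  rw [← sum_prod_mul_prod_const, ← sum_prod_mul_prod_const, Finset.sum_mul]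
  refine Finset.sum_congr rfl fun a _ => ?_
  rw [Finset.mul_sum, Finset.mul_sum]
  refine Finset.sum_congr rfl fun e _ => by ring

theorem mean_type (ψ : Fin P.T → ℝ) : P.mean g (fun o => ψ o.1) = ∑ t, P.p t * ψ t := by
  rw [mean_eq]
  simp only [← Finset.sum_mul, sum_prod_eq_one (sum_edgeProb g _),
    sum_prod_eq_one (sum_attachProb g), one_mul]

theorem mean_sum_attach (ψ : Fin n → ℝ) :
    P.mean g (fun o => ∑ j, ψ (o.2.1 j)) = P.m * ∑ v, attachProb g v * ψ v := by
  rw [mean_eq]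
  simp only [← Finset.sum_mul, sum_prod_eq_one (sum_edgeProb g _), one_mul,
    sum_prod_mul_sum (sum_attachProb g), P.p_sum]

theorem mean_sum_edge (ρ : Fin P.T → Fin (n + 1) × Fin (n + 1) → ℝ) :
    P.mean g (fun o => ∑ l, ρ o.1 (o.2.2 l))
      = ∑ t, P.p t * (P.k * ∑ x, edgeProb g t x * ρ t x) := by
  rw [mean_eq]
  simp only [sum_prod_mul_sum (sum_edgeProb g _), ← Finset.sum_mul,
    sum_prod_eq_one (sum_attachProb g), one_mul]

/-- The expectation of `ρ u`, where `u` is the second end of an edge of the edge step whose first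
end is `w`. -/
def draw (t : Fin P.T) (w : Fin (n + 1)) (ρ : Fin (n + 1) → ℝ) : ℝ :=
  ∑ y : Fin P.d → Fin (n + 1), (∏ j, sampleProb g t w (y j)) *
    ((∑ u ∈ P.best g y, ρ u) / (P.best g y).card)

theorem edgeProb_eq (t : Fin P.T) (w u : Fin (n + 1)) :
    edgeProb g t (w, u) = (n + 1 : ℝ)⁻¹ * ∑ y : Fin P.d → Fin (n + 1),
      (∏ j, sampleProb g t w (y j)) * (if u ∈ P.best g y then ((P.best g y).card : ℝ)⁻¹ else 0) := by
  have h1 : P.edgeLaw g t (w, u) = (n + 1 : ℝ≥0∞)⁻¹ * ∑ y : Fin P.d → Fin (n + 1),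
      (∏ j, P.sampleLaw g t w (y j))
        * (if u ∈ P.best g y then ((P.best g y).card : ℝ≥0∞)⁻¹ else 0) := by
    rw [edgeLaw, PMF.bind_apply, tsum_eq_single w]
    · rw [PMF.uniformOfFintype_apply, PMF.bind_apply, tsum_fintype]
      congr 1
      · simp
      · refine Finset.sum_congr rfl fun y _ => ?_
        congr 1
        rw [PMF.map_apply, tsum_eq_single u]
        · simp [PMF.uniformOfFinset_apply]
        · intro u' hu'
          simp [hu'.symm]
    · intro w' hw'
      refine mul_eq_zero_of_right _ ?_
      rw [PMF.bind_apply, ENNReal.tsum_eq_zero]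
      intro y
      refine mul_eq_zero_of_right _ ?_
      rw [PMF.map_apply, ENNReal.tsum_eq_zero]
      intro u'
      simp [hw'.symm]
  rw [edgeProb, h1, ENNReal.toReal_mul, ENNReal.toReal_inv, ENNReal.toReal_sum]
  · congr 1
    refine Finset.sum_congr rfl fun y _ => ?_
    rw [ENNReal.toReal_mul, ENNReal.toReal_prod]
    congr 1
    split_ifs <;> simp
  · intro y _
    refine ENNReal.mul_ne_top (ENNReal.prod_ne_top fun j _ => PMF.apply_ne_top _ _) ?_
    split_ifs
    · simp [(P.best_nonempty g y).ne_empty]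
    · simp

theorem sum_edgeProb_mul (t : Fin P.T) (ρ : Fin (n + 1) × Fin (n + 1) → ℝ) :
    ∑ x, edgeProb g t x * ρ x = (n + 1 : ℝ)⁻¹ * ∑ w, draw g t w fun u => ρ (w, u) := by
  rw [Fintype.sum_prod_type, Finset.mul_sum]
  refine Finset.sum_congr rfl fun w _ => ?_
  simp only [edgeProb_eq, draw, mul_assoc, ← Finset.mul_sum]
  congr 1
  simp only [Finset.sum_mul]
  rw [Finset.sum_comm]
  refine Finset.sum_congr rfl fun y _ => ?_
  simp only [mul_assoc, ← Finset.mul_sum]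
  congr 1
  simp only [ite_mul, zero_mul, Finset.sum_ite_mem, Finset.univ_inter, ← Finset.mul_sum]
  rw [div_eq_inv_mul]

theorem draw_mono {t : Fin P.T} {w : Fin (n + 1)} {ρ ρ' : Fin (n + 1) → ℝ}
    (h : ∀ u, ρ u ≤ ρ' u) : draw g t w ρ ≤ draw g t w ρ' := by
  refine Finset.sum_le_sum fun y _ => mul_le_mul_of_nonneg_left ?_
    (Finset.prod_nonneg fun j _ => sampleProb_nonneg _ _ _ _)
  gcongr
  exact h _

theorem draw_const (t : Fin P.T) (w : Fin (n + 1)) (c : ℝ) : draw g t w (fun _ => c) = c := by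
  have : ∀ y, (∑ _u ∈ P.best g y, c) / (P.best g y).card = c := fun y => by
    have := card_best_pos g y
    simp; field_simp
  simp only [draw, this, ← Finset.sum_mul, sum_prod_eq_one (sum_sampleProb g t w), one_mul]

theorem draw_nonneg {t : Fin P.T} {w : Fin (n + 1)} {ρ : Fin (n + 1) → ℝ}
    (h : ∀ u, 0 ≤ ρ u) : 0 ≤ draw g t w ρ := by
  rw [← draw_const g t w 0]
  exact draw_mono g h

theorem draw_le_one {t : Fin P.T} {w : Fin (n + 1)} {ρ : Fin (n + 1) → ℝ}
    (h : ∀ u, ρ u ≤ 1) : draw g t w ρ ≤ 1 := by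
  rw [← draw_const g t w 1]
  exact draw_mono g h

/-- Lower bound for the probability that the second end of an edge lies in `B`, if it does whenever
the sample meets `A`. -/
theorem le_draw_indicator (t : Fin P.T) (w : Fin (n + 1)) (A B : Finset (Fin (n + 1)))
    (h : ∀ y : Fin P.d → Fin (n + 1), (∀ j, sampleProb g t w (y j) ≠ 0) → (∃ j, y j ∈ A) →
      P.best g y ⊆ B) :
    1 - (1 - ∑ v ∈ A, sampleProb g t w v) ^ P.d ≤ draw g t w (fun u => if u ∈ B then 1 else 0) := by
  have h1 : 1 - ∑ v ∈ A, sampleProb g t w v = ∑ v ∈ Aᶜ, sampleProb g t w v := by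
    rw [← sum_sampleProb g t w, ← Finset.sum_add_sum_compl A]; ring
  have e : 1 - (∑ v ∈ Aᶜ, sampleProb g t w v) ^ P.d = ∑ y : Fin P.d → Fin (n + 1),
      (∏ j, sampleProb g t w (y j)) * (1 - if ∀ j, y j ∈ Aᶜ then 1 else 0) := by
    rw [← sum_prod_mul_indicator]
    simp only [mul_sub, mul_one, Finset.sum_sub_distrib, sum_prod_eq_one (sum_sampleProb g t w)]
  rw [h1, e]
  refine Finset.sum_le_sum fun y _ => ?_
  by_cases h0 : ∃ j, sampleProb g t w (y j) = 0
  · obtain ⟨j, hj⟩ := h0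
    rw [Finset.prod_eq_zero (Finset.mem_univ j) hj]; simp
  push Not at h0
  refine mul_le_mul_of_nonneg_left ?_ (Finset.prod_nonneg fun j _ => sampleProb_nonneg _ _ _ _)
  by_cases hy : ∀ j, y j ∈ Aᶜ
  · rw [if_pos hy, sub_self]
    exact div_nonneg (Finset.sum_nonneg fun u _ => by split_ifs <;> simp) (Nat.cast_nonneg _)
  · rw [if_neg hy, sub_zero]
    push Not at hy
    obtain ⟨j, hj⟩ := hy
    have hB := h y h0 ⟨j, by simpa using hj⟩
    rw [Finset.sum_congr rfl fun u hu => if_pos (hB hu)]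
    have := card_best_pos g y
    simp [this.ne']

/-- Upper bound for the probability that `v` is the second end of an edge, if it is not when the
sample meets `A`. -/
theorem draw_single_le (t : Fin P.T) (w v : Fin (n + 1)) (A : Finset (Fin (n + 1))) (hv : v ∉ A)
    (h : ∀ y : Fin P.d → Fin (n + 1), (∃ j, y j ∈ A) → v ∉ P.best g y) :
    draw g t w (fun u => if u = v then 1 else 0)
      ≤ (1 - ∑ u ∈ A, sampleProb g t w u) ^ P.d
        - (1 - ∑ u ∈ A, sampleProb g t w u - sampleProb g t w v) ^ P.d := by
  have h1 : 1 - ∑ v ∈ A, sampleProb g t w v = ∑ v ∈ Aᶜ, sampleProb g t w v := by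
    rw [← sum_sampleProb g t w, ← Finset.sum_add_sum_compl A]; ring
  have h2 : 1 - ∑ v ∈ A, sampleProb g t w v - sampleProb g t w v
      = ∑ v ∈ (insert v A)ᶜ, sampleProb g t w v := by
    rw [← sum_sampleProb g t w, ← Finset.sum_add_sum_compl (insert v A), Finset.sum_insert hv]; ring
  rw [h2, h1, ← sum_prod_mul_indicator (r := P.d) Aᶜ,
    ← sum_prod_mul_indicator (r := P.d) (insert v A)ᶜ, ← Finset.sum_sub_distrib]
  refine Finset.sum_le_sum fun y _ => ?_
  rw [← mul_sub]
  refine mul_le_mul_of_nonneg_left ?_ (Finset.prod_nonneg fun j _ => sampleProb_nonneg _ _ _ _)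
  have hle : (∑ u ∈ P.best g y, if u = v then (1 : ℝ) else 0) / (P.best g y).card
      ≤ if v ∈ P.best g y then 1 else 0 := by
    rw [Finset.sum_ite_eq']
    split_ifs with hb
    · rw [div_le_one (card_best_pos g y)]
      exact_mod_cast (P.best_nonempty g y).card_pos
    · simp
  refine hle.trans ?_
  by_cases hb : v ∈ P.best g y
  · have ha : ∀ j, y j ∈ Aᶜ := by
      intro j
      rw [Finset.mem_compl]
      exact fun hj => h y ⟨j, hj⟩ hb
    have hn : ¬ ∀ j, y j ∈ (insert v A)ᶜ := by
      intro hc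
      have hb' := (Finset.mem_filter.1 hb).1
      obtain ⟨j, -, hj⟩ := Finset.mem_image.1 hb'
      have := hc j
      simp [hj] at this
    rw [if_pos hb, if_pos ha, if_neg hn, sub_zero]
  · rw [if_neg hb]
    by_cases hn : ∀ j, y j ∈ (insert v A)ᶜ
    · have ha : ∀ j, y j ∈ Aᶜ := by
        intro j
        have := hn j
        simp only [Finset.mem_compl, Finset.mem_insert, not_or] at this ⊢
        exact this.2
      rw [if_pos hn, if_pos ha, sub_self]
    · rw [if_neg hn, sub_zero]
      split_ifs <;> simp

/-- The second end of an edge is a candidate. -/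
theorem draw_congr {t : Fin P.T} {w : Fin (n + 1)} {ρ ρ' : Fin (n + 1) → ℝ}
    (h : ∀ u, sampleProb g t w u ≠ 0 → ρ u = ρ' u) : draw g t w ρ = draw g t w ρ' := by
  refine Finset.sum_congr rfl fun y _ => ?_
  by_cases h0 : ∃ j, sampleProb g t w (y j) = 0
  · obtain ⟨j, hj⟩ := h0
    rw [Finset.prod_eq_zero (Finset.mem_univ j) hj]; simp
  push Not at h0
  congr 2
  refine Finset.sum_congr rfl fun u hu => h u ?_
  obtain ⟨j, -, hj⟩ := Finset.mem_image.1 (Finset.mem_filter.1 hu).1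
  exact hj ▸ h0 j

end Params

/-! ### Weights, attachment and sampling probabilities -/

theorem weightedChoice_toReal {α : Type*} [DecidableEq α] (C : Finset α) (hC : C.Nonempty)
    (wt : α → ℝ≥0) (h : ∑ b ∈ C, wt b ≠ 0) (a : α) :
    (weightedChoice C hC wt a).toReal = if a ∈ C then (wt a : ℝ) / ∑ b ∈ C, (wt b : ℝ) else 0 := by
  rw [weightedChoice, dif_neg h, PMF.ofFinset_apply]
  split_ifs <;> simp

theorem mem_of_weightedChoice_ne_zero {α : Type*} [DecidableEq α] (C : Finset α) (hC : C.Nonempty)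
    (wt : α → ℝ≥0) {a : α} (h : weightedChoice C hC wt a ≠ 0) : a ∈ C := by
  by_contra ha
  refine h ?_
  rw [weightedChoice]
  split_ifs with h0
  · exact PMF.uniformOfFinset_apply_of_notMem hC ha
  · rw [PMF.ofFinset_apply, if_neg ha]

namespace Params

variable {P : Params} {n : ℕ} (g : TypedGraph P.T n)

/-- The weight `deg v + β` as a real number. -/
def wt (v : Fin n) : ℝ := g.deg v + P.β

/-- The vertices of type `i`. -/
def typeVerts (i : Fin P.T) : Finset (Fin n) := Finset.univ.filter fun v => g.vtype v = i

/-- The number of vertices of type `i`. -/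
def typeCount (i : Fin P.T) : ℕ := (typeVerts g i).card

/-- The total weight of the vertices of type `i`. -/
def typeWeight (i : Fin P.T) : ℝ := ∑ v ∈ typeVerts g i, wt g v

/-- The total weight of a graph with `n` vertices, which does not depend on the graph, as the number
of edges is `(m + k) * (n - 1)`. -/
def totWeight (P : Params) (n : ℕ) : ℝ := P.S * n - 2 * (P.m + P.k)

variable {g}

theorem mem_typeVerts {i : Fin P.T} {v : Fin n} : v ∈ typeVerts g i ↔ g.vtype v = i := by
  simp [typeVerts]

theorem one_le_m (P : Params) : (1 : ℝ) ≤ P.m := by exact_mod_cast P.m_pos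

theorem one_le_k (P : Params) : (1 : ℝ) ≤ P.k := by exact_mod_cast P.k_pos

theorem S_pos (P : Params) : 0 < P.S := by
  have := one_le_m P; have := one_le_k P; have := P.neg_one_lt_β
  simp only [S]; linarith

theorem wt_pos (hg : P.Regular g) (hn : 2 ≤ n) (v : Fin n) : 0 < wt g v := by
  have : (1 : ℝ) ≤ g.deg v := by exact_mod_cast hg.2 hn v
  have := P.neg_one_lt_β
  simp only [wt]; linarith

theorem coe_weight (hg : P.Regular g) (hn : 2 ≤ n) (v : Fin n) : (P.weight g v : ℝ) = wt g v :=
  Real.coe_toNNReal _ (wt_pos hg hn v).le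

theorem sum_wt (hg : P.Regular g) (hn : 2 ≤ n) : ∑ v, wt g v = totWeight P n := by
  simp only [wt, Finset.sum_add_distrib, ← Nat.cast_sum, TypedGraph.sum_deg, hg.1, totWeight, S]
  obtain ⟨l, rfl⟩ : ∃ l, n = l + 1 := ⟨n - 1, by omega⟩
  simp
  ring

theorem typeWeight_pos (hg : P.Regular g) (hn : 2 ≤ n) {i : Fin P.T} {v : Fin n}
    (hv : g.vtype v = i) : 0 < typeWeight g i :=
  Finset.sum_pos (fun v _ => wt_pos hg hn v) ⟨v, mem_typeVerts.2 hv⟩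

theorem totWeight_pos (hg : P.Regular g) (hn : 2 ≤ n) : 0 < totWeight P n := by
  rw [← sum_wt hg hn]
  exact Finset.sum_pos (fun v _ => wt_pos hg hn v) ⟨⟨0, by omega⟩, Finset.mem_univ _⟩

theorem typeWeight_le (hg : P.Regular g) (hn : 2 ≤ n) (i : Fin P.T) :
    typeWeight g i ≤ totWeight P n := by
  rw [← sum_wt hg hn]
  exact Finset.sum_le_sum_of_subset_of_nonneg (Finset.subset_univ _)
    fun v _ _ => (wt_pos hg hn v).le

theorem typeWeight_nonneg (hg : P.Regular g) (hn : 2 ≤ n) (i : Fin P.T) : 0 ≤ typeWeight g i :=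
  Finset.sum_nonneg fun v _ => (wt_pos hg hn v).le

theorem wt_le_typeWeight (hg : P.Regular g) (hn : 2 ≤ n) {i : Fin P.T} {v : Fin n}
    (hv : g.vtype v = i) : wt g v ≤ typeWeight g i :=
  Finset.single_le_sum (f := wt g) (fun v _ => (wt_pos hg hn v).le) (mem_typeVerts.2 hv)

theorem typeCount_le (i : Fin P.T) : typeCount g i ≤ n := by
  refine (Finset.card_le_univ _).trans ?_
  simp

variable [NeZero n]

theorem attachProb_eq (hg : P.Regular g) (hn : 2 ≤ n) (v : Fin n) :
    attachProb g v = wt g v / totWeight P n := by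
  have h0 : ∑ v, (P.weight g v : ℝ) = totWeight P n := by
    simp only [coe_weight hg hn, sum_wt hg hn]
  rw [attachProb, attachLaw, weightedChoice_toReal, if_pos (Finset.mem_univ v), h0,
    coe_weight hg hn]
  intro h
  have h' := congrArg (fun x : ℝ≥0 => (x : ℝ)) h
  simp only [NNReal.coe_sum, h0, NNReal.coe_zero] at h'
  exact (totWeight_pos hg hn).ne' h'

/-- The types of all vertices when the new vertex has type `t`. -/
def newTypes (g : TypedGraph P.T n) (t : Fin P.T) : Fin (n + 1) → Fin P.T :=
  Fin.snoc (α := fun _ => Fin P.T) g.vtype t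

omit [NeZero n] in
@[simp] theorem newTypes_castSucc (t : Fin P.T) (v : Fin n) :
    newTypes g t v.castSucc = g.vtype v := by simp [newTypes]

omit [NeZero n] in
@[simp] theorem newTypes_last (t : Fin P.T) : newTypes g t (Fin.last n) = t := by simp [newTypes]

omit [NeZero n] in
theorem exists_ne_of_two_le {i : Fin P.T} (h : 2 ≤ typeCount g i) (w : Fin n) :
    ∃ v, v ≠ w ∧ g.vtype v = i := by
  obtain ⟨v, hv, hvw⟩ := Finset.exists_mem_ne (Nat.lt_of_succ_le h) w
  exact ⟨v, hvw, mem_typeVerts.1 hv⟩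

theorem candidates_eq (h2 : ∀ j, 2 ≤ typeCount g j) (t : Fin P.T) (w : Fin (n + 1)) :
    P.candidates (newTypes g t) w
      = Finset.univ.filter fun v => v ≠ w ∧ newTypes g t v = newTypes g t w := by
  rw [candidates, if_pos]
  refine Fin.lastCases ?_ (fun w => ?_) w
  · obtain ⟨v, -, hv⟩ := exists_ne_of_two_le (h2 t) ⟨0, NeZero.pos n⟩
    exact ⟨v.castSucc, by simp [hv, (Fin.castSucc_lt_last v).ne]⟩
  · obtain ⟨v, hvw, hv⟩ := exists_ne_of_two_le (h2 (g.vtype w)) w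
    exact ⟨v.castSucc, by simp [hv, hvw]⟩

theorem newTypes_eq_of_sampleProb_ne_zero (h2 : ∀ j, 2 ≤ typeCount g j) {t : Fin P.T}
    {w u : Fin (n + 1)} (h : sampleProb g t w u ≠ 0) :
    u ≠ w ∧ newTypes g t u = newTypes g t w := by
  have h1 : P.sampleLaw g t w u ≠ 0 := fun h0 => h (by rw [sampleProb, h0, ENNReal.toReal_zero])
  have h3 := mem_of_weightedChoice_ne_zero _ _ _ h1
  rw [← newTypes, candidates_eq h2] at h3
  simpa using h3

theorem sum_candidates (h2 : ∀ j, 2 ≤ typeCount g j) (hg : P.Regular g) (hn : 2 ≤ n)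
    (t : Fin P.T) (w : Fin n) :
    ∑ b ∈ P.candidates (newTypes g t) w.castSucc,
      ((Fin.snoc (α := fun _ => ℝ≥0) (P.weight g) 0 b : ℝ≥0) : ℝ)
      = typeWeight g (g.vtype w) - wt g w := by
  rw [candidates_eq h2, Finset.sum_filter, Fin.sum_univ_castSucc]
  simp only [Fin.snoc_castSucc, Fin.snoc_last, NNReal.coe_zero, ite_self, add_zero,
    newTypes_castSucc, coe_weight hg hn, ne_eq, Fin.castSucc_inj]
  rw [typeWeight, ← Finset.sum_filter, eq_sub_iff_add_eq, add_comm,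
    ← Finset.add_sum_erase _ _ (mem_typeVerts.2 (rfl : g.vtype w = _))]
  congr 1
  refine Finset.sum_congr ?_ fun _ _ => rfl
  ext v
  simp [mem_typeVerts]

omit [NeZero n] in
theorem typeWeight_sub_wt_pos (h2 : ∀ j, 2 ≤ typeCount g j) (hg : P.Regular g) (hn : 2 ≤ n)
    (w : Fin n) : 0 < typeWeight g (g.vtype w) - wt g w := by
  obtain ⟨v, hvw, hv⟩ := exists_ne_of_two_le (h2 (g.vtype w)) w
  rw [typeWeight, ← Finset.add_sum_erase _ _ (mem_typeVerts.2 (rfl : g.vtype w = _)),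
    add_sub_cancel_left]
  exact Finset.sum_pos (fun v _ => wt_pos hg hn v)
    ⟨v, Finset.mem_erase.2 ⟨hvw, mem_typeVerts.2 hv⟩⟩

theorem sampleProb_castSucc (h2 : ∀ j, 2 ≤ typeCount g j) (hg : P.Regular g) (hn : 2 ≤ n)
    (t : Fin P.T) (w v : Fin n) :
    sampleProb g t w.castSucc v.castSucc = if v ≠ w ∧ g.vtype v = g.vtype w then
      wt g v / (typeWeight g (g.vtype w) - wt g w) else 0 := by
  have h0 := sum_candidates h2 hg hn t w
  rw [sampleProb, sampleLaw, weightedChoice_toReal]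
  · rw [← newTypes, h0, candidates_eq h2]
    simp [coe_weight hg hn]
  · intro h
    have h' := congrArg (fun x : ℝ≥0 => (x : ℝ)) h
    simp only [NNReal.coe_sum, NNReal.coe_zero] at h'
    rw [← newTypes, h0] at h'
    exact (typeWeight_sub_wt_pos h2 hg hn w).ne' h'

theorem sampleProb_last (h2 : ∀ j, 2 ≤ typeCount g j) (hg : P.Regular g) (hn : 2 ≤ n)
    (t : Fin P.T) (w : Fin n) : sampleProb g t w.castSucc (Fin.last n) = 0 := by
  have h0 := sum_candidates h2 hg hn t w
  rw [sampleProb, sampleLaw, weightedChoice_toReal]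
  · simp
  · intro h
    have h' := congrArg (fun x : ℝ≥0 => (x : ℝ)) h
    simp only [NNReal.coe_sum, NNReal.coe_zero] at h'
    rw [← newTypes, h0] at h'
    exact (typeWeight_sub_wt_pos h2 hg hn w).ne' h'

/-! ### One-step changes of the numbers and weights of the types -/

omit [NeZero n] in
theorem sum_typeVerts_next {M : Type*} [AddCommMonoid M] (o : P.Outcome n) (i : Fin P.T)
    (F : Fin (n + 1) → M) :
    ∑ v ∈ typeVerts (P.next g o) i, F v
      = ∑ v ∈ typeVerts g i, F v.castSucc + if o.1 = i then F (Fin.last n) else 0 := by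
  rw [typeVerts, Finset.sum_filter, Fin.sum_univ_castSucc, typeVerts, Finset.sum_filter]
  simp only [Params.next, TypedGraph.vtype_extend_castSucc, TypedGraph.vtype_extend_last]

omit [NeZero n] in
theorem typeCount_next (o : P.Outcome n) (i : Fin P.T) :
    typeCount (P.next g o) i = typeCount g i + if o.1 = i then 1 else 0 := by
  simp only [typeCount, Finset.card_eq_sum_ones]
  exact sum_typeVerts_next o i _

omit [NeZero n] in
theorem typeWeight_next (o : P.Outcome n) (i : Fin P.T) :
    typeWeight (P.next g o) i = typeWeight g i + (∑ j, if g.vtype (o.2.1 j) = i then 1 else 0)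
      + (if o.1 = i then P.m + P.β else 0)
      + ∑ l, ((if newTypes g o.1 (o.2.2 l).1 = i then 1 else 0)
        + (if newTypes g o.1 (o.2.2 l).2 = i then 1 else 0)) := by
  have h1 : ∀ a : Fin P.m → Fin n, ∑ v ∈ typeVerts g i, (TypedGraph.attachHits a v : ℝ)
      = ∑ j, if g.vtype (a j) = i then 1 else 0 := fun a => by
    simp only [TypedGraph.attachHits, Nat.cast_sum]
    rw [Finset.sum_comm]
    refine Finset.sum_congr rfl fun j _ => ?_
    simp [mem_typeVerts]
  have h3 : ∀ x : Fin (n + 1), (∑ v ∈ typeVerts g i, if x = v.castSucc then (1 : ℝ) else 0)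
      + (if o.1 = i then if x = Fin.last n then 1 else 0 else 0)
      = if newTypes g o.1 x = i then 1 else 0 := by
    intro x
    refine Fin.lastCases ?_ (fun x => ?_) x
    · simp [(Fin.castSucc_lt_last _).ne']
    · simp [mem_typeVerts, (Fin.castSucc_lt_last _).ne]
  have h2 : ∀ e : Fin P.k → Fin (n + 1) × Fin (n + 1),
      ∑ v ∈ typeVerts g i, (TypedGraph.edgeHits e v.castSucc : ℝ)
        + (if o.1 = i then (TypedGraph.edgeHits e (Fin.last n) : ℝ) else 0)
      = ∑ l, ((if newTypes g o.1 (e l).1 = i then 1 else 0)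
        + (if newTypes g o.1 (e l).2 = i then 1 else 0)) := fun e => by
    simp only [← h3]
    simp only [TypedGraph.edgeHits, Nat.cast_sum, Nat.cast_add, Nat.cast_ite, Nat.cast_one,
      Nat.cast_zero]
    rw [Finset.sum_comm]
    by_cases ht : o.1 = i
    · simp only [ht, if_true, ← Finset.sum_add_distrib]
      refine Finset.sum_congr rfl fun l _ => ?_
      rw [Finset.sum_add_distrib]; ring
    · simp only [ht, if_false, add_zero, ← Finset.sum_add_distrib]
  rw [typeWeight, sum_typeVerts_next, ← h2, ← h1, typeWeight]
  simp only [wt, Params.next, TypedGraph.deg_extend_castSucc, TypedGraph.deg_extend_last,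
    Nat.cast_add, Finset.sum_add_distrib]
  split_ifs <;> ring

theorem mean_typeWeight_next (h2 : ∀ j, 2 ≤ typeCount g j) (hg : P.Regular g) (hn : 2 ≤ n)
    (i : Fin P.T) :
    P.mean g (fun o => typeWeight (P.next g o) i) = typeWeight g i
      + P.m * (typeWeight g i / totWeight P n) + P.p i * (P.m + P.β)
      + 2 * P.k * ((typeCount g i + P.p i) / (n + 1)) := by
  simp only [typeWeight_next, mean_add, mean_const]
  congr 1
  · congr 1
    · congr 1
      rw [mean_sum_attach g fun v => if g.vtype v = i then 1 else 0]
      congr 1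
      simp only [attachProb_eq hg hn, mul_ite, mul_one, mul_zero, ← Finset.sum_filter,
        ← Finset.sum_div]
      rfl
    · rw [mean_type g fun t => if t = i then P.m + P.β else 0]
      simp
  · rw [mean_sum_edge g fun t x => (if newTypes g t x.1 = i then 1 else 0)
      + if newTypes g t x.2 = i then 1 else 0]
    have h3 : ∀ t, ∑ x, edgeProb g t x * ((if newTypes g t x.1 = i then 1 else 0)
        + if newTypes g t x.2 = i then 1 else 0)
        = (n + 1 : ℝ)⁻¹ * (2 * (typeCount g i + if t = i then 1 else 0)) := by
      intro t
      rw [sum_edgeProb_mul]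
      congr 1
      have h4 : ∀ w, draw g t w (fun u => (if newTypes g t w = i then (1 : ℝ) else 0)
          + if newTypes g t u = i then 1 else 0) = 2 * if newTypes g t w = i then 1 else 0 := by
        intro w
        rw [draw_congr (ρ' := fun _ => 2 * if newTypes g t w = i then 1 else 0), draw_const]
        intro u hu
        rw [(newTypes_eq_of_sampleProb_ne_zero h2 hu).2]
        split_ifs <;> norm_num
      simp only [h4, ← Finset.mul_sum]
      rw [Fin.sum_univ_castSucc]
      simp [typeCount, typeVerts]
    simp only [h3]
    have h5 : ∑ t, P.p t * (P.k * ((n + 1 : ℝ)⁻¹ * (2 * (typeCount g i + if t = i then 1 else 0))))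
        = (P.k * ((n + 1 : ℝ)⁻¹ * 2))
          * ∑ t, (P.p t * typeCount g i + P.p t * if t = i then 1 else 0) := by
      rw [Finset.mul_sum]
      exact Finset.sum_congr rfl fun t _ => by ring
    rw [h5, Finset.sum_add_distrib, ← Finset.sum_mul, P.p_sum]
    simp
    ring

theorem mean_typeCount_next (i : Fin P.T) :
    P.mean g (fun o => (typeCount (P.next g o) i : ℝ)) = typeCount g i + P.p i := by
  simp only [typeCount_next, Nat.cast_add, mean_add, mean_const]
  congr 1
  have := mean_type g fun t => ((if t = i then 1 else 0 : ℕ) : ℝ)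
  rw [this]; simp

end Params

/-! ### Concentration of the numbers and weights of the types -/

theorem eventually_le_rpow_of_lt (C : ℝ) {a b : ℝ} (h : a < b) :
    ∀ᶠ n : ℕ in atTop, C * (n : ℝ) ^ a ≤ (n : ℝ) ^ b := by
  have h1 : Tendsto (fun n : ℕ => (n : ℝ) ^ (b - a)) atTop atTop :=
    (tendsto_rpow_atTop (sub_pos.2 h)).comp tendsto_natCast_atTop_atTop
  filter_upwards [h1.eventually_ge_atTop C, eventually_gt_atTop 0] with n hn h0
  have h0' : (0 : ℝ) < n := by exact_mod_cast h0
  calc C * (n : ℝ) ^ a ≤ (n : ℝ) ^ (b - a) * (n : ℝ) ^ a := by gcongr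
    _ = (n : ℝ) ^ b := by rw [← Real.rpow_add h0']; ring_nf

theorem eventually_abs_le_rpow {V : ℕ → ℝ} {a b l : ℝ} (hab : a < 2 * b)
    (h : Tendsto (fun n : ℕ => V n ^ 2 / (n : ℝ) ^ a) atTop (𝓝 l)) :
    ∀ᶠ n : ℕ in atTop, |V n| ≤ (n : ℝ) ^ b := by
  filter_upwards [h.eventually_le_const (lt_add_one l), eventually_le_rpow_of_lt (l + 1) hab,
    eventually_gt_atTop 0] with n h1 h2 h0
  have h0' : (0 : ℝ) < n := by exact_mod_cast h0
  refine abs_le_of_sq_le_sq ?_ (by positivity)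
  rw [div_le_iff₀ (by positivity)] at h1
  calc V n ^ 2 ≤ (l + 1) * (n : ℝ) ^ a := h1
    _ ≤ (n : ℝ) ^ (2 * b) := h2
    _ = ((n : ℝ) ^ b) ^ 2 := by rw [← Real.rpow_natCast, ← Real.rpow_mul h0'.le]; ring_nf

/-- If the drift `D` of `V` is `ρ / 2 * (V / x)` up to an error `C * q`, then `V ^ 2` grows at a
relative rate of at most `a / x` for every `a > ρ`: the product of `V` and the error is absorbed by
completing the square. -/
theorem quadratic_drift {V D ρ a C C₁ q x : ℝ} (ha : ρ < a) (hx : 0 < x)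
    (hD : |D - ρ / 2 * (V / x)| ≤ C * q) :
    V ^ 2 + (2 * V * D + C₁) ≤ V ^ 2 * (1 + a / x) + C ^ 2 / (a - ρ) * (q ^ 2 * x) + C₁ := by
  have hκ : 0 < a - ρ := sub_pos.2 ha
  have h3 : V * (D - ρ / 2 * (V / x)) ≤ |V| * (C * q) := by
    refine (le_abs_self _).trans ?_
    rw [abs_mul]
    gcongr
  have h4 : 0 ≤ ((a - ρ) * |V| - C * q * x) ^ 2 / ((a - ρ) * x) := by positivity
  have h5 : ((a - ρ) * |V| - C * q * x) ^ 2 / ((a - ρ) * x)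
      = (a - ρ) * (|V| ^ 2 / x) + C ^ 2 / (a - ρ) * (q ^ 2 * x) - 2 * (|V| * (C * q)) := by
    generalize a - ρ = κ at hκ ⊢
    field_simp
    ring
  rw [h5, sq_abs] at h4
  have h6 : V * (D - ρ / 2 * (V / x)) = V * D - ρ / 2 * (V ^ 2 / x) := by ring
  have h7 : V ^ 2 * (1 + a / x) = V ^ 2 + a * (V ^ 2 / x) := by ring
  rw [h7]
  linarith

namespace Params

section Chain

variable {P : Params} {Ω : Type*} [mΩ : MeasurableSpace Ω] {μ : Measure Ω} [IsProbabilityMeasure μ]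
  {G : (n : ℕ) → Ω → TypedGraph P.T n}

theorem p_nonneg (P : Params) (i : Fin P.T) : 0 ≤ P.p i := (P.p_pos i).le

/-- The numbers of the types are sums of independent indicators; the square of the deviation, divided
by `n ^ (5 / 4)`, is a supermartingale up to a summable error. -/
theorem IsGraphSequence.ae_typeCount (hG : P.IsGraphSequence μ G) :
    ∀ᵐ ω ∂μ, ∀ᶠ n : ℕ in atTop, ∀ i,
      |(typeCount (G n ω) i : ℝ) - P.p i * n| ≤ (n : ℝ) ^ (2 / 3 : ℝ) := by
  suffices H : ∀ i, ∀ᵐ ω ∂μ, ∀ᶠ n : ℕ in atTop,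
      |(typeCount (G n ω) i : ℝ) - P.p i * n| ≤ (n : ℝ) ^ (2 / 3 : ℝ) by
    filter_upwards [ae_all_iff.2 H] with ω hω
    exact eventually_all.2 hω
  intro i
  have h := hG.robbins_siegmund
    (fun n g => ((typeCount g i : ℝ) - P.p i * n) ^ 2 / (n : ℝ) ^ (5 / 4 : ℝ))
    (fun _ _ => 0) (fun _ => Set.univ) (c := fun n => 1 / (n : ℝ) ^ (5 / 4 : ℝ)) 1
    (fun n g => by positivity) (fun _ _ => le_rfl) (fun n => by positivity)
    (Real.summable_one_div_nat_rpow.2 (by norm_num)) ?_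
  · filter_upwards [h] with ω hω
    obtain ⟨⟨l, hl⟩, -⟩ := hω (by simp)
    exact eventually_abs_le_rpow (by norm_num) hl
  · intro n _ hn g _ _
    have hn0 : (1 : ℝ) ≤ n := by exact_mod_cast hn
    have h1 : ∀ o : P.Outcome n, ((typeCount (P.next g o) i : ℝ) - P.p i * (n + 1 : ℕ)) ^ 2
        / ((n + 1 : ℕ) : ℝ) ^ (5 / 4 : ℝ)
        ≤ 1 / (n : ℝ) ^ (5 / 4 : ℝ) * (((typeCount g i : ℝ) - P.p i * n) ^ 2
          + (2 * ((typeCount g i : ℝ) - P.p i * n)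
            * ((typeCount (P.next g o) i : ℝ) - (typeCount g i + P.p i)) + 1)) := by
      intro o
      have h2 : ((typeCount (P.next g o) i : ℝ) - (typeCount g i + P.p i)) ^ 2 ≤ 1 := by
        rw [typeCount_next]
        have := P.p_pos i
        have := P.p_lt_one i
        split_ifs <;> push_cast <;> nlinarith
      calc _ ≤ ((typeCount (P.next g o) i : ℝ) - P.p i * (n + 1 : ℕ)) ^ 2
            / (n : ℝ) ^ (5 / 4 : ℝ) := by
            gcongr
            linarith
        _ ≤ _ := by
            rw [div_eq_mul_inv, mul_comm, ← one_div]
            gcongr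
            push_cast
            nlinarith
    refine (mean_mono g h1).trans (le_of_eq ?_)
    rw [mean_mul, mean_add, mean_const, mean_add, mean_const, mean_mul, mean_sub, mean_const,
      mean_typeCount_next]
    ring

theorem abs_typeWeight_next_sub_le {n : ℕ} (g : TypedGraph P.T n) (o : P.Outcome n)
    (i : Fin P.T) :
    |typeWeight (P.next g o) i - typeWeight g i| ≤ 2 * P.m + |P.β| + 2 * P.k := by
  have h1 : ∀ l, (0 : ℝ) ≤ ((if newTypes g o.1 (o.2.2 l).1 = i then (1 : ℝ) else 0)
        + (if newTypes g o.1 (o.2.2 l).2 = i then 1 else 0)) ∧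
      ((if newTypes g o.1 (o.2.2 l).1 = i then (1 : ℝ) else 0)
        + (if newTypes g o.1 (o.2.2 l).2 = i then 1 else 0)) ≤ 2 := fun l => by
    split_ifs <;> norm_num
  have h2 : ∀ j, (0 : ℝ) ≤ (if g.vtype (o.2.1 j) = i then (1 : ℝ) else 0) ∧
      (if g.vtype (o.2.1 j) = i then (1 : ℝ) else 0) ≤ 1 := fun j => by
    split_ifs <;> norm_num
  have h3 := Finset.sum_nonneg fun l (_ : l ∈ Finset.univ) => (h1 l).1
  have h4 := Finset.sum_le_sum fun l (_ : l ∈ Finset.univ) => (h1 l).2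
  have h5 := Finset.sum_nonneg fun l (_ : l ∈ Finset.univ) => (h2 l).1
  have h6 := Finset.sum_le_sum fun l (_ : l ∈ Finset.univ) => (h2 l).2
  simp only [Finset.sum_const, Finset.card_univ, Fintype.card_fin, nsmul_eq_mul] at h4 h6
  rw [typeWeight_next]
  have hm := one_le_m P
  have hb := abs_nonneg P.β
  have hb1 := le_abs_self P.β
  have hb2 := neg_abs_le P.β
  rw [abs_le]
  split_ifs <;> constructor <;> linarith

/-- The numbers and the weights of the types are close to their typical values. -/
def Typical {n : ℕ} (g : TypedGraph P.T n) : Prop :=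
  ∀ i, |(typeCount g i : ℝ) - P.p i * n| ≤ (n : ℝ) ^ (3 / 4 : ℝ) ∧
    |typeWeight g i - P.p i * P.S * n| ≤ (n : ℝ) ^ (3 / 4 : ℝ)

theorem eventually_two_le_typeCount (P : Params) {a : ℝ} (ha : a < 1) :
    ∀ᶠ n : ℕ in atTop, ∀ (g : TypedGraph P.T n),
    (∀ i, |(typeCount g i : ℝ) - P.p i * n| ≤ (n : ℝ) ^ a) → ∀ i, 2 ≤ typeCount g i := by
  have h1 : ∀ᶠ n : ℕ in atTop, ∀ i, (n : ℝ) ^ a + 2 ≤ P.p i * n := by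
    refine eventually_all.2 fun i => ?_
    have hp := P.p_pos i
    filter_upwards [eventually_le_rpow_of_lt (2 / P.p i) ha, eventually_ge_atTop
      (Nat.ceil (4 / P.p i))] with n h2 h3
    have h4 : 4 / P.p i ≤ n := (Nat.le_ceil _).trans (by exact_mod_cast h3)
    rw [Real.rpow_one] at h2
    rw [div_mul_eq_mul_div, div_le_iff₀ hp] at h2
    rw [div_le_iff₀ hp] at h4
    linarith
  filter_upwards [h1] with n h1 g hg i
  have h2 := (abs_le.1 (hg i)).1
  have h3 := h1 i
  have : (2 : ℝ) ≤ typeCount g i := by linarith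
  exact_mod_cast this

theorem two_m_lt_S (P : Params) : 2 * (P.m : ℝ) < P.S := by
  have := one_le_k P; have := P.neg_one_lt_β
  simp only [S]; linarith

theorem abs_mean_typeWeight_sub_le {n : ℕ} [NeZero n] {g : TypedGraph P.T n}
    (h2 : ∀ j, 2 ≤ typeCount g j) (hg : P.Regular g) (hn : 2 ≤ n)
    (hN : ∀ i, |(typeCount g i : ℝ) - P.p i * n| ≤ (n : ℝ) ^ (2 / 3 : ℝ)) (i : Fin P.T) :
    |P.mean g (fun o => typeWeight (P.next g o) i) - typeWeight g i - P.p i * P.S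
      - P.m / P.S * ((typeWeight g i - P.p i * P.S * n) / n)|
      ≤ (2 * P.m * (P.m + P.k) / P.S + 2 * P.k) * (n : ℝ) ^ (-(1 / 3) : ℝ) := by
  have hS := S_pos P
  have hn1 : (2 : ℝ) ≤ n := by exact_mod_cast hn
  have hn0 : (0 : ℝ) < n := by linarith
  have hW := typeWeight_le hg hn i
  have hW0 := typeWeight_nonneg hg hn i
  have ht := totWeight_pos hg hn
  have hm := one_le_m P
  have hk := one_le_k P
  have htot : totWeight P n = P.S * n - 2 * (P.m + P.k) := rfl
  rw [mean_typeWeight_next h2 hg hn]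
  have e : typeWeight g i + P.m * (typeWeight g i / totWeight P n) + P.p i * (P.m + P.β)
      + 2 * P.k * ((typeCount g i + P.p i) / (n + 1)) - typeWeight g i - P.p i * P.S
      - P.m / P.S * ((typeWeight g i - P.p i * P.S * n) / n)
      = P.m * (typeWeight g i / totWeight P n) * (2 * (P.m + P.k)) / (P.S * n)
        + 2 * P.k * ((typeCount g i - P.p i * n) / (n + 1)) := by
    have h3 : P.β = P.S - 2 * P.m - 2 * P.k := by simp only [S]; ring
    have h4 : 2 * (P.m + P.k) = P.S * n - totWeight P n := by rw [htot]; ring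
    rw [h4, h3]
    field_simp
    ring
  rw [e]
  have hpow : (n : ℝ) ^ (2 / 3 : ℝ) = n * (n : ℝ) ^ (-(1 / 3) : ℝ) := by
    nth_rewrite 2 [← Real.rpow_one (n : ℝ)]
    rw [← Real.rpow_add hn0]; norm_num
  have hinv : (1 : ℝ) / n ≤ (n : ℝ) ^ (-(1 / 3) : ℝ) := by
    rw [one_div, ← Real.rpow_neg_one]
    exact Real.rpow_le_rpow_of_exponent_le (by linarith) (by norm_num)
  refine (abs_add_le _ _).trans ?_
  rw [add_mul]
  gcongr
  · have hq : typeWeight g i / totWeight P n ≤ 1 := (div_le_one ht).2 hW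
    have hq0 : 0 ≤ typeWeight g i / totWeight P n := by positivity
    rw [abs_of_nonneg (by positivity)]
    calc P.m * (typeWeight g i / totWeight P n) * (2 * (P.m + P.k)) / (P.S * n)
        ≤ P.m * 1 * (2 * (P.m + P.k)) / (P.S * n) := by gcongr
      _ = 2 * P.m * (P.m + P.k) / P.S * (1 / n) := by field_simp
      _ ≤ _ := by gcongr
  · rw [abs_mul, abs_of_nonneg (by positivity : (0 : ℝ) ≤ 2 * P.k), abs_div,
      abs_of_pos (by positivity : (0 : ℝ) < n + 1)]
    gcongr
    rw [div_le_iff₀ (by positivity)]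
    refine (hN i).trans ?_
    rw [hpow]
    have : 0 ≤ (n : ℝ) ^ (-(1 / 3) : ℝ) := by positivity
    nlinarith

/-- The deviation of the weight of a type has the relative drift `m / (S * n)`, and `2 * m / S < 1`, so
that its square, divided by `n ^ (17 / 12)`, is a supermartingale up to an error of the order
`n ^ (1 / 3 - 17 / 12)`, which is summable. The term `n ^ (1 / 3)` comes from the deviation
`n ^ (2 / 3)` of the numbers of the types. -/
theorem IsGraphSequence.ae_typical (hG : P.IsGraphSequence μ G) :
    ∀ᵐ ω ∂μ, ∀ᶠ n : ℕ in atTop, Typical (G n ω) := by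
  suffices H : ∀ i, ∀ᵐ ω ∂μ, ∀ᶠ n : ℕ in atTop,
      |typeWeight (G n ω) i - P.p i * P.S * n| ≤ (n : ℝ) ^ (3 / 4 : ℝ) by
    filter_upwards [ae_all_iff.2 H, hG.ae_typeCount] with ω hω h1
    filter_upwards [eventually_all.2 hω, h1, eventually_ge_atTop 1] with n h2 h3 hn i
    refine ⟨(h3 i).trans ?_, h2 i⟩
    exact Real.rpow_le_rpow_of_exponent_le (by exact_mod_cast hn) (by norm_num)
  intro i
  obtain ⟨N, hN⟩ := eventually_atTop.1 (eventually_two_le_typeCount P (a := 2 / 3) (by norm_num))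
  have hS := S_pos P
  set ρ : ℝ := 2 * P.m / P.S with hρ
  have hρ1 : ρ < 1 := (div_lt_one hS).2 (two_m_lt_S P)
  set C : ℝ := 2 * P.m * (P.m + P.k) / P.S + 2 * P.k with hC
  have hC0 : 0 ≤ C := by positivity
  set C₁ : ℝ := (2 * P.m + |P.β| + 2 * P.k + P.p i * P.S) ^ 2 with hC1
  have hC10 : 0 ≤ C₁ := by positivity
  have hκ : 0 < 17 / 12 - ρ := by linarith
  set C₂ : ℝ := C ^ 2 / (17 / 12 - ρ) + C₁ with hC2
  have hC20 : 0 ≤ C₂ := by positivity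
  have h := hG.robbins_siegmund
    (fun n g => (typeWeight g i - P.p i * P.S * n) ^ 2 / (n : ℝ) ^ (17 / 12 : ℝ))
    (fun _ _ => 0)
    (fun n => {g | ∀ i, |(typeCount g i : ℝ) - P.p i * n| ≤ (n : ℝ) ^ (2 / 3 : ℝ)})
    (c := fun n => C₂ * (1 / (n : ℝ) ^ (13 / 12 : ℝ))) (max N 2)
    (fun n g => by positivity) (fun _ _ => le_rfl) (fun n => by positivity)
    ((Real.summable_one_div_nat_rpow.2 (by norm_num)).mul_left _) ?_
  · filter_upwards [h, hG.ae_typeCount] with ω hω h1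
    obtain ⟨⟨l, hl⟩, -⟩ := hω h1
    exact eventually_abs_le_rpow (by norm_num) hl
  · intro n _ hn g hA hg
    have hn2 : 2 ≤ n := (le_max_right _ _).trans hn
    have h2 := hN n ((le_max_left _ _).trans hn) g hA
    have hn0 : (2 : ℝ) ≤ n := by exact_mod_cast hn2
    have hn00 : (0 : ℝ) < n := by linarith
    have herr := abs_mean_typeWeight_sub_le h2 hg hn2 hA i
    set V := typeWeight g i - P.p i * P.S * n with hV
    set D := P.mean g (fun o => typeWeight (P.next g o) i) - typeWeight g i - P.p i * P.S with hD
    have h1 : ∀ o : P.Outcome n, (typeWeight (P.next g o) i - P.p i * P.S * (n + 1 : ℕ)) ^ 2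
        / ((n + 1 : ℕ) : ℝ) ^ (17 / 12 : ℝ)
        ≤ 1 / ((n + 1 : ℕ) : ℝ) ^ (17 / 12 : ℝ) * (V ^ 2
          + (2 * V * (typeWeight (P.next g o) i - (typeWeight g i + P.p i * P.S)) + C₁)) := by
      intro o
      have h2 : (typeWeight (P.next g o) i - (typeWeight g i + P.p i * P.S)) ^ 2 ≤ C₁ := by
        rw [hC1, ← sq_abs]
        refine pow_le_pow_left₀ (abs_nonneg _) ?_ 2
        rw [← sub_sub]
        refine (abs_sub _ _).trans (add_le_add (abs_typeWeight_next_sub_le g o i) (le_of_eq ?_))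
        exact abs_of_nonneg (mul_nonneg (p_nonneg P i) hS.le)
      rw [div_eq_mul_inv, mul_comm, ← one_div]
      gcongr
      push_cast
      nlinarith
    refine (mean_mono g h1).trans ?_
    rw [mean_mul, mean_add, mean_const, mean_add, mean_const, mean_mul, mean_sub, mean_const]
    have e1 : P.mean g (fun o => typeWeight (P.next g o) i) - (typeWeight g i + P.p i * P.S) = D := by
      rw [hD]; ring
    rw [e1, one_div, inv_mul_le_iff₀ (by positivity)]
    set q := (n : ℝ) ^ (-(1 / 3) : ℝ) with hq
    have hq0 : 0 ≤ q := by positivity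
    have hq2 : q ^ 2 * n = (n : ℝ) ^ (1 / 3 : ℝ) := by
      have e2 : (n : ℝ) ^ (1 / 3 : ℝ) = (n : ℝ) ^ (-(1 / 3) * 2 : ℝ) * (n : ℝ) ^ (1 : ℝ) := by
        rw [← Real.rpow_add hn00]; norm_num
      rw [e2, Real.rpow_one, hq, ← Real.rpow_natCast, ← Real.rpow_mul hn00.le]; norm_num
    have hb : 1 + 17 / 12 * (1 / (n : ℝ)) ≤ (1 + 1 / (n : ℝ)) ^ (17 / 12 : ℝ) :=
      one_add_mul_self_le_rpow_one_add (by
        have : 0 ≤ 1 / (n : ℝ) := by positivity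
        linarith) (by norm_num)
    have hb2 : ((n + 1 : ℕ) : ℝ) ^ (17 / 12 : ℝ)
        = (n : ℝ) ^ (17 / 12 : ℝ) * (1 + 1 / (n : ℝ)) ^ (17 / 12 : ℝ) := by
      rw [← Real.mul_rpow hn00.le (by positivity)]
      congr 1; push_cast; field_simp
    have hq' := quadratic_drift (a := 17 / 12) (ρ := ρ) (C₁ := C₁) (by linarith) hn00 (by
      rw [show ρ / 2 = P.m / P.S by rw [hρ]; ring]; exact herr)
    rw [hq2] at hq'
    have h13 : (1 : ℝ) ≤ (n : ℝ) ^ (1 / 3 : ℝ) := Real.one_le_rpow (by linarith) (by norm_num)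
    have hfin : V ^ 2 + (2 * V * D + C₁)
        ≤ (V ^ 2 + C₂ * (n : ℝ) ^ (1 / 3 : ℝ)) * (1 + 17 / 12 * (1 / (n : ℝ))) := by
      refine hq'.trans ?_
      have h7 : 0 ≤ C₂ * (n : ℝ) ^ (1 / 3 : ℝ) * (17 / 12 * (1 / (n : ℝ))) := by positivity
      have h8 : C₁ ≤ C₁ * (n : ℝ) ^ (1 / 3 : ℝ) := le_mul_of_one_le_right hC10 h13
      have h9 : C₂ * (n : ℝ) ^ (1 / 3 : ℝ) = C ^ 2 / (17 / 12 - ρ) * (n : ℝ) ^ (1 / 3 : ℝ)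
        + C₁ * (n : ℝ) ^ (1 / 3 : ℝ) := by rw [hC2]; ring
      have h10 : (V ^ 2 + C₂ * (n : ℝ) ^ (1 / 3 : ℝ)) * (1 + 17 / 12 * (1 / (n : ℝ)))
          = V ^ 2 * (1 + 17 / 12 / n) + C₂ * (n : ℝ) ^ (1 / 3 : ℝ)
            + C₂ * (n : ℝ) ^ (1 / 3 : ℝ) * (17 / 12 * (1 / (n : ℝ))) := by ring
      rw [h10]
      linarith
    refine hfin.trans ?_
    have hpow : (n : ℝ) ^ (1 / 3 : ℝ) = (n : ℝ) ^ (17 / 12 : ℝ) * (1 / (n : ℝ) ^ (13 / 12 : ℝ)) := by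
      rw [mul_one_div, ← Real.rpow_sub hn00]; norm_num
    have e3 : ((n + 1 : ℕ) : ℝ) ^ (17 / 12 : ℝ) * (V ^ 2 / (n : ℝ) ^ (17 / 12 : ℝ) - 0
        + C₂ * (1 / (n : ℝ) ^ (13 / 12 : ℝ)))
        = (V ^ 2 + C₂ * (n : ℝ) ^ (1 / 3 : ℝ)) * (1 + 1 / (n : ℝ)) ^ (17 / 12 : ℝ) := by
      rw [hb2, hpow]
      field_simp
      ring
    rw [e3]
    gcongr

end Chain

end Params

/-! ### The probability that the best of a sample lies in a given set -/

/-- The quotient of `1 - (1 - y) ^ d`, the probability that a sample of size `d` hits a set of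
probability `y`, by `y`. -/
def hitRatio (d : ℕ) (y : ℝ) : ℝ := ∑ j ∈ Finset.range d, (1 - y) ^ j

theorem mul_hitRatio (d : ℕ) (y : ℝ) : y * hitRatio d y = 1 - (1 - y) ^ d := by
  have := mul_neg_geom_sum (1 - y) d
  rwa [sub_sub_cancel] at this

theorem hitRatio_anti {d : ℕ} {x y : ℝ} (hxy : x ≤ y) (hy : y ≤ 1) :
    hitRatio d y ≤ hitRatio d x :=
  Finset.sum_le_sum fun j _ => pow_le_pow_left₀ (by linarith) (by linarith) j

theorem hitRatio_nonneg {d : ℕ} {y : ℝ} (hy : y ≤ 1) : 0 ≤ hitRatio d y :=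
  Finset.sum_nonneg fun j _ => pow_nonneg (by linarith) j

theorem hitRatio_zero (d : ℕ) : hitRatio d 0 = d := by simp [hitRatio]

theorem hitRatio_le {d : ℕ} {y : ℝ} (h0 : 0 ≤ y) (hy : y ≤ 1) : hitRatio d y ≤ d := by
  rw [← hitRatio_zero]; exact hitRatio_anti h0 hy

theorem hit_mono {d : ℕ} {x y : ℝ} (hxy : x ≤ y) (hy : y ≤ 1) :
    1 - (1 - x) ^ d ≤ 1 - (1 - y) ^ d := by
  have := pow_le_pow_left₀ (by linarith) (by linarith : 1 - y ≤ 1 - x) d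
  linarith

theorem hit_nonneg {d : ℕ} {y : ℝ} (h0 : 0 ≤ y) (hy : y ≤ 1) : 0 ≤ 1 - (1 - y) ^ d := by
  rw [← mul_hitRatio]; exact mul_nonneg h0 (hitRatio_nonneg hy)

theorem hit_le_one {d : ℕ} {y : ℝ} (hy : y ≤ 1) : 1 - (1 - y) ^ d ≤ 1 := by
  have := pow_nonneg (by linarith : 0 ≤ 1 - y) d
  linarith

namespace Params

variable {P : Params} {n : ℕ} {g : TypedGraph P.T n} {i : Fin P.T}

theorem deg_le_maxDegree {v : Fin n} (hv : g.vtype v = i) : g.deg v ≤ g.maxDegree i :=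
  Finset.le_sup (f := g.deg) (by simpa using hv)

theorem exists_deg_eq_maxDegree (h : 0 < typeCount g i) :
    ∃ u, g.vtype u = i ∧ g.deg u = g.maxDegree i := by
  obtain ⟨u, hu, h1⟩ := Finset.exists_mem_eq_sup (typeVerts g i) (Finset.card_pos.1 h) g.deg
  exact ⟨u, mem_typeVerts.1 hu, h1.symm⟩

theorem deg_next_castSucc (o : P.Outcome n) (v : Fin n) :
    (P.next g o).deg v.castSucc
      = g.deg v + TypedGraph.attachHits o.2.1 v + TypedGraph.edgeHits o.2.2 v.castSucc :=
  TypedGraph.deg_extend_castSucc _ _ _ _ _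

theorem vtype_next_castSucc (o : P.Outcome n) (v : Fin n) :
    (P.next g o).vtype v.castSucc = g.vtype v := TypedGraph.vtype_extend_castSucc _ _ _ _ _

theorem deg_next_le_maxDegree (o : P.Outcome n) {v : Fin n} (hv : g.vtype v = i) :
    g.deg v + TypedGraph.attachHits o.2.1 v + TypedGraph.edgeHits o.2.2 v.castSucc
      ≤ (P.next g o).maxDegree i := by
  rw [← deg_next_castSucc (g := g)]
  exact deg_le_maxDegree ((vtype_next_castSucc o v).trans hv)

theorem maxDegree_le_next (o : P.Outcome n) : g.maxDegree i ≤ (P.next g o).maxDegree i := by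
  refine Finset.sup_le fun v hv => ?_
  have := deg_next_le_maxDegree (g := g) o (mem_typeVerts.1 hv : g.vtype v = i)
  omega

theorem maxDegree_next_le (o : P.Outcome n) :
    (P.next g o).maxDegree i ≤ g.maxDegree i + (P.m + 2 * P.k) := by
  refine Finset.sup_le fun v hv => ?_
  have hv' := mem_typeVerts.1 hv
  revert hv'
  refine Fin.lastCases (fun _ => ?_) (fun v hv' => ?_) v
  · have := TypedGraph.edgeHits_le o.2.2 (Fin.last n)
    rw [Params.next, TypedGraph.deg_extend_last]; omega
  · rw [vtype_next_castSucc] at hv'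
    have := deg_le_maxDegree hv'
    have := TypedGraph.edgeHits_le o.2.2 v.castSucc
    have := TypedGraph.attachHits_le o.2.1 v
    rw [deg_next_castSucc]; omega

theorem one_le_maxDegree (hg : P.Regular g) (hn : 2 ≤ n) (h : 0 < typeCount g i) :
    1 ≤ g.maxDegree i := by
  obtain ⟨u, -, hu⟩ := exists_deg_eq_maxDegree h
  rw [← hu]; exact hg.2 hn u

/-- The vertices of highest degree among those of type `i`. -/
def leaders (g : TypedGraph P.T n) (i : Fin P.T) : Finset (Fin n) :=
  (typeVerts g i).filter fun v => g.deg v = g.maxDegree i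

theorem mem_leaders {v : Fin n} : v ∈ leaders g i ↔ g.vtype v = i ∧ g.deg v = g.maxDegree i := by
  simp [leaders, mem_typeVerts]

theorem wt_leader {v : Fin n} (hv : v ∈ leaders g i) : wt g v = g.maxDegree i + P.β := by
  rw [wt, (mem_leaders.1 hv).2]

theorem oldDeg_castSucc (v : Fin n) : P.oldDeg g v.castSucc = g.deg v := by simp [oldDeg]

variable [NeZero n]

theorem exists_castSucc_of_sampleProb_ne_zero (h2 : ∀ j, 2 ≤ typeCount g j) (hg : P.Regular g) (hn : 2 ≤ n) {t : Fin P.T}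
    {w : Fin n} (hw : g.vtype w = i) {u : Fin (n + 1)} (hu : sampleProb g t w.castSucc u ≠ 0) :
    ∃ v, u = Fin.castSucc v ∧ g.vtype v = i ∧ v ≠ w := by
  revert hu
  refine Fin.lastCases (fun hu => ?_) (fun v hu => ?_) u
  · exact absurd (sampleProb_last h2 hg hn t w) hu
  · have h3 := newTypes_eq_of_sampleProb_ne_zero h2 hu
    simp only [newTypes_castSucc] at h3
    exact ⟨v, rfl, h3.2.trans hw, fun h => h3.1 (by rw [h])⟩

theorem best_subset_leaders (h2 : ∀ j, 2 ≤ typeCount g j) (hg : P.Regular g) (hn : 2 ≤ n)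
    {t : Fin P.T} {w : Fin n} (hw : g.vtype w = i) {y : Fin P.d → Fin (n + 1)}
    (hy : ∀ j, sampleProb g t w.castSucc (y j) ≠ 0)
    (hA : ∃ j, y j ∈ (leaders g i).map Fin.castSuccEmb) :
    P.best g y ⊆ (leaders g i).map Fin.castSuccEmb := by
  intro u hu
  obtain ⟨hu1, hu2⟩ := Finset.mem_filter.1 hu
  obtain ⟨l, -, rfl⟩ := Finset.mem_image.1 hu1
  obtain ⟨v, hv, hvi, -⟩ := exists_castSucc_of_sampleProb_ne_zero h2 hg hn hw (hy l)
  obtain ⟨j, hj⟩ := hA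
  obtain ⟨z, hz, hzj⟩ := Finset.mem_map.1 hj
  have h3 := hu2 j
  rw [← hzj, hv] at h3
  simp only [Fin.coe_castSuccEmb, oldDeg_castSucc, (mem_leaders.1 hz).2] at h3
  rw [hv]
  exact Finset.mem_map.2 ⟨v, mem_leaders.2 ⟨hvi, le_antisymm (deg_le_maxDegree hvi) h3⟩, rfl⟩

theorem sum_sampleProb_map (h2 : ∀ j, 2 ≤ typeCount g j) (hg : P.Regular g) (hn : 2 ≤ n)
    (t : Fin P.T) {w : Fin n} (hw : g.vtype w = i) {A : Finset (Fin n)}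
    (hA : A ⊆ typeVerts g i) (hwA : w ∉ A) :
    ∑ v ∈ A.map Fin.castSuccEmb, sampleProb g t w.castSucc v
      = (∑ v ∈ A, wt g v) / (typeWeight g i - wt g w) := by
  rw [Finset.sum_map, Finset.sum_div]
  refine Finset.sum_congr rfl fun v hv => ?_
  rw [Fin.coe_castSuccEmb, sampleProb_castSucc h2 hg hn, if_pos, hw]
  exact ⟨fun h => hwA (h ▸ hv), (mem_typeVerts.1 (hA hv)).trans hw.symm⟩

theorem sum_sampleProb_le_one (t : Fin P.T) (w : Fin (n + 1)) (A : Finset (Fin (n + 1))) :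
    ∑ v ∈ A, sampleProb g t w v ≤ 1 := by
  rw [← sum_sampleProb g t w]
  exact Finset.sum_le_sum_of_subset_of_nonneg (Finset.subset_univ _)
    fun _ _ _ => sampleProb_nonneg _ _ _ _

/-- If an edge of the edge step starts in a vertex of type `i` outside a set `A` of leaders, and the
sample meets `A`, then the edge ends in a leader. -/
theorem le_sum_edgeProb_leaders (h2 : ∀ j, 2 ≤ typeCount g j) (hg : P.Regular g) (hn : 2 ≤ n)
    (t : Fin P.T) {A : Finset (Fin n)} (hA : A ⊆ leaders g i) :
    ((typeCount g i : ℝ) - A.card) / (n + 1)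
        * (1 - (1 - (∑ v ∈ A, wt g v) / typeWeight g i) ^ P.d)
      ≤ ∑ x, edgeProb g t x *
        if x.2 ∈ (leaders g i).map Fin.castSuccEmb then 1 else 0 := by
  have hAi : A ⊆ typeVerts g i := hA.trans (Finset.filter_subset _ _)
  rw [sum_edgeProb_mul, div_mul_eq_mul_div, div_eq_inv_mul]
  refine mul_le_mul_of_nonneg_left ?_ (by positivity)
  rw [Fin.sum_univ_castSucc]
  refine le_add_of_le_of_nonneg ?_ (draw_nonneg g fun u => by split_ifs <;> simp)
  have hc : (typeCount g i : ℝ) - A.card = ((typeVerts g i) \ A).card := by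
    rw [Finset.card_sdiff_of_subset hAi, Nat.cast_sub (Finset.card_le_card hAi), typeCount]
  rw [hc, ← nsmul_eq_mul, ← Finset.sum_const]
  refine (Finset.sum_le_sum fun w hw => ?_).trans (Finset.sum_le_sum_of_subset_of_nonneg
    (Finset.subset_univ (typeVerts g i \ A)) fun w _ _ => draw_nonneg g fun u => by
      split_ifs <;> simp)
  obtain ⟨hw1, hwA⟩ := Finset.mem_sdiff.1 hw
  have hwi := mem_typeVerts.1 hw1
  refine le_trans ?_ (le_draw_indicator g t w.castSucc (A.map Fin.castSuccEmb) _
    fun y hy hyA => best_subset_leaders h2 hg hn hwi hy ?_)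
  · refine hit_mono ?_ (sum_sampleProb_le_one _ _ _)
    rw [sum_sampleProb_map h2 hg hn t hwi hAi hwA]
    have hpos := typeWeight_sub_wt_pos h2 hg hn w
    rw [hwi] at hpos
    refine div_le_div_of_nonneg_left (Finset.sum_nonneg fun v _ => (wt_pos hg hn v).le) hpos ?_
    linarith [wt_pos hg hn w]
  · obtain ⟨j, hj⟩ := hyA
    exact ⟨j, Finset.map_subset_map.2 hA hj⟩

/-- Upper bound for the probability that an edge of the edge step ends in `v`. The summand `3`
accounts for the edges that start in the new vertex, and for the fact that the first end `w` is no
candidate: this raises the share of `v` by a factor of at most `1 + 2 * wt g w / typeWeight g i`. -/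
theorem sum_edgeProb_le (h2 : ∀ j, 2 ≤ typeCount g j) (hg : P.Regular g) (hn : 2 ≤ n)
    (t : Fin P.T) {v : Fin n} (hv : g.vtype v = i) :
    ∑ x, edgeProb g t x * (if x.2 = v.castSucc then 1 else 0)
      ≤ (typeCount g i * (1 - (1 - wt g v / typeWeight g i) ^ P.d) + 3) / (n + 1) := by
  rw [sum_edgeProb_mul, div_eq_inv_mul]
  refine mul_le_mul_of_nonneg_left ?_ (by positivity)
  rw [Fin.sum_univ_castSucc]
  have hlast : draw g t (Fin.last n) (fun u => if u = v.castSucc then 1 else 0) ≤ 1 :=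
    draw_le_one g fun u => by split_ifs <;> simp
  have hW := typeWeight_pos hg hn hv
  have hy0 : 0 ≤ wt g v / typeWeight g i := div_nonneg (wt_pos hg hn v).le hW.le
  have hy1 : wt g v / typeWeight g i ≤ 1 := (div_le_one hW).2 (wt_le_typeWeight hg hn hv)
  have hh0 := hit_nonneg (d := P.d) hy0 hy1
  have hh1 := hit_le_one (d := P.d) hy1
  have key : ∀ w : Fin n, draw g t w.castSucc (fun u => if u = v.castSucc then 1 else 0)
      ≤ if g.vtype w = i then (1 - (1 - wt g v / typeWeight g i) ^ P.d)
        + 2 * (wt g w / typeWeight g i) else 0 := by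
    intro w
    have hww : 0 ≤ wt g w / typeWeight g i := div_nonneg (wt_pos hg hn w).le hW.le
    by_cases hwi : g.vtype w = i
    · rw [if_pos hwi]
      by_cases hwv : w = v
      · rw [draw_congr (ρ' := fun _ => 0), draw_const]
        · positivity
        · intro u hu
          have := (newTypes_eq_of_sampleProb_ne_zero h2 hu).1
          rw [if_neg (by rw [← hwv]; exact this)]
      -- a vertex with more than half of the weight is treated separately, as the share of `v` among
      -- the other vertices is not controlled by its share among all vertices
      · by_cases hbig : typeWeight g i < 2 * wt g w
        · have h1 : draw g t w.castSucc (fun u => if u = v.castSucc then 1 else 0) ≤ 1 :=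
            draw_le_one g fun u => by split_ifs <;> simp
          have h3 : 1 ≤ 2 * (wt g w / typeWeight g i) := by
            rw [← mul_div_assoc, le_div_iff₀ hW]; linarith
          linarith
        · push Not at hbig
          refine (draw_single_le g t w.castSucc v.castSucc ∅ (by simp) (by simp)).trans ?_
          have hs : sampleProb g t w.castSucc v.castSucc = wt g v / (typeWeight g i - wt g w) := by
            rw [sampleProb_castSucc h2 hg hn, if_pos ⟨Ne.symm hwv, hv.trans hwi.symm⟩, hwi]
          have hs1 : sampleProb g t w.castSucc v.castSucc ≤ 1 := by
            have := sum_sampleProb_le_one (g := g) t w.castSucc {v.castSucc}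
            simpa using this
          simp only [Finset.sum_empty, sub_zero, one_pow]
          have hpos := typeWeight_sub_wt_pos h2 hg hn w
          rw [hwi] at hpos
          set y := wt g v / typeWeight g i with hy
          set z := sampleProb g t w.castSucc v.castSucc with hz
          have hyz : y ≤ z := by
            rw [hs, hy]
            exact div_le_div_of_nonneg_left (wt_pos hg hn v).le hpos (by linarith [wt_pos hg hn w])
          have hzy : z ≤ y * (1 + 2 * (wt g w / typeWeight g i)) := by
            rw [hs, hy, div_mul_eq_mul_div, div_le_div_iff₀ hpos hW]
            have h5 : wt g v * typeWeight g i ≤ wt g v * ((1 + 2 * (wt g w / typeWeight g i))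
                * (typeWeight g i - wt g w)) := by
              refine mul_le_mul_of_nonneg_left ?_ (wt_pos hg hn v).le
              have h6 : (1 + 2 * (wt g w / typeWeight g i)) * (typeWeight g i - wt g w)
                = typeWeight g i + wt g w * (typeWeight g i - 2 * wt g w) / typeWeight g i := by
                field_simp; ring
              rw [h6]
              have : 0 ≤ wt g w * (typeWeight g i - 2 * wt g w) / typeWeight g i :=
                div_nonneg (mul_nonneg (wt_pos hg hn w).le (by linarith)) hW.le
              linarith
            linarith
          calc 1 - (1 - z) ^ P.d = z * hitRatio P.d z := (mul_hitRatio _ _).symm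
            _ ≤ (y * (1 + 2 * (wt g w / typeWeight g i))) * hitRatio P.d y :=
                mul_le_mul hzy (hitRatio_anti hyz hs1) (hitRatio_nonneg hs1) (by positivity)
            _ = (1 - (1 - y) ^ P.d) * (1 + 2 * (wt g w / typeWeight g i)) := by
                rw [← mul_hitRatio]; ring
            _ ≤ _ := by nlinarith
    · rw [if_neg hwi, draw_congr (ρ' := fun _ => 0), draw_const]
      intro u hu
      have := (newTypes_eq_of_sampleProb_ne_zero h2 hu).2
      rw [if_neg]
      rintro rfl
      simp only [newTypes_castSucc] at this
      exact hwi (this.symm.trans hv)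
  have hsum := Finset.sum_le_sum fun w (_ : w ∈ Finset.univ) => key w
  rw [← Finset.sum_filter, Finset.sum_add_distrib, ← Finset.mul_sum, ← Finset.sum_div,
    Finset.sum_const, nsmul_eq_mul] at hsum
  have e1 : (∑ w with g.vtype w = i, wt g w) / typeWeight g i = 1 := div_self hW.ne'
  rw [e1] at hsum
  have e2 : ((Finset.univ.filter fun w => g.vtype w = i).card : ℝ) = typeCount g i := rfl
  rw [e2] at hsum
  linarith

/-! ### One-step drifts of degrees -/

theorem mean_one_sub (ψ : P.Outcome n → ℝ) :
    P.mean g (fun o => 1 - ψ o) = 1 - P.mean g ψ := by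
  rw [mean_sub, mean_const]

theorem mean_attachHits (hg : P.Regular g) (hn : 2 ≤ n) (v : Fin n) :
    P.mean g (fun o => (TypedGraph.attachHits o.2.1 v : ℝ)) = P.m * (wt g v / totWeight P n) := by
  have := mean_sum_attach g fun u => ((if u = v then 1 else 0 : ℕ) : ℝ)
  simp only [TypedGraph.attachHits, Nat.cast_sum]
  rw [this]
  simp [attachProb_eq hg hn]

theorem mean_edge_le {ρ : Fin P.T → Fin (n + 1) × Fin (n + 1) → ℝ} {b : ℝ}
    (h : ∀ t, ∑ x, edgeProb g t x * ρ t x ≤ b) :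
    P.mean g (fun o => ∑ l, ρ o.1 (o.2.2 l)) ≤ P.k * b := by
  rw [mean_sum_edge]
  calc ∑ t, P.p t * (P.k * ∑ x, edgeProb g t x * ρ t x) ≤ ∑ t, P.p t * (P.k * b) :=
        Finset.sum_le_sum fun t _ => mul_le_mul_of_nonneg_left
          (mul_le_mul_of_nonneg_left (h t) (Nat.cast_nonneg _)) (P.p_pos t).le
    _ = P.k * b := by rw [← Finset.sum_mul, P.p_sum, one_mul]

theorem le_mean_edge {ρ : Fin P.T → Fin (n + 1) × Fin (n + 1) → ℝ} {b : ℝ}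
    (h : ∀ t, b ≤ ∑ x, edgeProb g t x * ρ t x) :
    P.k * b ≤ P.mean g (fun o => ∑ l, ρ o.1 (o.2.2 l)) := by
  rw [mean_sum_edge]
  calc P.k * b = ∑ t, P.p t * (P.k * b) := by rw [← Finset.sum_mul, P.p_sum, one_mul]
    _ ≤ ∑ t, P.p t * (P.k * ∑ x, edgeProb g t x * ρ t x) :=
        Finset.sum_le_sum fun t _ => mul_le_mul_of_nonneg_left
          (mul_le_mul_of_nonneg_left (h t) (Nat.cast_nonneg _)) (P.p_pos t).le

theorem mean_edgeHits_le (h2 : ∀ j, 2 ≤ typeCount g j) (hg : P.Regular g) (hn : 2 ≤ n)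
    {v : Fin n} (hv : g.vtype v = i) :
    P.mean g (fun o => (TypedGraph.edgeHits o.2.2 v.castSucc : ℝ))
      ≤ P.k * ((typeCount g i * (1 - (1 - wt g v / typeWeight g i) ^ P.d) + 4) / (n + 1)) := by
  have hb : ∀ t, ∑ x, edgeProb g t x * (((if x.1 = v.castSucc then 1 else 0)
      + (if x.2 = v.castSucc then 1 else 0) : ℕ) : ℝ)
      ≤ (typeCount g i * (1 - (1 - wt g v / typeWeight g i) ^ P.d) + 4) / (n + 1) := by
    intro t
    have h3 := sum_edgeProb_le h2 hg hn t hv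
    have h4 : ∑ x, edgeProb g t x * (if x.1 = v.castSucc then 1 else 0) = 1 / (n + 1) := by
      rw [sum_edgeProb_mul, Finset.sum_congr rfl fun w _ =>
        draw_const g t w (if w = v.castSucc then 1 else 0)]
      simp
    simp only [Nat.cast_add, Nat.cast_ite, Nat.cast_one, Nat.cast_zero, mul_add,
      Finset.sum_add_distrib]
    rw [h4]
    refine (add_le_add_right h3 _).trans (le_of_eq ?_)
    rw [← add_div]; ring
  have := mean_edge_le (g := g) hb
  simpa only [TypedGraph.edgeHits, Nat.cast_sum] using this

/-- Upper bound for the drift of the degree of any vertex. -/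
theorem mean_deg_sub_le (h2 : ∀ j, 2 ≤ typeCount g j) (hg : P.Regular g) (hn : 2 ≤ n)
    {v : Fin n} (hv : g.vtype v = i) :
    P.mean g (fun o => ((P.next g o).deg v.castSucc : ℝ) - g.deg v)
      ≤ P.m * (wt g v / totWeight P n)
        + P.k * ((typeCount g i * (1 - (1 - wt g v / typeWeight g i) ^ P.d) + 4) / (n + 1)) := by
  have e : (fun o : P.Outcome n => ((P.next g o).deg v.castSucc : ℝ) - g.deg v)
      = fun o => (TypedGraph.attachHits o.2.1 v : ℝ) + TypedGraph.edgeHits o.2.2 v.castSucc := by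
    funext o; rw [deg_next_castSucc]; push_cast; ring
  rw [e, mean_add, mean_attachHits hg hn]
  exact add_le_add_right (mean_edgeHits_le h2 hg hn hv) _

/-- Lower bound for the drift of the highest degree, from the vertex step alone. -/
theorem le_mean_maxDegree_sub (hg : P.Regular g) (hn : 2 ≤ n) (hi : 0 < typeCount g i) :
    P.m * ((g.maxDegree i + P.β) / totWeight P n)
      ≤ P.mean g (fun o => ((P.next g o).maxDegree i : ℝ) - g.maxDegree i) := by
  obtain ⟨u, hu, hu'⟩ := exists_deg_eq_maxDegree hi
  have h1 := mean_attachHits hg hn u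
  rw [wt, hu'] at h1
  rw [← h1]
  refine mean_mono g fun o => ?_
  have h := deg_next_le_maxDegree o hu
  have : g.maxDegree i + TypedGraph.attachHits o.2.1 u ≤ (P.next g o).maxDegree i := by omega
  have : ((g.maxDegree i + TypedGraph.attachHits o.2.1 u : ℕ) : ℝ)
    ≤ ((P.next g o).maxDegree i : ℕ) := by exact_mod_cast this
  push_cast at this
  linarith

/-- Lower bound for the drift of the highest degree if there is a single leader. -/
theorem le_mean_maxDegree_sub_of_leaders_eq (h2 : ∀ j, 2 ≤ typeCount g j) (hg : P.Regular g)
    (hn : 2 ≤ n) {u : Fin n} (hu : leaders g i = {u}) :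
    P.m * ((g.maxDegree i + P.β) / totWeight P n)
      + P.k * (((typeCount g i : ℝ) - 1) / (n + 1)
        * (1 - (1 - (g.maxDegree i + P.β) / typeWeight g i) ^ P.d))
      ≤ P.mean g (fun o => ((P.next g o).maxDegree i : ℝ) - g.maxDegree i) := by
  have hul : u ∈ leaders g i := by rw [hu]; exact Finset.mem_singleton_self u
  have hui := (mem_leaders.1 hul).1
  have hb : ∀ t, ((typeCount g i : ℝ) - 1) / (n + 1)
        * (1 - (1 - (g.maxDegree i + P.β) / typeWeight g i) ^ P.d)
      ≤ ∑ x, edgeProb g t x * (if x.2 = u.castSucc then 1 else 0) := by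
    intro t
    have := le_sum_edgeProb_leaders h2 hg hn t (Finset.Subset.refl (leaders g i))
    rw [hu] at this
    simpa [wt_leader hul] using this
  have h3 := le_mean_edge (g := g) hb
  have h1 := mean_attachHits hg hn u
  rw [wt_leader hul] at h1
  rw [← h1]
  refine (add_le_add_right h3 _).trans ?_
  rw [← mean_add]
  refine mean_mono g fun o => ?_
  have h := deg_next_le_maxDegree o hui
  rw [(mem_leaders.1 hul).2] at h
  have h4 : (∑ l, if (o.2.2 l).2 = u.castSucc then 1 else 0)
      ≤ TypedGraph.edgeHits o.2.2 u.castSucc := by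
    exact Finset.sum_le_sum fun l _ => Nat.le_add_left _ _
  have h5 : ((g.maxDegree i + TypedGraph.attachHits o.2.1 u
      + ∑ l, if (o.2.2 l).2 = u.castSucc then 1 else 0 : ℕ) : ℝ)
    ≤ ((P.next g o).maxDegree i : ℕ) := by exact_mod_cast (by omega)
  push_cast at h5
  linarith

/-- Lower bound for the drift of the highest degree if there are two leaders: it suffices that one
of the edges hits one of them. -/
theorem le_mean_maxDegree_sub_of_two_leaders (h2 : ∀ j, 2 ≤ typeCount g j) (hg : P.Regular g)
    (hn : 2 ≤ n) {u v : Fin n} (hu : u ∈ leaders g i) (hv : v ∈ leaders g i) (huv : u ≠ v) :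
    1 - (1 - 2 * ((g.maxDegree i + P.β) / totWeight P n)) ^ P.m
      * (1 - ((typeCount g i : ℝ) - 2) / (n + 1)
        * (1 - (1 - 2 * ((g.maxDegree i + P.β) / typeWeight g i)) ^ P.d)) ^ P.k
      ≤ P.mean g (fun o => ((P.next g o).maxDegree i : ℝ) - g.maxDegree i) := by
  set A : Finset (Fin n) := {u, v} with hA
  have hAl : A ⊆ leaders g i := by
    intro x hx
    rcases Finset.mem_insert.1 hx with rfl | hx
    · exact hu
    · exact (Finset.mem_singleton.1 hx) ▸ hv
  set B := (leaders g i).map Fin.castSuccEmb with hB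
  have hsumA : ∑ x ∈ A, wt g x = 2 * (g.maxDegree i + P.β) := by
    rw [hA, Finset.sum_pair huv, wt_leader hu, wt_leader hv]; ring
  have hcard : (A.card : ℝ) = 2 := by rw [hA, Finset.card_pair huv]; norm_num
  set b : ℝ := ((typeCount g i : ℝ) - 2) / (n + 1)
        * (1 - (1 - 2 * ((g.maxDegree i + P.β) / typeWeight g i)) ^ P.d) with hb
  have hbt : ∀ t, b ≤ ∑ x, edgeProb g t x * if x.2 ∈ B then 1 else 0 := by
    intro t
    have := le_sum_edgeProb_leaders h2 hg hn t hAl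
    rwa [hcard, hsumA, mul_div_assoc] at this
  have hprod := mean_prod g (fun x => if x ∈ A then (0 : ℝ) else 1)
    (fun _ x => if x.2 ∈ B then (0 : ℝ) else 1)
  have e1 : ∑ x, attachProb g x * (if x ∈ A then (0 : ℝ) else 1)
      = 1 - 2 * ((g.maxDegree i + P.β) / totWeight P n) := by
    have e2 : ∀ x, attachProb g x * (if x ∈ A then (0 : ℝ) else 1)
        = attachProb g x - if x ∈ A then attachProb g x else 0 := fun x => by split_ifs <;> simp
    simp only [e2, Finset.sum_sub_distrib, sum_attachProb, Finset.sum_ite_mem, Finset.univ_inter]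
    simp only [attachProb_eq hg hn, ← Finset.sum_div, hsumA, mul_div_assoc]
  have e3 : ∀ t, ∑ x, edgeProb g t x * (if x.2 ∈ B then (0 : ℝ) else 1)
      = 1 - ∑ x, edgeProb g t x * if x.2 ∈ B then 1 else 0 := by
    intro t
    rw [eq_sub_iff_add_eq, ← Finset.sum_add_distrib]
    refine (Finset.sum_congr rfl fun x _ => ?_).trans (sum_edgeProb g t)
    split_ifs <;> simp
  have ha0 : 0 ≤ 1 - 2 * ((g.maxDegree i + P.β) / totWeight P n) := by
    rw [← e1]
    exact Finset.sum_nonneg fun x _ => mul_nonneg (attachProb_nonneg _ _) (by split_ifs <;> simp)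
  have hub : P.mean g (fun o => (∏ j, if o.2.1 j ∈ A then (0 : ℝ) else 1)
      * ∏ l, if (o.2.2 l).2 ∈ B then (0 : ℝ) else 1)
      ≤ (1 - 2 * ((g.maxDegree i + P.β) / totWeight P n)) ^ P.m * (1 - b) ^ P.k := by
    rw [hprod, e1]
    calc _ ≤ ∑ t, P.p t * ((1 - 2 * ((g.maxDegree i + P.β) / totWeight P n)) ^ P.m
          * (1 - b) ^ P.k) := by
          refine Finset.sum_le_sum fun t _ => mul_le_mul_of_nonneg_left ?_ (P.p_pos t).le
          refine mul_le_mul_of_nonneg_left ?_ (pow_nonneg ha0 _)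
          refine pow_le_pow_left₀ (Finset.sum_nonneg fun x _ =>
            mul_nonneg (edgeProb_nonneg _ _ _) (by split_ifs <;> simp)) ?_ _
          rw [e3]
          linarith [hbt t]
      _ = _ := by rw [← Finset.sum_mul, P.p_sum, one_mul]
  refine (sub_le_sub_left hub 1).trans ?_
  rw [← mean_one_sub]
  refine mean_mono g fun o => ?_
  have hle : (g.maxDegree i : ℝ) ≤ (P.next g o).maxDegree i := by
    exact_mod_cast maxDegree_le_next o
  by_cases h1 : ∃ j, o.2.1 j ∈ A
  · obtain ⟨j, hj⟩ := h1
    rw [Finset.prod_eq_zero (Finset.mem_univ j) (by simp [hj]), zero_mul, sub_zero]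
    have hx := mem_leaders.1 (hAl hj)
    have h4 := deg_next_le_maxDegree o hx.1
    rw [hx.2] at h4
    have h5 : 1 ≤ TypedGraph.attachHits o.2.1 (o.2.1 j) := by
      refine le_trans ?_ (Finset.single_le_sum (fun _ _ => Nat.zero_le _) (Finset.mem_univ j))
      simp
    have h6 : ((g.maxDegree i + 1 : ℕ) : ℝ) ≤ ((P.next g o).maxDegree i : ℕ) := by
      exact_mod_cast (by omega)
    push_cast at h6; linarith
  · by_cases h3 : ∃ l, (o.2.2 l).2 ∈ B
    · obtain ⟨l, hl⟩ := h3
      rw [Finset.prod_eq_zero (s := Finset.univ) (i := l)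
        (f := fun l => if (o.2.2 l).2 ∈ B then (0 : ℝ) else 1) (Finset.mem_univ l) (by simp [hl]),
        mul_zero, sub_zero]
      obtain ⟨x, hx, hxl⟩ := Finset.mem_map.1 hl
      have hx := mem_leaders.1 hx
      have h4 := deg_next_le_maxDegree o hx.1
      rw [hx.2] at h4
      have h5 : 1 ≤ TypedGraph.edgeHits o.2.2 x.castSucc := by
        refine le_trans ?_ (Finset.single_le_sum (fun _ _ => Nat.zero_le _) (Finset.mem_univ l))
        rw [← hxl]
        simp
      have h6 : ((g.maxDegree i + 1 : ℕ) : ℝ) ≤ ((P.next g o).maxDegree i : ℕ) := by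
        exact_mod_cast (by omega)
      push_cast at h6; linarith
    · rw [Finset.prod_eq_one, Finset.prod_eq_one]
      · linarith
      · intro l _
        rw [if_neg fun h => h3 ⟨l, h⟩]
      · intro j _
        rw [if_neg fun h => h1 ⟨j, h⟩]

end Params

/-! ### Asymptotic form of the drifts -/

theorem pow_sub_pow_le {a b : ℝ} (h0 : 0 ≤ b) (hab : b ≤ a) (ha : a ≤ 1) (j : ℕ) :
    a ^ j - b ^ j ≤ j * (a - b) := by
  induction j with
  | zero => simp
  | succ j ih =>
    have h1 : a ^ j ≤ 1 := pow_le_one₀ (h0.trans hab) ha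
    have h2 : a ^ (j + 1) - b ^ (j + 1) = a ^ j * (a - b) + b * (a ^ j - b ^ j) := by ring
    have h3 : 0 ≤ a ^ j - b ^ j := sub_nonneg.2 (pow_le_pow_left₀ h0 hab j)
    rw [h2]
    push_cast
    have h4 : a ^ j * (a - b) ≤ 1 * (a - b) := mul_le_mul_of_nonneg_right h1 (by linarith)
    have h5 : b * (a ^ j - b ^ j) ≤ 1 * (a ^ j - b ^ j) :=
      mul_le_mul_of_nonneg_right (by linarith) h3
    linarith

theorem hitRatio_sub_le {d : ℕ} {x y : ℝ} (h0 : 0 ≤ x) (hxy : x ≤ y) (hy : y ≤ 1) :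
    hitRatio d x - hitRatio d y ≤ (d : ℝ) ^ 2 * (y - x) := by
  rw [hitRatio, hitRatio, ← Finset.sum_sub_distrib]
  calc ∑ j ∈ Finset.range d, ((1 - x) ^ j - (1 - y) ^ j)
      ≤ ∑ j ∈ Finset.range d, (d : ℝ) * (y - x) := by
        refine Finset.sum_le_sum fun j hj => ?_
        have h1 := pow_sub_pow_le (a := 1 - x) (b := 1 - y) (by linarith) (by linarith)
          (by linarith) j
        have h2 : (j : ℝ) ≤ d := by exact_mod_cast (Finset.mem_range.1 hj).le
        refine h1.trans ?_
        rw [show 1 - x - (1 - y) = y - x by ring]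
        exact mul_le_mul_of_nonneg_right h2 (by linarith)
    _ = (d : ℝ) ^ 2 * (y - x) := by simp; ring

theorem sub_sq_le_one_sub_exp_neg {x : ℝ} (hx : 0 ≤ x) : x - x ^ 2 ≤ 1 - Real.exp (-x) := by
  have h1 : Real.exp (-x) ≤ 1 / (1 + x) := by
    rw [Real.exp_neg, ← one_div]
    exact one_div_le_one_div_of_le (by linarith) (by linarith [Real.add_one_le_exp x])
  have h2 : 1 / (1 + x) ≤ 1 - x + x ^ 2 := by
    rw [div_le_iff₀ (by linarith)]
    nlinarith [pow_nonneg hx 3]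
  linarith

/-- Lower bound for the probability that one of `m + k` independent trials succeeds, in terms of the
expected number of successes. -/
theorem sub_sq_le_one_sub_pow_mul_pow {a b x : ℝ} {m k : ℕ} (ha : a ≤ 1) (hb : b ≤ 1)
    (hx : 0 ≤ x) (h : x ≤ m * a + k * b) : x - x ^ 2 ≤ 1 - (1 - a) ^ m * (1 - b) ^ k := by
  refine (sub_sq_le_one_sub_exp_neg hx).trans ?_
  have h1 : ∀ (c : ℝ) (j : ℕ), c ≤ 1 → (1 - c) ^ j ≤ Real.exp (-(j * c)) := fun c j hc => by
    have := pow_le_pow_left₀ (by linarith) (Real.one_sub_le_exp_neg c) j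
    rwa [← Real.exp_nat_mul, mul_neg] at this
  have h2 : (1 - a) ^ m * (1 - b) ^ k ≤ Real.exp (-(m * a)) * Real.exp (-(k * b)) :=
    mul_le_mul (h1 a m ha) (h1 b k hb) (pow_nonneg (by linarith) _) (Real.exp_pos _).le
  rw [← Real.exp_add] at h2
  have h3 : Real.exp (-(m * a) + -(k * b)) ≤ Real.exp (-x) := Real.exp_le_exp.2 (by linarith)
  linarith

namespace Params

/-- The factor by which the drift of the degree of a vertex exceeds `deg / n`, if its weight is the
fraction `y` of the total weight of its type and it beats all other vertices of the sample. -/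
def growth (P : Params) (y : ℝ) : ℝ := (P.m + P.k * hitRatio P.d y) / P.S

variable {P : Params} {n : ℕ} {g : TypedGraph P.T n} {i : Fin P.T}

theorem growth_zero (P : Params) : P.growth 0 = P.r := by
  rw [growth, hitRatio_zero, r, mul_comm (P.k : ℝ)]

theorem growth_anti {x y : ℝ} (hxy : x ≤ y) (hy : y ≤ 1) : P.growth y ≤ P.growth x := by
  have := S_pos P
  unfold growth
  have := hitRatio_anti (d := P.d) hxy hy
  gcongr

theorem growth_le_r {y : ℝ} (h0 : 0 ≤ y) (hy : y ≤ 1) : P.growth y ≤ P.r := by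
  rw [← growth_zero]; exact growth_anti h0 hy

theorem growth_sub_le {x y : ℝ} (h0 : 0 ≤ x) (hxy : x ≤ y) (hy : y ≤ 1) :
    P.growth x - P.growth y ≤ P.k * (P.d : ℝ) ^ 2 / P.S * (y - x) := by
  have hS := S_pos P
  have h1 := hitRatio_sub_le (d := P.d) h0 hxy hy
  rw [growth, growth, ← sub_div, div_mul_eq_mul_div]
  gcongr
  have := mul_le_mul_of_nonneg_left h1 (Nat.cast_nonneg (α := ℝ) P.k)
  linarith

theorem r_pos (P : Params) : 0 < P.r := by
  have := S_pos P; have := one_le_m P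
  unfold r; positivity

/-- The typical relative error of the numbers and weights of the types. -/
def relErr (n : ℕ) : ℝ := (n : ℝ) ^ (-(1 / 4) : ℝ)

theorem relErr_nonneg (n : ℕ) : 0 ≤ relErr n := by unfold relErr; positivity

theorem tendsto_relErr : Tendsto relErr atTop (𝓝 0) :=
  (tendsto_rpow_neg_atTop (by norm_num)).comp tendsto_natCast_atTop_atTop

theorem mul_relErr (hn : 1 ≤ n) : (n : ℝ) * relErr n = (n : ℝ) ^ (3 / 4 : ℝ) := by
  have hn0 : (0 : ℝ) < n := by exact_mod_cast hn
  have e : (n : ℝ) ^ (3 / 4 : ℝ) = (n : ℝ) ^ (1 : ℝ) * (n : ℝ) ^ (-(1 / 4) : ℝ) := by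
    rw [← Real.rpow_add hn0]; norm_num
  rw [e, Real.rpow_one, relErr]

theorem one_le_mul_relErr (hn : 1 ≤ n) : 1 ≤ (n : ℝ) * relErr n := by
  rw [mul_relErr hn]
  exact Real.one_le_rpow (by exact_mod_cast hn) (by norm_num)

theorem Typical.count (ht : Typical g) (hn : 1 ≤ n) (i : Fin P.T) :
    (P.p i - relErr n) * n ≤ typeCount g i ∧ (typeCount g i : ℝ) ≤ (P.p i + relErr n) * n := by
  have h := abs_le.1 (ht i).1
  rw [← mul_relErr hn] at h
  constructor <;> linarith [h.1, h.2]

theorem Typical.weight (ht : Typical g) (hn : 1 ≤ n) (i : Fin P.T) :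
    (P.p i * P.S - relErr n) * n ≤ typeWeight g i ∧
      typeWeight g i ≤ (P.p i * P.S + relErr n) * n := by
  have h := abs_le.1 (ht i).2
  rw [← mul_relErr hn] at h
  constructor <;> linarith [h.1, h.2]

theorem Typical.sub_two_div (ht : Typical g) (hn : 1 ≤ n) (i : Fin P.T) {a : ℝ} (ha : a ≤ 2) :
    P.p i - 4 * relErr n ≤ ((typeCount g i : ℝ) - a) / (n + 1) := by
  have h1 := (ht.count hn i).1
  have h2 := one_le_mul_relErr hn
  have h3 := relErr_nonneg n
  have h4 := P.p_lt_one i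
  rw [le_div_iff₀ (by positivity)]
  nlinarith

theorem eventually_typical (P : Params) : ∀ᶠ n : ℕ in atTop, ∀ g : TypedGraph P.T n,
    Typical g → ∀ j, 2 ≤ typeCount g j := by
  filter_upwards [eventually_two_le_typeCount P (a := 3 / 4) (by norm_num)] with n h g hg
  exact h g fun i => (hg i).1

theorem eventually_relErr_le (P : Params) {c : ℝ} (hc : 0 < c) :
    ∀ᶠ n : ℕ in atTop, ∀ i, relErr n ≤ c * P.p i ∧ relErr n ≤ c * (P.p i * P.S) := by
  refine eventually_all.2 fun i => ?_
  have h1 : 0 < c * P.p i := mul_pos hc (P.p_pos i)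
  have h2 : 0 < c * (P.p i * P.S) := mul_pos hc (mul_pos (P.p_pos i) (S_pos P))
  exact (tendsto_relErr.eventually_le_const h1).and (tendsto_relErr.eventually_le_const h2)

/-- The share of a vertex of degree `D` in the weight of its type is at least about
`D / (p i * S * n)`. -/
theorem Typical.le_share (ht : Typical g) (hn : 2 ≤ n) (hW : 0 < typeWeight g i)
    {D : ℝ} (hD : 1 ≤ D) :
    D / (P.p i * P.S * n) * ((1 - 1 / D) * (1 - relErr n / (P.p i * P.S)))
      ≤ (D + P.β) / typeWeight g i := by
  have hS := S_pos P
  have hp := P.p_pos i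
  have hn0 : (0 : ℝ) < n := by exact_mod_cast (by omega : 0 < n)
  have hβ := P.neg_one_lt_β
  have hε := relErr_nonneg n
  have hw := (ht.weight (by omega) i).2
  set q := P.p i * P.S with hq
  have hq0 : 0 < q := mul_pos hp hS
  have h1 : (D - 1) / ((q + relErr n) * n) ≤ (D + P.β) / typeWeight g i :=
    div_le_div₀ (by linarith) (by linarith) hW hw
  refine le_trans ?_ h1
  have h2 : D / (q * n) * ((1 - 1 / D) * (1 - relErr n / q))
      = (D - 1) / n * ((q - relErr n) / (q * q)) := by
    field_simp
  have h3 : (D - 1) / ((q + relErr n) * n) = (D - 1) / n * (1 / (q + relErr n)) := by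
    field_simp
  rw [h2, h3]
  refine mul_le_mul_of_nonneg_left ?_ (div_nonneg (by linarith) hn0.le)
  rw [div_le_div_iff₀ (by positivity) (by positivity)]
  nlinarith

theorem le_attach_share (hg : P.Regular g) (hn : 2 ≤ n) {D : ℝ} (hD : 1 ≤ D) :
    D / n * ((1 - 1 / D) / P.S) ≤ (D + P.β) / totWeight P n := by
  have hS := S_pos P
  have hn0 : (0 : ℝ) < n := by exact_mod_cast (by omega : 0 < n)
  have hβ := P.neg_one_lt_β
  have h1 : (D - 1) / (P.S * n) ≤ (D + P.β) / totWeight P n := by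
    refine div_le_div₀ (by linarith) (by linarith) (totWeight_pos hg hn) ?_
    have := one_le_m P; have := one_le_k P
    unfold totWeight; linarith
  refine le_trans (le_of_eq ?_) h1
  field_simp

theorem one_sub_three_le {a b c : ℝ} (ha : 0 ≤ a) (hb : 0 ≤ b) (hc : 0 ≤ c) (ha1 : a ≤ 1) :
    1 - a - b - c ≤ (1 - a) * ((1 - b) * (1 - c)) := by
  have h1 : 1 - b - c ≤ (1 - b) * (1 - c) := by nlinarith
  nlinarith [mul_nonneg ha hb, mul_nonneg ha hc]

variable [NeZero n]

/-- Constant in the error term of `le_of_single_leader`. -/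
def lowerErr (P : Params) (i : Fin P.T) : ℝ :=
  P.m / P.S + P.k * P.d / P.S * (1 + 4 / P.p i + 1 / (P.p i * P.S))

/-- The drift of the highest degree is the drift of the degree of the leader, if there is only one. -/
theorem le_of_single_leader (ht : Typical g) (h2 : ∀ j, 2 ≤ typeCount g j) (hg : P.Regular g)
    (hn : 2 ≤ n) (hε : relErr n ≤ 1 / 4 * P.p i ∧ relErr n ≤ 1 / 4 * (P.p i * P.S)) {u : Fin n}
    (hu : leaders g i = {u}) (hM : (g.maxDegree i : ℝ) ≤ P.p i * P.S * n) :
    (g.maxDegree i : ℝ) / n * (P.growth (g.maxDegree i / (P.p i * P.S * n))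
        - P.lowerErr i * (relErr n + 1 / g.maxDegree i))
      ≤ P.mean g (fun o => ((P.next g o).maxDegree i : ℝ) - g.maxDegree i) := by
  refine le_trans ?_ (le_mean_maxDegree_sub_of_leaders_eq h2 hg hn hu)
  have hS := S_pos P
  have hp := P.p_pos i
  have hn0 : (0 : ℝ) < n := by exact_mod_cast (by omega : 0 < n)
  have hul : u ∈ leaders g i := by rw [hu]; exact Finset.mem_singleton_self u
  have hW := typeWeight_pos hg hn (mem_leaders.1 hul).1
  have hM1 : (1 : ℝ) ≤ g.maxDegree i := by
    exact_mod_cast one_le_maxDegree hg hn (by have := h2 i; omega)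
  have hz1 : (g.maxDegree i + P.β) / typeWeight g i ≤ 1 := by
    rw [← wt_leader hul, div_le_one hW]
    exact wt_le_typeWeight hg hn (mem_leaders.1 hul).1
  have hz := ht.le_share (i := i) hn hW hM1
  have ha := le_attach_share hg hn hM1
  have hν := ht.sub_two_div (by omega) i (a := 1) (by norm_num)
  set M : ℝ := (g.maxDegree i : ℝ) with hMd
  set ε := relErr n with hεd
  have hε0 : 0 ≤ ε := relErr_nonneg n
  set q := P.p i * P.S with hq
  have hq0 : 0 < q := mul_pos hp hS
  set y := M / (q * n) with hy
  have hy0 : 0 ≤ y := by positivity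
  have hy1 : y ≤ 1 := by rw [hy, div_le_one (by positivity)]; exact hM
  have hMi : 1 / M ≤ 1 := by rw [div_le_one (by linarith)]; exact hM1
  have hMi0 : 0 ≤ 1 / M := by positivity
  have hεq : ε / q ≤ 1 := by rw [div_le_one hq0]; linarith [hε.2]
  have hεq0 : 0 ≤ ε / q := by positivity
  set z₀ := y * ((1 - 1 / M) * (1 - ε / q)) with hz0
  have hz00 : 0 ≤ z₀ := mul_nonneg hy0 (mul_nonneg (by linarith) (by linarith))
  have hz0y : z₀ ≤ y := by
    refine mul_le_of_le_one_right hy0 (mul_le_one₀ (by linarith) (by linarith) (by linarith))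
  have hh : z₀ * hitRatio P.d y ≤ 1 - (1 - (M + P.β) / typeWeight g i) ^ P.d := by
    refine le_trans ?_ (hit_mono hz hz1)
    rw [← mul_hitRatio]
    exact mul_le_mul_of_nonneg_left (hitRatio_anti hz0y hy1) hz00
  have hH0 : 0 ≤ hitRatio P.d y := hitRatio_nonneg hy1
  have hHd : hitRatio P.d y ≤ P.d := hitRatio_le hy0 hy1
  have hν' : (P.p i - 4 * ε) * (z₀ * hitRatio P.d y)
      ≤ ((typeCount g i : ℝ) - 1) / (n + 1) * (1 - (1 - (M + P.β) / typeWeight g i) ^ P.d) :=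
    mul_le_mul hν hh (mul_nonneg hz00 hH0) (le_trans (by linarith [hε.1]) hν)
  have e1 : (P.p i - 4 * ε) * (z₀ * hitRatio P.d y)
      = M / n * ((1 - 4 * ε / P.p i) * ((1 - 1 / M) * (1 - ε / q)) * hitRatio P.d y / P.S) := by
    have e2 : y = M / n * (1 / (P.p i * P.S)) := by
      rw [hy, hq]; field_simp
    rw [hz0, e2]
    field_simp
  have h3 : 1 - 4 * ε / P.p i - 1 / M - ε / q
      ≤ (1 - 4 * ε / P.p i) * ((1 - 1 / M) * (1 - ε / q)) := by
    refine one_sub_three_le (by positivity) hMi0 hεq0 ?_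
    rw [div_le_one hp]; linarith [hε.1]
  calc M / n * (P.growth y - P.lowerErr i * (ε + 1 / M))
      ≤ M / n * (P.m * ((1 - 1 / M) / P.S)
        + P.k * ((1 - 4 * ε / P.p i - 1 / M - ε / q) * hitRatio P.d y / P.S)) := by
        refine mul_le_mul_of_nonneg_left ?_ (by positivity)
        rw [growth, lowerErr]
        have h4 : 0 ≤ 4 * ε / P.p i + 1 / M + ε / q := by positivity
        have h5 : (4 * ε / P.p i + 1 / M + ε / q) * hitRatio P.d y
          ≤ (4 * ε / P.p i + 1 / M + ε / q) * P.d := mul_le_mul_of_nonneg_left hHd h4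
        have h6 : 4 * ε / P.p i + 1 / M + ε / q ≤ (1 + 4 / P.p i + 1 / q) * (ε + 1 / M) := by
          have : (1 + 4 / P.p i + 1 / q) * (ε + 1 / M) = 4 * ε / P.p i + 1 / M + ε / q
            + (ε + 4 / P.p i * (1 / M) + 1 / q * (1 / M)) := by ring
          have : 0 ≤ ε + 4 / P.p i * (1 / M) + 1 / q * (1 / M) := by positivity
          linarith
        have h7 : P.k / P.S * ((4 * ε / P.p i + 1 / M + ε / q) * hitRatio P.d y)
            ≤ P.k / P.S * ((1 + 4 / P.p i + 1 / q) * (ε + 1 / M) * P.d) := by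
          refine mul_le_mul_of_nonneg_left (h5.trans ?_) (by positivity)
          exact mul_le_mul_of_nonneg_right h6 (Nat.cast_nonneg _)
        have h8 : 0 ≤ P.m / P.S * ε := by positivity
        have e3 : (P.m + P.k * hitRatio P.d y) / P.S
            - (P.m / P.S + P.k * P.d / P.S * (1 + 4 / P.p i + 1 / q)) * (ε + 1 / M)
            = P.m / P.S + P.k / P.S * hitRatio P.d y - P.m / P.S * ε - P.m / P.S * (1 / M)
              - P.k / P.S * ((1 + 4 / P.p i + 1 / q) * (ε + 1 / M) * P.d) := by ring
        have e4 : P.m * ((1 - 1 / M) / P.S)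
            + P.k * ((1 - 4 * ε / P.p i - 1 / M - ε / q) * hitRatio P.d y / P.S)
            = P.m / P.S - P.m / P.S * (1 / M) + P.k / P.S * hitRatio P.d y
              - P.k / P.S * ((4 * ε / P.p i + 1 / M + ε / q) * hitRatio P.d y) := by ring
        rw [e3, e4]
        linarith
    _ ≤ M / n * (P.m * ((1 - 1 / M) / P.S)
        + P.k * ((1 - 4 * ε / P.p i) * ((1 - 1 / M) * (1 - ε / q)) * hitRatio P.d y / P.S)) := by
        gcongr
    _ = P.m * (M / n * ((1 - 1 / M) / P.S)) + P.k * ((P.p i - 4 * ε) * (z₀ * hitRatio P.d y)) := by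
        rw [e1]; ring
    _ ≤ _ := by gcongr

set_option maxHeartbeats 400000 in
-- a long chain of explicit estimates
/-- If there are two leaders, the expected number of edges that hit one of them is almost twice
`r * M / n`. As the highest degree is small in comparison with `n`, the highest degree increases with
almost this probability; the bound `3 / 2 * (r * M / n)` leaves room for the losses. -/
theorem le_of_two_leaders (ht : Typical g) (h2 : ∀ j, 2 ≤ typeCount g j) (hg : P.Regular g)
    (hn : 2 ≤ n) (hε : relErr n ≤ 1 / 64 * P.p i ∧ relErr n ≤ 1 / 64 * (P.p i * P.S)) {u v : Fin n}
    (hu : u ∈ leaders g i) (hv : v ∈ leaders g i) (huv : u ≠ v) (hM16 : 16 ≤ g.maxDegree i)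
    (hM : (g.maxDegree i : ℝ) * (32 * P.d) ≤ P.p i * P.S * n)
    (hM' : 9 / 2 * (P.r * (g.maxDegree i / n)) ≤ 1) :
    P.r * (g.maxDegree i / n)
      ≤ P.mean g (fun o => ((P.next g o).maxDegree i : ℝ) - g.maxDegree i) := by
  refine le_trans ?_ (le_mean_maxDegree_sub_of_two_leaders h2 hg hn hu hv huv)
  have hS := S_pos P
  have hp := P.p_pos i
  have hr := r_pos P
  have hn0 : (0 : ℝ) < n := by exact_mod_cast (by omega : 0 < n)
  have hW := typeWeight_pos hg hn (mem_leaders.1 hu).1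
  have hM1 : (16 : ℝ) ≤ g.maxDegree i := by exact_mod_cast hM16
  have hz1 : 2 * ((g.maxDegree i + P.β) / typeWeight g i) ≤ 1 := by
    rw [← mul_div_assoc, div_le_one hW]
    have h3 : wt g u + wt g v ≤ typeWeight g i := by
      rw [← Finset.sum_pair huv]
      refine Finset.sum_le_sum_of_subset_of_nonneg ?_ fun x _ _ => (wt_pos hg hn x).le
      intro x hx
      rcases Finset.mem_insert.1 hx with rfl | hx
      · exact mem_typeVerts.2 (mem_leaders.1 hu).1
      · exact (Finset.mem_singleton.1 hx) ▸ mem_typeVerts.2 (mem_leaders.1 hv).1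
    rw [wt_leader hu, wt_leader hv] at h3
    linarith
  have ha1 : 2 * ((g.maxDegree i + P.β) / totWeight P n) ≤ 1 := by
    refine le_trans ?_ hz1
    have h0 : (0 : ℝ) ≤ g.maxDegree i + P.β := by linarith [P.neg_one_lt_β]
    have := div_le_div_of_nonneg_left h0 hW (typeWeight_le hg hn i)
    linarith
  have hz := ht.le_share (i := i) hn hW (by linarith : (1 : ℝ) ≤ g.maxDegree i)
  have ha := le_attach_share hg hn (by linarith : (1 : ℝ) ≤ g.maxDegree i)
  have hν := ht.sub_two_div (by omega) i (a := 2) le_rfl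
  have hν1 : ((typeCount g i : ℝ) - 2) / (n + 1) ≤ 1 := by
    rw [div_le_one (by positivity)]
    have : (typeCount g i : ℝ) ≤ n := by exact_mod_cast typeCount_le i
    linarith
  set M : ℝ := (g.maxDegree i : ℝ) with hMd
  set ε := relErr n with hεd
  have hε0 : 0 ≤ ε := relErr_nonneg n
  set q := P.p i * P.S with hq
  have hq0 : 0 < q := mul_pos hp hS
  have hd : (2 : ℝ) ≤ P.d := by exact_mod_cast P.one_lt_d
  set y := M / (q * n) with hy
  have hy0 : 0 < y := by positivity
  have hyd : P.d * y ≤ 1 / 32 := by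
    rw [hy, ← mul_div_assoc, div_le_iff₀ (by positivity)]; linarith
  have hMi : 1 / M ≤ 1 / 16 := one_div_le_one_div_of_le (by norm_num) hM1
  have hεq : ε / q ≤ 1 / 64 := by rw [div_le_iff₀ hq0]; exact hε.2
  set z₀ := y * (2 * (15 / 16) * (15 / 16)) with hz0
  have hz00 : 0 < z₀ := by positivity
  have hz0' : z₀ ≤ 2 * ((M + P.β) / typeWeight g i) := by
    have h3 : y * ((15 / 16) * (15 / 16)) ≤ y * ((1 - 1 / M) * (1 - ε / q)) := by
      gcongr <;> linarith
    rw [hz0]; linarith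
  have hz0d : P.d * z₀ ≤ 1 / 16 := by
    rw [hz0]
    nlinarith
  have hz01 : z₀ ≤ 1 := hz0'.trans hz1
  have hH : 15 / 16 * (P.d : ℝ) ≤ hitRatio P.d z₀ := by
    have h3 := hitRatio_sub_le (d := P.d) le_rfl hz00.le hz01
    rw [hitRatio_zero] at h3
    nlinarith
  have hh : z₀ * (15 / 16 * P.d) ≤ 1 - (1 - 2 * ((M + P.β) / typeWeight g i)) ^ P.d := by
    refine le_trans ?_ (hit_mono hz0' hz1)
    rw [← mul_hitRatio]
    gcongr
  set b := ((typeCount g i : ℝ) - 2) / (n + 1)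
    * (1 - (1 - 2 * ((M + P.β) / typeWeight g i)) ^ P.d) with hb
  have hb1 : b ≤ 1 :=
    mul_le_one₀ hν1 (le_trans (by positivity) hh) (hit_le_one hz1)
  have hbl : 15 / 16 * P.p i * (z₀ * (15 / 16 * P.d)) ≤ b := by
    refine mul_le_mul (le_trans ?_ hν) hh (by positivity)
      (le_trans (by linarith [hε.1] : (0 : ℝ) ≤ P.p i - 4 * ε) hν)
    linarith [hε.1]
  have hx : 3 / 2 * (P.r * (M / n)) ≤ P.m * (2 * ((M + P.β) / totWeight P n)) + P.k * b := by
    have h3 : P.m * (2 * (M / n * ((15 / 16) / P.S)))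
        ≤ P.m * (2 * ((M + P.β) / totWeight P n)) := by
      refine mul_le_mul_of_nonneg_left (mul_le_mul_of_nonneg_left (le_trans ?_ ha) (by norm_num))
        (Nat.cast_nonneg _)
      gcongr
      linarith
    have h4 : P.k * (15 / 16 * P.p i * (z₀ * (15 / 16 * P.d))) ≤ P.k * b := by gcongr
    have e1 : P.k * (15 / 16 * P.p i * (z₀ * (15 / 16 * P.d)))
        = M / n * (P.k * P.d / P.S) * (2 * (15 / 16) ^ 4) := by
      rw [hz0, hy, hq]; field_simp
    have e2 : P.r * (M / n) = M / n * (P.m / P.S) + M / n * (P.k * P.d / P.S) := by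
      rw [r]; ring
    have e3 : P.m * (2 * (M / n * ((15 / 16) / P.S))) = M / n * (P.m / P.S) * (15 / 8) := by ring
    have h5 : 0 ≤ M / n * (P.m / P.S) := by positivity
    have h6 : 0 ≤ M / n * (P.k * P.d / P.S) := by positivity
    rw [e1] at h4
    rw [e3] at h3
    rw [e2]
    linarith
  have hx0 : 0 ≤ P.r * (M / n) := by positivity
  refine le_trans ?_ (sub_sq_le_one_sub_pow_mul_pow ha1 hb1 (by positivity) hx)
  linarith [mul_nonneg hx0 (by linarith : 0 ≤ 1 - 9 / 2 * (P.r * (M / n)))]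

/-- Lower bound for the drift of the highest degree, if there is a single leader or if the highest
degree is below a small multiple of `n`. -/
theorem eventually_le_mean_maxDegree_sub (P : Params) (i : Fin P.T) :
    ∃ δ : ℝ, 0 < δ ∧ ∀ᶠ n : ℕ in atTop, ∀ [NeZero n], ∀ g : TypedGraph P.T n,
      P.Regular g → Typical g → 16 ≤ g.maxDegree i →
      (g.maxDegree i : ℝ) ≤ P.p i * P.S * n →
      ((g.maxDegree i : ℝ) ≤ δ * n ∨ (leaders g i).card = 1) →
      (g.maxDegree i : ℝ) / n * (P.growth (g.maxDegree i / (P.p i * P.S * n))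
          - P.lowerErr i * (relErr n + 1 / g.maxDegree i))
        ≤ P.mean g (fun o => ((P.next g o).maxDegree i : ℝ) - g.maxDegree i) := by
  have hS := S_pos P
  have hp := P.p_pos i
  have hr := r_pos P
  have hd : (2 : ℝ) ≤ P.d := by exact_mod_cast P.one_lt_d
  refine ⟨min (P.p i * P.S / (32 * P.d)) (2 / (9 * P.r)), by positivity, ?_⟩
  filter_upwards [eventually_typical P, eventually_relErr_le P (c := 1 / 64) (by norm_num),
    eventually_ge_atTop 2] with n h1 h2 hn _ g hg ht hM16 hM hor
  have hn0 : (0 : ℝ) < n := by exact_mod_cast (by omega : 0 < n)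
  have h2' := h1 g ht
  obtain ⟨u, hu, hu'⟩ := exists_deg_eq_maxDegree (g := g) (i := i) (by have := h2' i; omega)
  have hul : u ∈ leaders g i := mem_leaders.2 ⟨hu, hu'⟩
  by_cases hex : ∃ v ∈ leaders g i, v ≠ u
  · obtain ⟨v, hv, hvu⟩ := hex
    have hM2 : (g.maxDegree i : ℝ) ≤ min (P.p i * P.S / (32 * P.d)) (2 / (9 * P.r)) * n := by
      refine hor.resolve_right fun h3 => hvu ?_
      obtain ⟨w, hw⟩ := Finset.card_eq_one.1 h3
      rw [hw, Finset.mem_singleton] at hv hul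
      rw [hv, hul]
    have hy0 : (0 : ℝ) ≤ g.maxDegree i / (P.p i * P.S * n) := by positivity
    have hy1 : g.maxDegree i / (P.p i * P.S * n) ≤ 1 := by
      rw [div_le_one (by positivity)]; exact hM
    refine le_trans ?_ (le_of_two_leaders ht h2' hg hn (h2 i) hul hv hvu.symm hM16 ?_ ?_)
    · rw [mul_comm P.r]
      refine mul_le_mul_of_nonneg_left ?_ (by positivity)
      have h3 := growth_le_r (P := P) hy0 hy1
      have h4 : 0 ≤ P.lowerErr i * (relErr n + 1 / g.maxDegree i) := by
        have := relErr_nonneg n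
        unfold lowerErr; positivity
      linarith
    · have h3 := hM2.trans (mul_le_mul_of_nonneg_right (min_le_left _ _) hn0.le)
      rw [div_mul_eq_mul_div, le_div_iff₀ (by positivity)] at h3
      exact h3
    · have h3 := hM2.trans (mul_le_mul_of_nonneg_right (min_le_right _ _) hn0.le)
      rw [div_mul_eq_mul_div, le_div_iff₀ (by positivity)] at h3
      rw [← mul_div_assoc, ← mul_div_assoc, div_le_one hn0]
      linarith
  · push Not at hex
    refine le_of_single_leader ht h2' hg hn ⟨(h2 i).1.trans ?_, (h2 i).2.trans ?_⟩
      (Finset.eq_singleton_iff_unique_mem.2 ⟨hul, hex⟩) hM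
    · gcongr; norm_num
    · gcongr; norm_num

theorem one_add_mul_one_add_le {a b s : ℝ} (ha : 0 ≤ a) (hb : 0 ≤ b) (hs : 0 ≤ s) (hs2 : s ≤ 2) :
    (1 + a * s) * (1 + b * s) ≤ 1 + (a + b + 2 * (a * b)) * s := by
  have : 0 ≤ a * b * s := by positivity
  nlinarith

set_option maxHeartbeats 800000 in
-- a long chain of explicit estimates
/-- Upper bound for the drift of the degree of a vertex. -/
theorem eventually_mean_deg_sub_le (P : Params) (i : Fin P.T) :
    ∃ C : ℝ, 0 ≤ C ∧ ∀ᶠ n : ℕ in atTop, ∀ [NeZero n], ∀ g : TypedGraph P.T n,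
      P.Regular g → Typical g → ∀ v, g.vtype v = i → ∀ y, 0 ≤ y → y ≤ 1 →
      y * (P.p i * P.S * n) ≤ g.deg v →
      P.mean g (fun o => ((P.next g o).deg v.castSucc : ℝ) - g.deg v)
        ≤ (g.deg v : ℝ) / n * (P.growth y + C * (relErr n + 1 / g.deg v)) := by
  have hS := S_pos P
  have hp := P.p_pos i
  have hd : (2 : ℝ) ≤ P.d := by exact_mod_cast P.one_lt_d
  set q := P.p i * P.S with hq
  have hq0 : 0 < q := mul_pos hp hS
  set c := 2 * (P.m + P.k) / P.S with hc
  have hc0 : 0 ≤ c := by positivity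
  have hβ0 := abs_nonneg P.β
  set B := |P.β| with hB
  set C₁ := B + 2 * c + 2 * (B * (2 * c)) with hC1
  set C₂ := B + 2 / q + 2 * (B * (2 / q)) with hC2
  set C₃ := 1 / P.p i + C₂ + 2 * (1 / P.p i * C₂) with hC3
  have hC10 : 0 ≤ C₁ := by positivity
  have hC20 : 0 ≤ C₂ := by positivity
  have hC30 : 0 ≤ C₃ := by positivity
  set C₄ := (P.d : ℝ) ^ 2 * (1 + 1 / q) with hC4
  have hC40 : 0 ≤ C₄ := by positivity
  set C := P.m / P.S * C₁ + P.k / P.S * (C₄ + C₃ * (P.d + C₄ * 2)) + 4 * P.k with hC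
  refine ⟨C, by positivity, ?_⟩
  filter_upwards [eventually_typical P, eventually_relErr_le P (c := 1 / 2) (by norm_num),
    eventually_ge_atTop 2, eventually_ge_atTop (Nat.ceil (2 * c))]
    with n h1 h2 hn hnc _ g hg ht v hv y hy0 hy1 hyD
  have h2' := h1 g ht
  refine (mean_deg_sub_le h2' hg hn hv).trans ?_
  have hn2 : (2 : ℝ) ≤ n := by exact_mod_cast hn
  have hn0 : (0 : ℝ) < n := by linarith
  have hnc' : 2 * c ≤ n := (Nat.le_ceil _).trans (by exact_mod_cast hnc)
  have hD1 : (1 : ℝ) ≤ g.deg v := by exact_mod_cast hg.2 hn v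
  have hW := typeWeight_pos hg hn hv
  have hz1 : wt g v / typeWeight g i ≤ 1 := (div_le_one hW).2 (wt_le_typeWeight hg hn hv)
  have hz := ht.le_share (i := i) hn hW hD1
  have hwt : wt g v = g.deg v + P.β := rfl
  have hw0 := wt_pos hg hn v
  have hNn := (ht.count (by omega) i).2
  have hWn := (ht.weight (by omega) i).1
  have htp := totWeight_pos hg hn
  have hεn := one_le_mul_relErr (by omega : 1 ≤ n)
  set D : ℝ := (g.deg v : ℝ) with hDd
  set ε := relErr n with hεd
  have hε0 : 0 ≤ ε := relErr_nonneg n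
  have hε1 : ε ≤ 1 := by
    rw [hεd, relErr]
    exact Real.rpow_le_one_of_one_le_of_nonpos (by linarith) (by norm_num)
  have hDi0 : 0 ≤ 1 / D := by positivity
  have hDi1 : 1 / D ≤ 1 := by rw [div_le_one (by linarith)]; exact hD1
  set s := ε + 1 / D with hs
  have hs0 : 0 ≤ s := by positivity
  have hs2 : s ≤ 2 := by linarith
  have hεs : ε ≤ s := by linarith
  have hDs : 1 / D ≤ s := by linarith
  have hwB : wt g v ≤ D * (1 + B * s) := by
    rw [hwt]
    have h3 : P.β ≤ B := le_abs_self _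
    have h4 : B = D * (B * (1 / D)) := by field_simp
    have h5 : D * (B * (1 / D)) ≤ D * (B * s) := by gcongr
    linarith
  -- the vertex step
  have hA : wt g v / totWeight P n ≤ D / n * ((1 + C₁ * s) / P.S) := by
    have htl : P.S * n * (1 - c / n) = totWeight P n := by
      rw [totWeight, hc]; field_simp
    have h3 : P.S * n ≤ totWeight P n * (1 + 2 * c * s) := by
      have h4 : (1 : ℝ) ≤ (1 - c / n) * (1 + 2 * (c / n)) := by
        have h5 : c / n ≤ 1 / 2 := by rw [div_le_iff₀ hn0]; linarith
        have h6 : 0 ≤ c / n := by positivity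
        nlinarith
      have h5 : c / n ≤ c * s := by
        rw [div_eq_mul_inv]
        refine mul_le_mul_of_nonneg_left ?_ hc0
        refine le_trans ?_ hεs
        rw [inv_le_iff_one_le_mul₀ hn0]; linarith
      calc P.S * n = P.S * n * 1 := (mul_one _).symm
        _ ≤ P.S * n * ((1 - c / n) * (1 + 2 * (c / n))) := by gcongr
        _ = totWeight P n * (1 + 2 * (c / n)) := by rw [← mul_assoc, htl]
        _ ≤ _ := by
          refine mul_le_mul_of_nonneg_left ?_ htp.le
          linarith
    have h6 : D / n * ((1 + C₁ * s) / P.S) = D * (1 + C₁ * s) / (P.S * n) := by field_simp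
    rw [h6, div_le_div_iff₀ htp (by positivity)]
    calc wt g v * (P.S * n) ≤ D * (1 + B * s) * (totWeight P n * (1 + 2 * c * s)) := by gcongr
      _ = D * ((1 + B * s) * (1 + 2 * c * s)) * totWeight P n := by ring
      _ ≤ D * (1 + C₁ * s) * totWeight P n := by
          gcongr
          exact one_add_mul_one_add_le hβ0 (by positivity) hs0 hs2
  -- the share of the vertex in the weight of its type
  have hzU : wt g v / typeWeight g i ≤ D / n * ((1 + C₂ * s) / q) := by
    have h3 : q * n ≤ typeWeight g i * (1 + 2 / q * s) := by
      have h4 : (q - ε) * n * (1 + 2 / q * ε) ≤ typeWeight g i * (1 + 2 / q * s) := by gcongr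
      refine le_trans ?_ h4
      have h5 : (q - ε) * n * (1 + 2 / q * ε) = q * n + n * (ε * (q - 2 * ε) / q) := by
        field_simp; ring
      rw [h5]
      have h6 : 0 ≤ n * (ε * (q - 2 * ε) / q) := by
        have : 0 ≤ q - 2 * ε := by linarith [(h2 i).2]
        positivity
      linarith
    have h6 : D / n * ((1 + C₂ * s) / q) = D * (1 + C₂ * s) / (q * n) := by field_simp
    rw [h6, div_le_div_iff₀ hW (by positivity)]
    calc wt g v * (q * n) ≤ D * (1 + B * s) * (typeWeight g i * (1 + 2 / q * s)) := by gcongr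
      _ = D * ((1 + B * s) * (1 + 2 / q * s)) * typeWeight g i := by ring
      _ ≤ D * (1 + C₂ * s) * typeWeight g i := by
          gcongr
          exact one_add_mul_one_add_le hβ0 (by positivity) hs0 hs2
  set z := wt g v / typeWeight g i with hzd
  have hz0 : 0 ≤ z := div_nonneg hw0.le hW.le
  -- the hit ratio at the actual share
  have hH : hitRatio P.d z ≤ hitRatio P.d y + C₄ * s := by
    set y' := y * ((1 - 1 / D) * (1 - ε / q)) with hy'
    have hεq : ε / q ≤ 1 := by rw [div_le_one hq0]; linarith [(h2 i).2]
    have hεq0 : 0 ≤ ε / q := by positivity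
    have hf0 : 0 ≤ (1 - 1 / D) * (1 - ε / q) := mul_nonneg (by linarith) (by linarith)
    have hf1 : (1 - 1 / D) * (1 - ε / q) ≤ 1 :=
      mul_le_one₀ (by linarith) (by linarith) (by linarith)
    have h3 : y' ≤ z := by
      refine le_trans ?_ hz
      refine mul_le_mul_of_nonneg_right ?_ hf0
      rw [le_div_iff₀ (by positivity)]
      exact hyD
    have h4 : y' ≤ y := mul_le_of_le_one_right hy0 hf1
    have h5 := hitRatio_sub_le (d := P.d) (mul_nonneg hy0 hf0) h4 hy1
    have h6 := hitRatio_anti (d := P.d) h3 hz1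
    have h7 : y - y' ≤ (1 + 1 / q) * s := by
      have h8 : y - y' = y * (1 - (1 - 1 / D) * (1 - ε / q)) := by rw [hy']; ring
      have h9 : 1 - (1 - 1 / D) * (1 - ε / q) ≤ 1 / D + ε / q := by
        nlinarith [mul_nonneg hDi0 hεq0]
      have h10 : y * (1 - (1 - 1 / D) * (1 - ε / q)) ≤ 1 * (1 / D + ε / q) :=
        mul_le_mul hy1 h9 (by linarith) zero_le_one
      have h11 : ε / q ≤ 1 / q * s := by
        rw [div_eq_mul_one_div, mul_comm]; gcongr
      rw [h8]
      linarith
    have h12 : (P.d : ℝ) ^ 2 * (y - y') ≤ C₄ * s := by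
      rw [hC4, mul_assoc]; gcongr
    linarith
  have hHy0 : 0 ≤ hitRatio P.d y := hitRatio_nonneg hy1
  have hHyd : hitRatio P.d y ≤ P.d := hitRatio_le hy0 hy1
  have hN1 : (typeCount g i : ℝ) / (n + 1) ≤ P.p i * (1 + 1 / P.p i * s) := by
    rw [div_le_iff₀ (by positivity)]
    have h3 : P.p i * (1 + 1 / P.p i * s) = P.p i + s := by field_simp
    rw [h3]
    refine hNn.trans ?_
    gcongr
    linarith
  have hE : (typeCount g i * (1 - (1 - z) ^ P.d) + 4) / (n + 1)
      ≤ D / n * (1 / P.S * (hitRatio P.d y + (C₄ + C₃ * (P.d + C₄ * 2)) * s) + 4 * s) := by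
    have h3 : (typeCount g i : ℝ) / (n + 1) * (1 - (1 - z) ^ P.d)
        ≤ P.p i * (1 + 1 / P.p i * s) * ((D / n * ((1 + C₂ * s) / q))
          * (hitRatio P.d y + C₄ * s)) := by
      rw [← mul_hitRatio]
      have := hitRatio_nonneg (d := P.d) hz1
      gcongr
    have h4 : P.p i * (1 + 1 / P.p i * s) * ((D / n * ((1 + C₂ * s) / q))
          * (hitRatio P.d y + C₄ * s))
        = D / n * (1 / P.S * (((1 + 1 / P.p i * s) * (1 + C₂ * s))
          * (hitRatio P.d y + C₄ * s))) := by
      rw [hq]; field_simp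
    have h5 : ((1 + 1 / P.p i * s) * (1 + C₂ * s)) * (hitRatio P.d y + C₄ * s)
        ≤ hitRatio P.d y + (C₄ + C₃ * (P.d + C₄ * 2)) * s := by
      calc _ ≤ (1 + C₃ * s) * (hitRatio P.d y + C₄ * s) := by
            gcongr
            exact one_add_mul_one_add_le (by positivity) hC20 hs0 hs2
        _ = hitRatio P.d y + C₄ * s + C₃ * s * (hitRatio P.d y + C₄ * s) := by ring
        _ ≤ hitRatio P.d y + C₄ * s + C₃ * s * (P.d + C₄ * 2) := by gcongr
        _ = _ := by ring
    have h6 : (4 : ℝ) / (n + 1) ≤ D / n * (4 * s) := by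
      have h7 : (4 : ℝ) / (n + 1) ≤ 4 / n := by gcongr; linarith
      refine h7.trans ?_
      have h8 : (4 : ℝ) / n = D / n * (4 * (1 / D)) := by field_simp
      rw [h8]; gcongr
    rw [add_div, mul_div_right_comm]
    calc _ ≤ D / n * (1 / P.S * (hitRatio P.d y + (C₄ + C₃ * (P.d + C₄ * 2)) * s))
          + D / n * (4 * s) := by
          refine add_le_add (h3.trans ?_) h6
          rw [h4]; gcongr
      _ = _ := by ring
  calc _ ≤ P.m * (D / n * ((1 + C₁ * s) / P.S))
        + P.k * (D / n * (1 / P.S * (hitRatio P.d y + (C₄ + C₃ * (P.d + C₄ * 2)) * s) + 4 * s)) := by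
        gcongr
    _ = D / n * (P.growth y + C * s) := by rw [growth, hC]; ring

end Params

/-! ### Deterministic lower bounds for the highest degree -/

theorem tendsto_zero_of_not_summable {w X : ℕ → ℝ} {l : ℝ} (hw0 : ∀ n, 0 ≤ w n)
    (hw : ¬ Summable w) (hX0 : ∀ n, 0 ≤ X n) (hX : Tendsto X atTop (𝓝 l))
    (hs : Summable fun n => w n * X n) : Tendsto X atTop (𝓝 0) := by
  have hl0 : 0 ≤ l := ge_of_tendsto' hX hX0
  rcases hl0.eq_or_lt with rfl | hl
  · exact hX
  · refine absurd ?_ hw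
    obtain ⟨N, hN⟩ := eventually_atTop.1 (hX.eventually_const_le (half_lt_self hl))
    rw [← summable_nat_add_iff N]
    refine Summable.of_nonneg_of_le (fun n => hw0 _) (fun n => ?_)
      (((summable_nat_add_iff N).2 hs).mul_left (2 / l))
    have h1 := mul_le_mul_of_nonneg_left (hN (n + N) (by omega)) (hw0 (n + N))
    calc w (n + N) = 2 / l * (w (n + N) * (l / 2)) := by field_simp
      _ ≤ _ := by gcongr

/-- The estimate behind `lower_step`: a second order expansion of `τ' / (M + ζ)` in `ζ / M`. -/
theorem sq_pos_part_le {τ τ' M M' ζ : ℝ} (hM : 0 < M) (hζ0 : 0 ≤ ζ) (hζM : ζ ≤ M)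
    (hM' : M + ζ ≤ M') (hτ : M < τ) (hτ' : τ ≤ τ') (h2 : τ' ≤ 2 * τ) :
    max (τ' / M' - 1) 0 ^ 2 ≤ (τ / M - 1) ^ 2
      + 2 * (τ / M - 1) * ((τ' - τ) / M - τ' / M * (ζ / M - ζ ^ 2 / M ^ 2))
      + (2 * ((τ' - τ) / M) ^ 2 + 8 * (τ / M) ^ 2 * (ζ ^ 2 / M ^ 2)) := by
  set u := τ / M with hu
  set T := τ' / M with hT
  set z := ζ / M with hz
  have hz0 : 0 ≤ z := by positivity
  have hz1 : z ≤ 1 := (div_le_one hM).2 hζM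
  have hu1 : 1 < u := (one_lt_div hM).2 hτ
  have hT0 : 0 ≤ T := div_nonneg (by linarith) hM.le
  have hT2 : T ≤ 2 * u := by rw [hT, hu, ← mul_div_assoc]; gcongr
  have e1 : (τ' - τ) / M = T - u := by rw [hT, hu]; ring
  have e2 : ζ ^ 2 / M ^ 2 = z ^ 2 := by rw [hz]; ring
  rw [e1, e2]
  have h1 : τ' / M' ≤ T * (1 - z + z ^ 2) := by
    have h3 : τ' / M' ≤ τ' / (M + ζ) := div_le_div_of_nonneg_left (by linarith) (by linarith) hM'
    refine h3.trans ?_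
    have h4 : τ' / (M + ζ) = T * (1 / (1 + z)) := by rw [hT, hz]; field_simp
    rw [h4]
    refine mul_le_mul_of_nonneg_left ?_ hT0
    rw [div_le_iff₀ (by linarith)]
    nlinarith [pow_nonneg hz0 3]
  set δ := (T - u) - T * (z - z ^ 2) with hδ
  have h5 : τ' / M' - 1 ≤ (u - 1) + δ := by rw [hδ]; linarith
  have h6 : max (τ' / M' - 1) 0 ^ 2 ≤ ((u - 1) + δ) ^ 2 := by
    rw [← sq_abs (u - 1 + δ)]
    exact pow_le_pow_left₀ (le_max_right _ _) (max_le (h5.trans (le_abs_self _)) (abs_nonneg _)) 2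
  refine h6.trans ?_
  have h7 : δ ^ 2 ≤ 2 * (T - u) ^ 2 + 8 * u ^ 2 * z ^ 2 := by
    have h8 : (T * (z - z ^ 2)) ^ 2 ≤ (2 * u * z) ^ 2 := by
      refine pow_le_pow_left₀ (mul_nonneg hT0 (by nlinarith)) ?_ 2
      exact mul_le_mul hT2 (by nlinarith) (by nlinarith) (by linarith)
    have h9 : δ ^ 2 ≤ 2 * (T - u) ^ 2 + 2 * (T * (z - z ^ 2)) ^ 2 := by
      rw [hδ]; nlinarith [sq_nonneg ((T - u) + T * (z - z ^ 2))]
    nlinarith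
  nlinarith

/-- The deterministic part of the estimate of `(τ / M - 1)²`, with `u = τ / M`: the linear terms are
dominated by the gap `γ` between the growth rates, and the quadratic ones either by the linear
ones or, if `u ≤ 2`, by a summable error. -/
theorem lower_step_aux {n K M τ u a b γ B : ℝ} (hn0 : 0 < n) (hK1 : 1 ≤ K) (hM0 : 0 < M)
    (hτ0 : 0 < τ) (hu : u = τ / M) (hu1 : 1 < u) (hB0 : 0 < B) (hb0 : 0 ≤ b)
    (hbB : b ≤ B) (hγ : 0 < γ) (hab : b + γ ≤ a) (haB : a ≤ B)
    (hγn : 64 * (B + 1) ^ 2 * K ≤ γ * n) (hγM : 64 * (B + 1) ^ 2 * K ≤ γ * M) :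
    (u - 1) ^ 2 + 2 * (u - 1) * (u * (b / n)) + 2 * (u * (b / n)) ^ 2
        - 2 * (u - 1) * u * (a / n) * (1 - K / M) + 8 * u ^ 2 * (K * a / (n * M))
      ≤ (u - 1) ^ 2 - γ / (2 * n) * (u - 1) ^ 2 + (8 * B ^ 2 / n ^ 2 + 64 * K * B / (n * τ)) := by
  have hu0 : 0 < u := by linarith
  have hgM : 64 * (B + 1) ^ 2 * (K / M) ≤ γ := by
    rw [← mul_div_assoc, div_le_iff₀ hM0]; exact hγM
  have hgn : 64 * (B + 1) ^ 2 * (1 / n) ≤ γ := by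
    rw [← mul_div_assoc, div_le_iff₀ hn0, mul_one]
    refine le_trans ?_ hγn
    exact le_mul_of_one_le_right (by positivity) hK1
  have hKM0 : 0 ≤ K / M := by positivity
  have hn1 : 0 ≤ 1 / n := by positivity
  -- the linear term
  have hlin : 2 * (u - 1) * (u * (b / n)) - 2 * (u - 1) * u * (a / n) * (1 - K / M)
      ≤ - ((u - 1) * u * (γ / n)) := by
    have h1 : b - a * (1 - K / M) ≤ - (γ / 2) := by
      have h2 : a * (K / M) ≤ B * (K / M) := by gcongr
      have h3 : B * (K / M) ≤ 32 * (B + 1) ^ 2 * (K / M) := by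
        gcongr; nlinarith
      linarith
    have h4 : 0 ≤ 2 * (u - 1) * u * (1 / n) := by
      have : 0 ≤ u - 1 := by linarith
      positivity
    have h5 := mul_le_mul_of_nonneg_left h1 h4
    calc _ = 2 * (u - 1) * u * (1 / n) * (b - a * (1 - K / M)) := by ring
      _ ≤ _ := h5
      _ = _ := by ring
  have hquad : 2 * (u * (b / n)) ^ 2 + 8 * u ^ 2 * (K * a / (n * M))
      ≤ u ^ 2 * (2 * B ^ 2 / n ^ 2 + 8 * K * B / (n * M)) := by
    have h1 : 2 * (u * (b / n)) ^ 2 ≤ 2 * (u * (B / n)) ^ 2 := by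
      have : 0 ≤ u := by linarith
      gcongr
    have h2 : 8 * u ^ 2 * (K * a / (n * M)) ≤ 8 * u ^ 2 * (K * B / (n * M)) := by gcongr
    calc _ ≤ 2 * (u * (B / n)) ^ 2 + 8 * u ^ 2 * (K * B / (n * M)) := add_le_add h1 h2
      _ = _ := by ring
  have hX : γ / (2 * n) * (u - 1) ^ 2 ≤ (u - 1) * u * (γ / n) / 2 := by
    have h1 : 0 ≤ γ / (2 * n) * (u - 1) := by
      have : 0 ≤ u - 1 := by linarith
      positivity
    calc γ / (2 * n) * (u - 1) ^ 2 = γ / (2 * n) * (u - 1) * (u - 1) := by ring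
      _ ≤ γ / (2 * n) * (u - 1) * u := by gcongr; linarith
      _ = _ := by ring
  have herr0 : 0 ≤ 8 * B ^ 2 / n ^ 2 + 64 * K * B / (n * τ) := by positivity
  rcases le_or_gt 2 u with hu2 | hu2
  · have h1 : u ^ 2 * (2 * B ^ 2 / n ^ 2 + 8 * K * B / (n * M)) ≤ (u - 1) * u * (γ / n) / 2 := by
      have h2 : 2 * B ^ 2 / n ^ 2 + 8 * K * B / (n * M) ≤ γ / n / 4 := by
        have h3 : 2 * B ^ 2 * (1 / n) ≤ γ / 8 := by
          have : 2 * B ^ 2 * (1 / n) ≤ 8 * (B + 1) ^ 2 * (1 / n) := by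
            gcongr <;> linarith
          linarith
        have h4 : 8 * B * (K / M) ≤ γ / 8 := by
          have : 8 * B * (K / M) ≤ 8 * (B + 1) ^ 2 * (K / M) := by
            gcongr; nlinarith
          linarith
        calc _ = (2 * B ^ 2 * (1 / n) + 8 * B * (K / M)) * (1 / n) := by field_simp
          _ ≤ (γ / 8 + γ / 8) * (1 / n) := by gcongr
          _ = _ := by ring
      calc _ ≤ u ^ 2 * (γ / n / 4) := by gcongr
        _ ≤ (2 * ((u - 1) * u)) * (γ / n / 4) := by
            gcongr; nlinarith
        _ = _ := by ring
    linarith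
  · have h1 : u ^ 2 * (2 * B ^ 2 / n ^ 2 + 8 * K * B / (n * M))
        ≤ 8 * B ^ 2 / n ^ 2 + 64 * K * B / (n * τ) := by
      have h2 : τ ≤ 2 * M := by
        rw [hu, div_lt_iff₀ hM0] at hu2; exact hu2.le
      have h3 : 8 * K * B / (n * M) ≤ 16 * K * B / (n * τ) := by
        rw [div_le_div_iff₀ (by positivity) (by positivity)]
        have : 8 * K * B * n * τ ≤ 8 * K * B * n * (2 * M) := by gcongr
        linarith
      have h4 : u ^ 2 ≤ 4 := by nlinarith
      calc _ ≤ 4 * (2 * B ^ 2 / n ^ 2 + 16 * K * B / (n * τ)) := by gcongr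
        _ = _ := by ring
    linarith [mul_nonneg (mul_nonneg (by linarith : 0 ≤ u - 1) (by linarith : 0 ≤ u))
      (by positivity : 0 ≤ γ / n)]

namespace Params

variable {P : Params}

/-- An upper bound for the increase of a degree in one step. -/
def maxIncr (P : Params) : ℝ := P.m + 2 * P.k

theorem one_le_maxIncr (P : Params) : 1 ≤ P.maxIncr := by
  have := one_le_m P; have := one_le_k P; unfold maxIncr; linarith

section OneStep

variable {n : ℕ} {g : TypedGraph P.T n} {i : Fin P.T}

theorem maxDegree_sub_mem (o : P.Outcome n) :
    0 ≤ ((P.next g o).maxDegree i : ℝ) - g.maxDegree i ∧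
      ((P.next g o).maxDegree i : ℝ) - g.maxDegree i ≤ P.maxIncr := by
  have h1 : (g.maxDegree i : ℝ) ≤ (P.next g o).maxDegree i := by
    exact_mod_cast maxDegree_le_next o
  have h2 : ((P.next g o).maxDegree i : ℝ) ≤ (g.maxDegree i + (P.m + 2 * P.k) : ℕ) := by
    exact_mod_cast maxDegree_next_le o
  push_cast at h2
  unfold maxIncr
  constructor <;> linarith

variable [NeZero n]

/-- If the highest degree `M` is less than `τ`, and its drift exceeds the relative growth of `τ`,
then `(τ / M - 1)²` decreases on average, up to an error that is small if `M` is comparable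
to `τ`. -/
theorem lower_step {τ τ' a b γ B : ℝ} (hB : 0 ≤ B) (hτ' : τ ≤ τ')
    (hstep : τ' ≤ τ * (1 + b / n)) (hb0 : 0 ≤ b) (hbB : b ≤ B) (hγ : 0 < γ) (hab : b + γ ≤ a)
    (haB : a ≤ B) (hγn : 64 * (B + 1) ^ 2 * P.maxIncr ≤ γ * n)
    (hγM : 64 * (B + 1) ^ 2 * P.maxIncr ≤ γ * g.maxDegree i) (hM : (g.maxDegree i : ℝ) < τ)
    (hdrift : a * (g.maxDegree i / n)
      ≤ P.mean g (fun o => ((P.next g o).maxDegree i : ℝ) - g.maxDegree i)) :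
    P.mean g (fun o => max (τ' / (P.next g o).maxDegree i - 1) 0 ^ 2)
      ≤ (τ / g.maxDegree i - 1) ^ 2 - γ / (2 * n) * (τ / g.maxDegree i - 1) ^ 2
        + (8 * B ^ 2 / n ^ 2 + 64 * P.maxIncr * B / (n * τ)) := by
  set K := P.maxIncr with hK
  have hK1 : 1 ≤ K := one_le_maxIncr P
  set M : ℝ := (g.maxDegree i : ℝ) with hMd
  have hn0 : (0 : ℝ) < n := by exact_mod_cast NeZero.pos n
  have hBK : 64 * (B + 1) ≤ 64 * (B + 1) ^ 2 * K := by nlinarith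
  have hγB : γ ≤ B := by linarith
  have hB0 : 0 < B := by linarith
  have hM0 : 0 < M := by
    by_contra h
    push Not at h
    nlinarith
  have hMK : K ≤ M := by
    have h1 : γ * M ≤ B * M := by gcongr
    have h2 : 64 * (B + 1) ^ 2 * K ≤ B * M := hγM.trans h1
    have h3 : B * K ≤ 64 * (B + 1) ^ 2 * K := by
      gcongr
      nlinarith
    exact le_of_mul_le_mul_left (h3.trans h2) hB0
  have hnB : B ≤ n := by
    have h1 : γ * n ≤ B * n := by gcongr
    have h2 : 64 * (B + 1) ^ 2 * K ≤ B * n := hγn.trans h1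
    have h3 : B * B ≤ 64 * (B + 1) ^ 2 * K := by
      have : B * B ≤ 64 * (B + 1) ^ 2 * 1 := by nlinarith
      refine this.trans ?_
      gcongr
    exact le_of_mul_le_mul_left (h3.trans h2) hB0
  have hτ0 : 0 < τ := hM0.trans hM
  have hbn : b / n ≤ 1 := by rw [div_le_one hn0]; linarith
  have hτ2 : τ' ≤ 2 * τ := hstep.trans (by nlinarith)
  have ha0 : 0 < a := by linarith
  set e := P.mean g (fun o => ((P.next g o).maxDegree i : ℝ) - M) with he
  have he0 : 0 < e := lt_of_lt_of_le (by positivity) hdrift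
  -- the increment of the highest degree, rescaled to have mean exactly `a * M / n`
  set c := a * (M / n) / e with hc
  have hc0 : 0 ≤ c := by positivity
  have hc1 : c ≤ 1 := (div_le_one he0).2 hdrift
  set ζ : P.Outcome n → ℝ := fun o => c * (((P.next g o).maxDegree i : ℝ) - M) with hζ
  have hΔ := fun o : P.Outcome n => maxDegree_sub_mem (g := g) (i := i) o
  have hζ0 : ∀ o, 0 ≤ ζ o := fun o => mul_nonneg hc0 (hΔ o).1
  have hζΔ : ∀ o, ζ o ≤ ((P.next g o).maxDegree i : ℝ) - M := fun o =>
    mul_le_of_le_one_left (hΔ o).1 hc1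
  have hζK : ∀ o, ζ o ≤ K := fun o => (hζΔ o).trans (hΔ o).2
  have hmζ : P.mean g ζ = a * (M / n) := by
    rw [hζ, mean_mul, ← he, hc, div_mul_cancel₀ _ he0.ne']
  set u := τ / M with hu
  have hu1 : 1 < u := (one_lt_div hM0).2 hM
  set L : ℝ := 2 * (u - 1) * ((τ' - τ) / M) + 2 * ((τ' - τ) / M) ^ 2 with hL
  set α : ℝ := 2 * (u - 1) * (τ' / M) / M with hα
  set ε : ℝ := (2 * (u - 1) * (τ' / M) + 8 * u ^ 2) * K / M ^ 2 with hε
  have hT0 : 0 ≤ τ' / M := div_nonneg (by linarith) hM0.le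
  have hpt : ∀ o, max (τ' / (P.next g o).maxDegree i - 1) 0 ^ 2
      ≤ ((u - 1) ^ 2 + L) + (ε - α) * ζ o := by
    intro o
    have h1 := sq_pos_part_le hM0 (hζ0 o) ((hζK o).trans hMK)
      (by linarith [hζΔ o] : M + ζ o ≤ (P.next g o).maxDegree i) hM hτ' hτ2
    refine h1.trans ?_
    have h2 : ζ o ^ 2 ≤ K * ζ o := by nlinarith [hζ0 o, hζK o]
    have h3 : (2 * (u - 1) * (τ' / M) + 8 * u ^ 2) * (ζ o ^ 2 / M ^ 2)
        ≤ (2 * (u - 1) * (τ' / M) + 8 * u ^ 2) * (K * ζ o / M ^ 2) := by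
      have : 0 ≤ 2 * (u - 1) * (τ' / M) + 8 * u ^ 2 := by
        have := mul_nonneg (by linarith : 0 ≤ 2 * (u - 1)) hT0
        positivity
      gcongr
    have e1 : (ε - α) * ζ o = (2 * (u - 1) * (τ' / M) + 8 * u ^ 2) * (K * ζ o / M ^ 2)
        - 2 * (u - 1) * (τ' / M) * (ζ o / M) := by rw [hε, hα]; ring
    rw [e1, hL]
    linarith
  refine (mean_mono g hpt).trans ?_
  rw [mean_add, mean_const, mean_mul, hmζ]
  -- bounds for the terms in the mean
  have hρ : (τ' - τ) / M ≤ u * (b / n) := by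
    rw [hu, div_mul_eq_mul_div]
    gcongr
    linarith
  have hρ0 : 0 ≤ (τ' - τ) / M := div_nonneg (by linarith) hM0.le
  have hTu : u ≤ τ' / M := by rw [hu]; gcongr
  have hTu2 : τ' / M ≤ 2 * u := by rw [hu, ← mul_div_assoc]; gcongr
  have hKM : K / M ≤ 1 := (div_le_one hM0).2 hMK
  have hdet : (u - 1) ^ 2 + L + (ε - α) * (a * (M / n))
      ≤ (u - 1) ^ 2 + 2 * (u - 1) * (u * (b / n)) + 2 * (u * (b / n)) ^ 2
        - 2 * (u - 1) * u * (a / n) * (1 - K / M) + 8 * u ^ 2 * (K * a / (n * M)) := by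
    have h1 : 2 * (u - 1) * ((τ' - τ) / M) ≤ 2 * (u - 1) * (u * (b / n)) :=
      mul_le_mul_of_nonneg_left hρ (by linarith)
    have h2 : 2 * ((τ' - τ) / M) ^ 2 ≤ 2 * (u * (b / n)) ^ 2 := by gcongr
    have e1 : (ε - α) * (a * (M / n)) = 8 * u ^ 2 * (K * a / (n * M))
        - 2 * (u - 1) * (τ' / M) * (a / n) * (1 - K / M) := by
      rw [hε, hα]; field_simp; ring
    have h3 : 2 * (u - 1) * u * (a / n) * (1 - K / M)
        ≤ 2 * (u - 1) * (τ' / M) * (a / n) * (1 - K / M) := by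
      have h4 : 0 ≤ 2 * (u - 1) := by linarith
      have h5 : 0 ≤ 1 - K / M := by linarith
      gcongr
    rw [e1, hL]
    linarith
  exact hdet.trans (lower_step_aux hn0 hK1 hM0 hτ0 hu hu1 hB0 hb0 hbB hγ hab haB hγn hγM)

end OneStep

section Chain

variable {Ω : Type*} [mΩ : MeasurableSpace Ω] {μ : Measure Ω} [IsProbabilityMeasure μ]
  {G : (n : ℕ) → Ω → TypedGraph P.T n}

/-- If the relative drift of the highest degree exceeds the relative growth of `τ` as long as the
highest degree is less than `τ`, then the highest degree is eventually at least `(1 - ε) * τ`. -/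
theorem IsGraphSequence.eventually_le_maxDegree (hG : P.IsGraphSequence μ G) (i : Fin P.T)
    {τ a b γ : ℕ → ℝ} {B : ℝ} (A : (n : ℕ) → Set (TypedGraph P.T n)) {n₀ : ℕ}
    (hB : 0 ≤ B) (hτ1 : ∀ n, n₀ ≤ n → 0 < τ n)
    (hτ' : ∀ n, n₀ ≤ n → τ n ≤ τ (n + 1)) (hstep : ∀ n, n₀ ≤ n → τ (n + 1) ≤ τ n * (1 + b n / n))
    (hb0 : ∀ n, n₀ ≤ n → 0 ≤ b n) (hbB : ∀ n, n₀ ≤ n → b n ≤ B) (hγ : ∀ n, 0 < γ n)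
    (hab : ∀ n, n₀ ≤ n → b n + γ n ≤ a n)
    (haB : ∀ n, n₀ ≤ n → a n ≤ B) (hsum : Summable fun n => 1 / (n * τ n))
    (hdiv : ¬ Summable fun n => γ n / n)
    (hγn : ∀ n, n₀ ≤ n → 64 * (B + 1) ^ 2 * P.maxIncr ≤ γ n * n)
    (hA : ∀ (n : ℕ) [NeZero n], n₀ ≤ n → ∀ g ∈ A n, P.Regular g → (g.maxDegree i : ℝ) < τ n →
      64 * (B + 1) ^ 2 * P.maxIncr ≤ γ n * g.maxDegree i ∧
      a n * (g.maxDegree i / n)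
        ≤ P.mean g (fun o => ((P.next g o).maxDegree i : ℝ) - g.maxDegree i)) :
    ∀ᵐ ω ∂μ, (∀ᶠ n in atTop, G n ω ∈ A n) → ∀ ε : ℝ, 0 < ε →
      ∀ᶠ n in atTop, (1 - ε) * τ n ≤ (G n ω).maxDegree i := by
  have hK1 := one_le_maxIncr P
  have hC : 0 < 64 * (B + 1) ^ 2 * P.maxIncr := by positivity
  set τ₀ : ℕ → ℝ := fun n => max (τ n) 0 with hτ0
  have hτe : ∀ n, n₀ ≤ n → τ₀ n = τ n := fun n hn => max_eq_left (hτ1 n hn).le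
  have hsum' : Summable fun n => 1 / (n * τ₀ n) := by
    rw [← summable_nat_add_iff n₀] at hsum ⊢
    refine hsum.congr fun n => ?_
    rw [hτe _ (by omega)]
  have h := hG.robbins_siegmund
    (fun n g => max (τ n / g.maxDegree i - 1) 0 ^ 2)
    (fun n g => γ n / (2 * n) * max (τ n / g.maxDegree i - 1) 0 ^ 2) A
    (c := fun n => 8 * B ^ 2 / n ^ 2 + 64 * P.maxIncr * B / (n * τ₀ n)) (max n₀ 1)
    (fun n g => by positivity)
    (fun n g => by have := hγ n; positivity)
    (fun n => by
      have : 0 ≤ τ₀ n := le_max_right _ _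
      positivity)
    (((Real.summable_one_div_nat_pow.2 one_lt_two).mul_left (8 * B ^ 2)).congr
      (fun n => by rw [mul_one_div]) |>.add
      ((hsum'.mul_left (64 * P.maxIncr * B)).congr fun n => by rw [mul_one_div])) ?_
  · filter_upwards [h, hG.ae_regular] with ω h1 hreg hev ε hε
    obtain ⟨⟨l, hl⟩, hs⟩ := h1 hev
    have hX := tendsto_zero_of_not_summable (w := fun n => γ n / (2 * n))
      (fun n => by have := hγ n; positivity) (fun h => hdiv <| by
        refine (h.mul_left 2).congr fun n => ?_
        have : (2 : ℝ) * (γ n / (2 * n)) = γ n / n := by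
          rcases Nat.eq_zero_or_pos n with rfl | hn
          · simp
          · have : (0 : ℝ) < n := by exact_mod_cast hn
            field_simp
        exact this)
      (fun n => by positivity) hl hs
    filter_upwards [hX.eventually_lt_const (sq_pos_of_pos hε), eventually_ge_atTop (max n₀ 1), hev]
      with n hn hn0 hgA
    have hn1 : NeZero n := ⟨by have := (le_max_right _ _).trans hn0; omega⟩
    have hnn0 : n₀ ≤ n := (le_max_left _ _).trans hn0
    rcases le_or_gt (τ n) (G n ω |>.maxDegree i) with h3 | h3
    · refine le_trans ?_ h3
      have := hτ1 n hnn0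
      nlinarith
    · have h4 := (hA n hnn0 _ hgA (hreg n) h3).1
      have hM : (0 : ℝ) < (G n ω).maxDegree i := by
        by_contra h5
        push Not at h5
        have := hγ n
        nlinarith
      have h5 : max (τ n / (G n ω).maxDegree i - 1) 0 < ε := lt_of_pow_lt_pow_left₀ 2 hε.le hn
      have h6 := (le_max_left _ _).trans_lt h5
      have h7 : τ n < (1 + ε) * (G n ω).maxDegree i := by
        rw [sub_lt_iff_lt_add, div_lt_iff₀ hM] at h6; linarith
      have := hτ1 n hnn0
      nlinarith
  · intro n _ hn g hgA hg
    have hnn0 : n₀ ≤ n := (le_max_left _ _).trans hn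
    have hn0 : (0 : ℝ) < n := by exact_mod_cast NeZero.pos n
    have hτp := hτ1 n hnn0
    rw [hτe n hnn0]
    rcases le_or_gt (τ n) (g.maxDegree i) with h3 | h3
    · have hM : (0 : ℝ) < g.maxDegree i := hτp.trans_le h3
      have e0 : max (τ n / g.maxDegree i - 1) 0 = 0 := by
        rw [max_eq_right]
        rw [sub_nonpos, div_le_one hM]
        exact h3
      rw [e0]
      have h4 : ∀ o : P.Outcome n, max (τ (n + 1) / (P.next g o).maxDegree i - 1) 0 ^ 2
          ≤ (B / n) ^ 2 := by
        intro o
        refine pow_le_pow_left₀ (le_max_right _ _) (max_le ?_ (by positivity)) 2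
        have h5 : (g.maxDegree i : ℝ) ≤ (P.next g o).maxDegree i := by
          exact_mod_cast maxDegree_le_next o
        have h6 := hstep n hnn0
        have h7 : b n / n ≤ B / n := by gcongr; exact hbB n hnn0
        rw [sub_le_iff_le_add, div_le_iff₀ (hM.trans_le h5)]
        calc τ (n + 1) ≤ τ n * (1 + b n / n) := h6
          _ ≤ (P.next g o).maxDegree i * (B / n + 1) :=
            mul_le_mul (h3.trans h5) (by linarith)
              (by have := hb0 n hnn0; positivity) (by positivity)
          _ = _ := by ring
      refine (mean_mono g h4).trans ?_
      rw [mean_const]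
      have := one_le_maxIncr P
      have h8 : 0 ≤ 7 * B ^ 2 / (n : ℝ) ^ 2 + 64 * P.maxIncr * B / (n * τ n) := by positivity
      have e1 : (B / n) ^ 2 = 8 * B ^ 2 / (n : ℝ) ^ 2 - 7 * B ^ 2 / n ^ 2 := by ring
      rw [e1]
      simp only [ne_eq, OfNat.ofNat_ne_zero, not_false_eq_true, zero_pow, mul_zero, sub_zero]
      linarith
    · obtain ⟨h4, h5⟩ := hA n hnn0 g hgA hg h3
      have hM : (0 : ℝ) < g.maxDegree i := by
        by_contra h5
        push Not at h5
        have := hγ n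
        nlinarith
      have h6 := lower_step hB (hτ' n hnn0) (hstep n hnn0) (hb0 n hnn0) (hbB n hnn0) (hγ n)
        (hab n hnn0) (haB n hnn0) (hγn n hnn0) h4 h3 h5
      have e0 : max (τ n / g.maxDegree i - 1) 0 = τ n / g.maxDegree i - 1 := by
        refine max_eq_left ?_
        rw [sub_nonneg, one_le_div hM]; exact h3.le
      rw [e0]
      exact h6

end Chain

end Params

/-! ### Deterministic upper bounds for the highest degree -/

/-- A second order expansion of `(x - 1)₊²`. -/
theorem sq_pos_part_add_le (x δ : ℝ) :
    max (x + δ - 1) 0 ^ 2 ≤ max (x - 1) 0 ^ 2 + 2 * max (x - 1) 0 * δ + δ ^ 2 := by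
  have h1 : max (x + δ - 1) 0 ≤ |max (x - 1) 0 + δ| :=
    max_le (le_trans (by linarith [le_max_left (x - 1) 0]) (le_abs_self _)) (abs_nonneg _)
  have h2 := pow_le_pow_left₀ (le_max_right _ _) h1 2
  rw [sq_abs] at h2
  linarith

namespace Params

variable {P : Params}

/-- The sum of the squared relative excesses of the degrees of the vertices of type `i` over `τ`. -/
def excess {n : ℕ} (g : TypedGraph P.T n) (i : Fin P.T) (τ : ℝ) : ℝ :=
  ∑ v ∈ typeVerts g i, max (g.deg v / τ - 1) 0 ^ 2

theorem excess_nonneg {n : ℕ} (g : TypedGraph P.T n) (i : Fin P.T) (τ : ℝ) : 0 ≤ excess g i τ :=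
  Finset.sum_nonneg fun _ _ => sq_nonneg _

section OneStep

variable {n : ℕ} {g : TypedGraph P.T n} {i : Fin P.T}

theorem sq_le_excess (τ : ℝ) :
    max (g.maxDegree i / τ - 1) 0 ^ 2 ≤ excess g i τ := by
  rcases Nat.eq_zero_or_pos (typeCount g i) with h | h
  · have h1 : typeVerts g i = ∅ := Finset.card_eq_zero.1 h
    have h2 : g.maxDegree i = 0 := by
      show (typeVerts g i).sup g.deg = 0
      rw [h1]; rfl
    rw [h2]
    simpa using excess_nonneg g i τ
  · obtain ⟨u, hu, hu'⟩ := exists_deg_eq_maxDegree h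
    rw [← hu']
    exact Finset.single_le_sum (f := fun v => max (g.deg v / τ - 1) 0 ^ 2)
      (fun _ _ => sq_nonneg _) (mem_typeVerts.2 hu)

/-- The increment of the degree of `v`. -/
def degIncr (g : TypedGraph P.T n) (o : P.Outcome n) (v : Fin n) : ℝ :=
  (P.next g o).deg v.castSucc - g.deg v

theorem degIncr_eq (o : P.Outcome n) (v : Fin n) : degIncr g o v
    = TypedGraph.attachHits o.2.1 v + TypedGraph.edgeHits o.2.2 v.castSucc := by
  rw [degIncr, deg_next_castSucc]; push_cast; ring

theorem degIncr_nonneg (o : P.Outcome n) (v : Fin n) : 0 ≤ degIncr g o v := by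
  rw [degIncr_eq]; positivity

theorem sum_degIncr_le (o : P.Outcome n) (A : Finset (Fin n)) :
    ∑ v ∈ A, degIncr g o v ≤ P.maxIncr := by
  refine (Finset.sum_le_sum_of_subset_of_nonneg (Finset.subset_univ A)
    fun v _ _ => degIncr_nonneg o v).trans ?_
  simp only [degIncr_eq, Finset.sum_add_distrib, maxIncr]
  refine add_le_add ?_ ?_
  · exact_mod_cast (TypedGraph.sum_attachHits o.2.1).le
  · have h := TypedGraph.sum_edgeHits o.2.2
    rw [Fin.sum_univ_castSucc] at h
    exact_mod_cast (by omega : ∑ v : Fin n, TypedGraph.edgeHits o.2.2 v.castSucc ≤ 2 * P.k)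

theorem degIncr_le (o : P.Outcome n) (v : Fin n) : degIncr g o v ≤ P.maxIncr := by
  simpa using sum_degIncr_le (g := g) o {v}

theorem deg_last_le (o : P.Outcome n) :
    ((P.next g o).deg (Fin.last n) : ℝ) ≤ P.maxIncr := by
  rw [Params.next, TypedGraph.deg_extend_last, maxIncr]
  have := TypedGraph.edgeHits_le o.2.2 (Fin.last n)
  exact_mod_cast (by omega : P.m + TypedGraph.edgeHits o.2.2 (Fin.last n) ≤ P.m + 2 * P.k)

theorem sum_deg_le (hg : P.Regular g) (hn : 1 ≤ n) (A : Finset (Fin n)) :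
    ∑ v ∈ A, (g.deg v : ℝ) ≤ 2 * (P.m + P.k) * n := by
  refine (Finset.sum_le_sum_of_subset_of_nonneg (Finset.subset_univ A)
    fun v _ _ => Nat.cast_nonneg _).trans ?_
  have h := TypedGraph.sum_deg g
  rw [hg.1] at h
  rw [← Nat.cast_sum, h]
  push_cast [Nat.cast_sub hn]
  have : 0 ≤ (P.m : ℝ) + P.k := by positivity
  linarith

variable [NeZero n]

/-- If every degree that exceeds `τ` grows slower than `τ`, then the excess decreases on average,
up to an error that is summable if `1 / τ²` is. -/
theorem upper_step {τ τ' a b γ B : ℝ} (hg : P.Regular g) (hB : 0 ≤ B) (hBn : B ≤ n)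
    (hτK : P.maxIncr ≤ τ) (hτ' : τ ≤ τ') (hstep : τ * (1 + b / n) ≤ τ')
    (hstep' : τ' ≤ τ * (1 + B / n)) (hγ : 0 < γ) (hab : a + γ ≤ b)
    (hdrift : ∀ v, g.vtype v = i → τ < g.deg v →
      P.mean g (fun o => degIncr g o v) ≤ g.deg v / n * a) :
    P.mean g (fun o => excess (P.next g o) i τ')
      ≤ excess g i τ - γ / n * excess g i τ
        + (2 * P.maxIncr ^ 2 + 8 * (P.m + P.k) ^ 2 * B ^ 2) / τ ^ 2 := by
  have hK1 := one_le_maxIncr P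
  have hτ0 : 0 < τ := by linarith
  have hτ0' : 0 < τ' := by linarith
  have hn0 : (0 : ℝ) < n := by exact_mod_cast NeZero.pos n
  have hn1 : 1 ≤ n := NeZero.pos n
  have hBn1 : B / n ≤ 1 := (div_le_one hn0).2 hBn
  have hτ2 : τ' ≤ 2 * τ := hstep'.trans (by nlinarith)
  set p : Fin n → ℝ := fun v => max (g.deg v / τ - 1) 0 with hp
  have hp0 : ∀ v, 0 ≤ p v := fun v => le_max_right _ _
  set δ : P.Outcome n → Fin n → ℝ := fun o v =>
    degIncr g o v / τ' - g.deg v * (τ' - τ) / (τ * τ') with hδ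
  have hρ : (τ' - τ) / τ' ≤ B / n := by
    rw [div_le_iff₀ hτ0']
    have : B / n * τ ≤ B / n * τ' := by gcongr
    linarith
  have hρ0 : 0 ≤ (τ' - τ) / τ' := div_nonneg (by linarith) hτ0'.le
  -- the squares of the changes of the ratios are summable
  have hsq : ∀ o, ∑ v ∈ typeVerts g i, δ o v ^ 2
      ≤ (2 * P.maxIncr ^ 2 + 8 * (P.m + P.k) ^ 2 * B ^ 2) / τ ^ 2 := by
    intro o
    have h1 : ∀ v, δ o v ^ 2 ≤ 2 / τ ^ 2 * degIncr g o v ^ 2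
        + 2 * (B / n) ^ 2 / τ ^ 2 * (g.deg v : ℝ) ^ 2 := by
      intro v
      have h2 : (degIncr g o v / τ') ^ 2 ≤ (degIncr g o v / τ) ^ 2 := by
        have := degIncr_nonneg (g := g) o v
        gcongr
      have h3 : (g.deg v * (τ' - τ) / (τ * τ')) ^ 2 ≤ (g.deg v / τ * (B / n)) ^ 2 := by
        have e : g.deg v * (τ' - τ) / (τ * τ') = g.deg v / τ * ((τ' - τ) / τ') := by
          field_simp
        rw [e]
        gcongr
      calc δ o v ^ 2 ≤ 2 * (degIncr g o v / τ') ^ 2 + 2 * (g.deg v * (τ' - τ) / (τ * τ')) ^ 2 := by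
            rw [hδ]
            nlinarith [sq_nonneg (degIncr g o v / τ' + g.deg v * (τ' - τ) / (τ * τ'))]
        _ ≤ 2 * (degIncr g o v / τ) ^ 2 + 2 * (g.deg v / τ * (B / n)) ^ 2 := by gcongr
        _ = _ := by ring
    refine (Finset.sum_le_sum fun v _ => h1 v).trans ?_
    rw [Finset.sum_add_distrib, ← Finset.mul_sum, ← Finset.mul_sum]
    have h4 : ∑ v ∈ typeVerts g i, degIncr g o v ^ 2 ≤ P.maxIncr ^ 2 :=
      (Finset.sum_sq_le_sq_sum_of_nonneg fun v _ => degIncr_nonneg o v).trans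
        (pow_le_pow_left₀ (Finset.sum_nonneg fun v _ => degIncr_nonneg o v)
          (sum_degIncr_le o _) 2)
    have h5 : ∑ v ∈ typeVerts g i, (g.deg v : ℝ) ^ 2 ≤ (2 * (P.m + P.k) * n) ^ 2 :=
      (Finset.sum_sq_le_sq_sum_of_nonneg fun v _ => Nat.cast_nonneg _).trans
        (pow_le_pow_left₀ (Finset.sum_nonneg fun v _ => Nat.cast_nonneg _)
          (sum_deg_le hg hn1 _) 2)
    calc _ ≤ 2 / τ ^ 2 * P.maxIncr ^ 2 + 2 * (B / n) ^ 2 / τ ^ 2 * (2 * (P.m + P.k) * n) ^ 2 := by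
          gcongr
      _ = _ := by field_simp; ring
  have hpt : ∀ o, excess (P.next g o) i τ'
      ≤ excess g i τ + ∑ v ∈ typeVerts g i, 2 * p v * δ o v
        + (2 * P.maxIncr ^ 2 + 8 * (P.m + P.k) ^ 2 * B ^ 2) / τ ^ 2 := by
    intro o
    refine le_trans ?_ (add_le_add_right (hsq o) _)
    rw [excess, sum_typeVerts_next, excess, ← Finset.sum_add_distrib, ← Finset.sum_add_distrib]
    have h0 : (if o.1 = i then max (((P.next g o).deg (Fin.last n) : ℝ) / τ' - 1) 0 ^ 2 else 0)
        = 0 := by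
      have h1 : ((P.next g o).deg (Fin.last n) : ℝ) / τ' ≤ 1 :=
        (div_le_one hτ0').2 ((deg_last_le o).trans (by linarith))
      rw [max_eq_right (by linarith)]
      simp
    rw [h0, add_zero]
    refine Finset.sum_le_sum fun v _ => ?_
    have e : ((P.next g o).deg v.castSucc : ℝ) / τ' = g.deg v / τ + δ o v := by
      rw [hδ]
      simp only [degIncr]
      field_simp
      ring
    rw [e]
    exact sq_pos_part_add_le _ _
  refine (mean_mono g hpt).trans ?_
  rw [mean_add, mean_add, mean_const, mean_const, mean_sum]
  refine add_le_add_left ?_ _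
  rw [sub_eq_add_neg]
  refine add_le_add_right ?_ _
  rw [excess, Finset.mul_sum, ← Finset.sum_neg_distrib]
  refine Finset.sum_le_sum fun v hv => ?_
  rw [mean_mul]
  rcases le_or_gt (g.deg v : ℝ) τ with h | h
  · have : p v = 0 := max_eq_right (by rw [sub_nonpos, div_le_one hτ0]; exact h)
    simp only [hp] at this
    simp [hp, this]
  · have hx : 1 < g.deg v / τ := (one_lt_div hτ0).2 h
    have hpv : p v = g.deg v / τ - 1 := max_eq_left (by linarith)
    have hm : P.mean g (fun o => δ o v) ≤ - (γ / n * p v / 2) := by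
      have h1 := hdrift v (mem_typeVerts.1 hv) h
      have e : P.mean g (fun o => δ o v)
          = (P.mean g (fun o => degIncr g o v) - g.deg v * (τ' - τ) / τ) / τ' := by
        have : (fun o => δ o v) = fun o => τ'⁻¹ * degIncr g o v
            - g.deg v * (τ' - τ) / (τ * τ') := by
          funext o; rw [hδ]; ring
        rw [this, mean_sub, mean_mul, mean_const]
        field_simp
      have h2 : g.deg v * (b / n) ≤ g.deg v * (τ' - τ) / τ := by
        rw [mul_div_assoc]
        refine mul_le_mul_of_nonneg_left ?_ (Nat.cast_nonneg _)
        rw [le_div_iff₀ hτ0]; linarith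
      have h3 : P.mean g (fun o => degIncr g o v) - g.deg v * (τ' - τ) / τ
          ≤ - (g.deg v / n * γ) := by
        have h4 : g.deg v / n * (a + γ) ≤ g.deg v / n * b := by gcongr
        have h5 : g.deg v * (b / n) = g.deg v / n * b := by ring
        linarith
      rw [e, div_le_iff₀ hτ0']
      refine h3.trans ?_
      have h6 : p v * τ' ≤ 2 * g.deg v := by
        have h7 : p v ≤ g.deg v / τ := by rw [hpv]; linarith
        calc p v * τ' ≤ g.deg v / τ * (2 * τ) := by gcongr
          _ = _ := by field_simp
      have h8 : γ / n * (p v * τ') ≤ γ / n * (2 * g.deg v) := by gcongr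
      have h9 : γ / n * (2 * g.deg v) = 2 * (g.deg v / n * γ) := by ring
      linarith
    have := mul_le_mul_of_nonneg_left hm (by linarith [hp0 v] : 0 ≤ 2 * p v)
    refine this.trans (le_of_eq ?_)
    simp only [hp]
    ring

end OneStep

section Chain

variable {Ω : Type*} [mΩ : MeasurableSpace Ω] {μ : Measure Ω} [IsProbabilityMeasure μ]
  {G : (n : ℕ) → Ω → TypedGraph P.T n}

/-- If the relative drift of every degree that exceeds `τ` is less than the relative growth of `τ`,
then the highest degree is eventually at most `(1 + ε) * τ`. -/
theorem IsGraphSequence.eventually_maxDegree_le (hG : P.IsGraphSequence μ G) (i : Fin P.T)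
    {τ a b γ : ℕ → ℝ} {B : ℝ} {n₀ : ℕ} (hB : 0 ≤ B) (hτ1 : ∀ n, n₀ ≤ n → P.maxIncr ≤ τ n)
    (hτ' : ∀ n, n₀ ≤ n → τ n ≤ τ (n + 1)) (hstep : ∀ n, n₀ ≤ n → τ n * (1 + b n / n) ≤ τ (n + 1))
    (hstep' : ∀ n, n₀ ≤ n → τ (n + 1) ≤ τ n * (1 + B / n)) (hγ : ∀ n, 0 < γ n)
    (hab : ∀ n, n₀ ≤ n → a n + γ n ≤ b n) (hsum : Summable fun n => 1 / τ n ^ 2)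
    (hdiv : ¬ Summable fun n => γ n / n)
    (hdrift : ∀ (n : ℕ) [NeZero n], n₀ ≤ n → ∀ g : TypedGraph P.T n, P.Regular g → Typical g →
      ∀ v, g.vtype v = i → τ n < g.deg v →
        P.mean g (fun o => degIncr g o v) ≤ g.deg v / n * a n) :
    ∀ᵐ ω ∂μ, ∀ ε : ℝ, 0 < ε → ∀ᶠ n in atTop, ((G n ω).maxDegree i : ℝ) ≤ (1 + ε) * τ n := by
  have hK1 := one_le_maxIncr P
  have h := hG.robbins_siegmund (fun n g => excess g i (τ n))
    (fun n g => γ n / n * excess g i (τ n)) (fun n => {g | Typical g})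
    (c := fun n => (2 * P.maxIncr ^ 2 + 8 * (P.m + P.k) ^ 2 * B ^ 2) / τ n ^ 2)
    (max n₀ (max 1 ⌈B⌉₊)) (fun n g => excess_nonneg _ _ _)
    (fun n g => mul_nonneg (div_nonneg (hγ n).le (Nat.cast_nonneg _)) (excess_nonneg _ _ _))
    (fun n => by positivity)
    ((hsum.mul_left _).congr fun n => by rw [mul_one_div]) ?_
  · filter_upwards [h, hG.ae_typical] with ω h1 ht ε hε
    obtain ⟨⟨l, hl⟩, hs⟩ := h1 ht
    have hX := tendsto_zero_of_not_summable (w := fun n => γ n / n)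
      (fun n => div_nonneg (hγ n).le (Nat.cast_nonneg _)) hdiv
      (fun n => excess_nonneg _ _ _) hl hs
    filter_upwards [hX.eventually_lt_const (sq_pos_of_pos hε), eventually_ge_atTop n₀]
      with n hn hn0
    have hτ := hτ1 n hn0
    have hτ0 : 0 < τ n := by linarith
    have h2 := lt_of_pow_lt_pow_left₀ 2 hε.le ((sq_le_excess _).trans_lt hn)
    have h3 := (le_max_left _ _).trans_lt h2
    rw [sub_lt_iff_lt_add, div_lt_iff₀ hτ0] at h3
    linarith
  · intro n _ hn g ht hg
    have hn0 : n₀ ≤ n := (le_max_left _ _).trans hn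
    have hBn : B ≤ n := (Nat.le_ceil B).trans
      (by exact_mod_cast (le_max_right _ _).trans ((le_max_right _ _).trans hn))
    exact upper_step hg hB hBn (hτ1 n hn0) (hτ' n hn0) (hstep n hn0) (hstep' n hn0) (hγ n)
      (hab n hn0) (hdrift n hn0 g hg ht)

end Chain

end Params

/-! ### Rough bounds for the highest degree -/

namespace Params

variable {P : Params}

theorem sixteen_le_div_r (P : Params) : 16 ≤ 64 * (P.r + 1) ^ 2 * P.maxIncr / P.r := by
  have hr := r_pos P
  have hK := one_le_maxIncr P
  rw [le_div_iff₀ hr]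
  nlinarith [mul_nonneg (sq_nonneg (P.r + 1)) (by linarith : 0 ≤ P.maxIncr - 1)]

variable {Ω : Type*} [mΩ : MeasurableSpace Ω] {μ : Measure Ω} [IsProbabilityMeasure μ]
  {G : (n : ℕ) → Ω → TypedGraph P.T n}

/-- The highest degree exceeds (up to a factor close to `1`) every sequence `τ` whose relative
growth is less than the relative drift of a vertex of degree `τ`, as long as there is a single
leader or the highest degree is below a small multiple of `n`. The sequence `ν` is a lower bound of
the highest degree that is known in advance. -/
theorem IsGraphSequence.exists_eventually_le_maxDegree (hG : P.IsGraphSequence μ G) (i : Fin P.T) :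
    ∃ δ : ℝ, 0 < δ ∧ ∀ τ b γ ν : ℕ → ℝ,
      (∀ᶠ n in atTop, 0 < τ n ∧ τ n ≤ τ (n + 1) ∧ τ (n + 1) ≤ τ n * (1 + b n / n)) →
      (∀ᶠ n in atTop, τ n ≤ P.p i * P.S * n ∧ 0 ≤ b n ∧ 0 < ν n ∧ ν n ≤ n) → (∀ n, 0 < γ n) →
      (∀ᶠ n in atTop, b n + γ n
        ≤ P.growth (τ n / (P.p i * P.S * n)) - P.lowerErr i * (relErr n + 1 / ν n)) →
      (∀ᶠ n in atTop, 64 * (P.r + 1) ^ 2 * P.maxIncr ≤ γ n * ν n) →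
      (Summable fun n => 1 / (n * τ n)) → (¬ Summable fun n => γ n / n) →
      ∀ᵐ ω ∂μ, (∀ᶠ n in atTop, ν n ≤ (G n ω).maxDegree i) →
        (∀ᶠ n in atTop, ((G n ω).maxDegree i : ℝ) < τ n →
          ((G n ω).maxDegree i : ℝ) ≤ δ * n ∨ (leaders (G n ω) i).card = 1) →
        ∀ ε : ℝ, 0 < ε → ∀ᶠ n in atTop, (1 - ε) * τ n ≤ (G n ω).maxDegree i := by
  obtain ⟨δ, hδ, hdrift⟩ := eventually_le_mean_maxDegree_sub P i
  refine ⟨δ, hδ, fun τ b γ ν hτ hb hγ hgap hγν hsum hdiv => ?_⟩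
  have hS := S_pos P
  have hp := P.p_pos i
  have hr := r_pos P
  have hK := one_le_maxIncr P
  have hCpos : 0 < 64 * (P.r + 1) ^ 2 * P.maxIncr := by positivity
  have hE0 : 0 ≤ P.lowerErr i := by unfold lowerErr; positivity
  obtain ⟨n₀, hn₀⟩ := eventually_atTop.1 (hdrift.and (hτ.and (hb.and (hgap.and
    (hγν.and (eventually_ge_atTop 1))))))
  set a : ℕ → ℝ := fun n => P.growth (τ n / (P.p i * P.S * n))
    - P.lowerErr i * (relErr n + 1 / ν n) with ha
  have haR : ∀ n, n₀ ≤ n → a n ≤ P.r := by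
    intro n hn
    obtain ⟨-, ⟨h1, -⟩, ⟨h2, -, h3, -⟩, -, -, h4⟩ := hn₀ n hn
    have hn0 : (0 : ℝ) < n := by exact_mod_cast h4
    have h5 : P.growth (τ n / (P.p i * P.S * n)) ≤ P.r :=
      growth_le_r (by positivity) ((div_le_one (by positivity)).2 h2)
    have h6 : 0 ≤ P.lowerErr i * (relErr n + 1 / ν n) := by
      have := relErr_nonneg n
      positivity
    simp only [ha]; linarith
  have hγr : ∀ n, n₀ ≤ n → γ n ≤ P.r := fun n hn => by
    obtain ⟨-, -, ⟨-, h3, -⟩, h5, -⟩ := hn₀ n hn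
    have := haR n hn
    simp only [ha] at this
    linarith
  have h := hG.eventually_le_maxDegree i (τ := τ) (a := a) (b := b) (γ := γ) (B := P.r)
    (fun n => {g | Typical g ∧ ν n ≤ g.maxDegree i ∧ ((g.maxDegree i : ℝ) < τ n →
      (g.maxDegree i : ℝ) ≤ δ * n ∨ (leaders g i).card = 1)}) (n₀ := n₀) hr.le
    (fun n hn => (hn₀ n hn).2.1.1) (fun n hn => (hn₀ n hn).2.1.2.1)
    (fun n hn => (hn₀ n hn).2.1.2.2) (fun n hn => (hn₀ n hn).2.2.1.2.1)
    (fun n hn => by have := (hn₀ n hn).2.2.2.1; have := haR n hn; have := hγ n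
                    simp only [ha] at *; linarith) hγ
    (fun n hn => (hn₀ n hn).2.2.2.1) haR hsum hdiv
    (fun n hn => (hn₀ n hn).2.2.2.2.1.trans
      (mul_le_mul_of_nonneg_left (hn₀ n hn).2.2.1.2.2.2 (hγ n).le)) ?_
  · filter_upwards [h, hG.ae_typical] with ω h1 ht hν hor
    refine h1 ?_
    filter_upwards [ht, hν, hor] with n h2 h3 h4
    exact ⟨h2, h3, h4⟩
  · rintro n _ hn g ⟨ht, hν, hor⟩ hg hM
    obtain ⟨hd, -, ⟨h2, -, h3, -⟩, -, h5, h4⟩ := hn₀ n hn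
    have hn0 : (0 : ℝ) < n := by exact_mod_cast h4
    have hM0 : (0 : ℝ) < g.maxDegree i := h3.trans_le hν
    have hνM : γ n * ν n ≤ γ n * g.maxDegree i := mul_le_mul_of_nonneg_left hν (hγ n).le
    refine ⟨h5.trans hνM, ?_⟩
    have h16 : (16 : ℝ) ≤ g.maxDegree i := by
      refine (sixteen_le_div_r P).trans ?_
      rw [div_le_iff₀ hr]
      have : γ n * (g.maxDegree i : ℝ) ≤ P.r * g.maxDegree i := by
        gcongr; exact hγr n hn
      linarith
    have h6 := hd g hg ht (by exact_mod_cast h16) (hM.le.trans h2) (hor hM)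
    refine le_trans ?_ h6
    rw [mul_comm]
    refine mul_le_mul_of_nonneg_left ?_ (by positivity)
    have h7 : P.growth (τ n / (P.p i * P.S * n))
        ≤ P.growth (g.maxDegree i / (P.p i * P.S * n)) :=
      growth_anti (by gcongr) ((div_le_one (by positivity)).2 h2)
    have h8 : P.lowerErr i * (relErr n + 1 / g.maxDegree i)
        ≤ P.lowerErr i * (relErr n + 1 / ν n) := by gcongr
    simp only [ha]
    linarith

/-- The highest degree is less (up to a factor close to `1`) than every sequence `τ` whose relative
growth exceeds the relative drift of a vertex of degree `τ`. -/
theorem IsGraphSequence.exists_eventually_maxDegree_le (hG : P.IsGraphSequence μ G) (i : Fin P.T) :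
    ∃ C : ℝ, 0 ≤ C ∧ ∀ (τ b γ : ℕ → ℝ) (B : ℝ),
      (∀ᶠ n in atTop, P.maxIncr ≤ τ n ∧ τ n ≤ τ (n + 1) ∧ τ n * (1 + b n / n) ≤ τ (n + 1) ∧
        τ (n + 1) ≤ τ n * (1 + B / n)) →
      (∀ᶠ n in atTop, τ n ≤ P.p i * P.S * n) → (∀ n, 0 < γ n) →
      (∀ᶠ n in atTop, P.growth (τ n / (P.p i * P.S * n)) + C * (relErr n + 1 / τ n) + γ n ≤ b n) →
      (Summable fun n => 1 / τ n ^ 2) → (¬ Summable fun n => γ n / n) → 0 ≤ B →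
      ∀ᵐ ω ∂μ, ∀ ε : ℝ, 0 < ε → ∀ᶠ n in atTop, ((G n ω).maxDegree i : ℝ) ≤ (1 + ε) * τ n := by
  obtain ⟨C, hC, hdrift⟩ := eventually_mean_deg_sub_le P i
  refine ⟨C, hC, fun τ b γ B hτ hτS hγ hgap hsum hdiv hB => ?_⟩
  have hS := S_pos P
  have hp := P.p_pos i
  have hK := one_le_maxIncr P
  obtain ⟨n₀, hn₀⟩ := eventually_atTop.1 (hdrift.and (hτ.and (hτS.and (hgap.and
    (eventually_ge_atTop 1)))))
  refine hG.eventually_maxDegree_le i (n₀ := n₀) (b := b) (γ := γ) (B := B)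
    (a := fun n => P.growth (τ n / (P.p i * P.S * n)) + C * (relErr n + 1 / τ n)) hB
    (fun n hn => (hn₀ n hn).2.1.1) (fun n hn => (hn₀ n hn).2.1.2.1)
    (fun n hn => (hn₀ n hn).2.1.2.2.1) (fun n hn => (hn₀ n hn).2.1.2.2.2) hγ
    (fun n hn => (hn₀ n hn).2.2.2.1) hsum hdiv ?_
  intro n _ hn g hg ht v hv hD
  obtain ⟨hd, ⟨h1, -⟩, h2, -, h4⟩ := hn₀ n hn
  have hn0 : (0 : ℝ) < n := by exact_mod_cast h4
  have hτ0 : 0 < τ n := by linarith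
  have h6 := hd g hg ht v hv (τ n / (P.p i * P.S * n)) (by positivity)
    ((div_le_one (by positivity)).2 h2) (by rw [div_mul_cancel₀ _ (by positivity)]; exact hD.le)
  refine h6.trans ?_
  refine mul_le_mul_of_nonneg_left ?_ (by positivity)
  have : C * (relErr n + 1 / g.deg v) ≤ C * (relErr n + 1 / τ n) := by gcongr
  linarith

theorem not_summable_const_div {c : ℝ} (hc : 0 < c) : ¬ Summable fun n : ℕ => c / n := by
  intro h
  refine Real.not_summable_one_div_natCast ((h.mul_left (1 / c)).congr fun n => ?_)
  field_simp

/-- The highest degree tends to infinity: the drift of its inverse is at most a negative multiple of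
`1 / n` times the inverse, and `∑ 1 / n` diverges. -/
theorem IsGraphSequence.tendsto_maxDegree (hG : P.IsGraphSequence μ G) (i : Fin P.T) :
    ∀ᵐ ω ∂μ, Tendsto (fun n => ((G n ω).maxDegree i : ℝ)) atTop atTop := by
  have hS := S_pos P
  have hK := one_le_maxIncr P
  have hm := one_le_m P
  have hβ := P.neg_one_lt_β
  set c₀ := min 1 (1 + P.β) with hc₀
  have hc₀0 : 0 < c₀ := lt_min one_pos (by linarith)
  set c := P.m * c₀ / P.S with hc
  have hc0 : 0 < c := by positivity
  obtain ⟨n₀, hn₀⟩ := eventually_atTop.1 ((eventually_typical P).and (eventually_ge_atTop 2))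
  have h := hG.robbins_siegmund (fun n g => 1 / (g.maxDegree i : ℝ))
    (fun n g => c / n * (1 / (g.maxDegree i + P.maxIncr))) (fun n => {g | Typical g})
    (c := fun _ => 0) n₀ (fun n g => by positivity)
    (fun n g => by positivity) (fun n => le_rfl) summable_zero ?_
  · filter_upwards [h, hG.ae_typical, hG.ae_regular] with ω h1 ht hreg
    obtain ⟨⟨l, hl⟩, hs⟩ := h1 ht
    have hpos : ∀ᶠ n in atTop, 1 ≤ (G n ω).maxDegree i := by
      filter_upwards [ht, eventually_ge_atTop n₀] with n h2 h3
      exact one_le_maxDegree (hreg n) (hn₀ n h3).2 (by have := (hn₀ n h3).1 _ h2 i; omega)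
    have hX := tendsto_zero_of_not_summable (w := fun n => c / n) (fun n => by positivity)
      (not_summable_const_div hc0) (fun n => by positivity) hl ?_
    · have hX' : Tendsto (fun n => 1 / ((G n ω).maxDegree i : ℝ)) atTop (𝓝[>] 0) := by
        refine tendsto_nhdsWithin_iff.2 ⟨hX, ?_⟩
        filter_upwards [hpos] with n hn
        have : (1 : ℝ) ≤ (G n ω).maxDegree i := by exact_mod_cast hn
        exact Set.mem_Ioi.2 (by positivity)
      refine (tendsto_inv_nhdsGT_zero.comp hX').congr fun n => ?_
      simp
    · obtain ⟨N, hN⟩ := eventually_atTop.1 hpos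
      rw [← summable_nat_add_iff N] at hs ⊢
      refine Summable.of_nonneg_of_le (fun n => by positivity) (fun n => ?_)
        (hs.mul_left (1 + P.maxIncr))
      have h2 : (1 : ℝ) ≤ (G (n + N) ω).maxDegree i := by exact_mod_cast hN (n + N) (by omega)
      set M : ℝ := ((G (n + N) ω).maxDegree i : ℝ) with hM
      have h3 : 1 / M ≤ (1 + P.maxIncr) * (1 / (M + P.maxIncr)) := by
        rw [mul_one_div, div_le_div_iff₀ (by linarith) (by linarith)]
        nlinarith
      calc c / ((n + N : ℕ) : ℝ) * (1 / M)
          ≤ c / ((n + N : ℕ) : ℝ) * ((1 + P.maxIncr) * (1 / (M + P.maxIncr))) := by gcongr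
        _ = _ := by ring
  · intro n _ hn g ht hg
    obtain ⟨h2, hn2⟩ := hn₀ n hn
    have hi : 0 < typeCount g i := by have := h2 g ht i; omega
    have hM1 : (1 : ℝ) ≤ g.maxDegree i := by exact_mod_cast one_le_maxDegree hg hn2 hi
    have hd := le_mean_maxDegree_sub hg hn2 hi
    have hn0 : (0 : ℝ) < n := by exact_mod_cast (by omega : 0 < n)
    have htp := totWeight_pos hg hn2
    set M : ℝ := (g.maxDegree i : ℝ) with hM
    have h3 : c * (M / n) ≤ P.mean g (fun o => ((P.next g o).maxDegree i : ℝ) - M) := by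
      refine le_trans ?_ hd
      have h4 : c₀ * M ≤ M + P.β := by
        rcases le_total 0 P.β with h | h
        · have : c₀ * M ≤ 1 * M := by gcongr; exact min_le_left _ _
          linarith
        · have : c₀ * M ≤ (1 + P.β) * M := by gcongr; exact min_le_right _ _
          nlinarith
      have h5 : totWeight P n ≤ P.S * n := by
        have := one_le_k P
        rw [totWeight]; linarith
      calc c * (M / n) = P.m * ((c₀ * M) / (P.S * n)) := by rw [hc]; field_simp
        _ ≤ P.m * ((M + P.β) / totWeight P n) := by
          gcongr
          have : 0 ≤ c₀ * M := by positivity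
          linarith
    have h6 : ∀ o : P.Outcome n, 1 / ((P.next g o).maxDegree i : ℝ)
        ≤ 1 / M - 1 / (M * (M + P.maxIncr)) * (((P.next g o).maxDegree i : ℝ) - M) := by
      intro o
      obtain ⟨h7, h8⟩ := maxDegree_sub_mem (g := g) (i := i) o
      rw [← hM] at h7 h8
      set M' : ℝ := ((P.next g o).maxDegree i : ℝ) with hM'
      have e : 1 / M' = 1 / M - 1 / (M * M') * (M' - M) := by
        have : M' ≠ 0 := by intro h; rw [h] at h7; linarith
        field_simp; ring
      rw [e]
      have h9 : 1 / (M * (M + P.maxIncr)) ≤ 1 / (M * M') := by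
        gcongr
        · have : 0 < M' := by linarith
          positivity
        · linarith
      have := mul_le_mul_of_nonneg_right h9 h7
      linarith
    refine (mean_mono g h6).trans ?_
    rw [mean_sub, mean_const, mean_mul, add_zero]
    refine sub_le_sub_left ?_ _
    have h10 := mul_le_mul_of_nonneg_left h3 (by positivity : 0 ≤ 1 / (M * (M + P.maxIncr)))
    refine le_trans (le_of_eq ?_) h10
    have : M + P.maxIncr ≠ 0 := by positivity
    field_simp

theorem rpow_succ_le {s : ℝ} (h0 : 0 ≤ s) (h1 : s ≤ 1) {n : ℕ} (hn : 1 ≤ n) :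
    ((n + 1 : ℕ) : ℝ) ^ s ≤ (n : ℝ) ^ s * (1 + s / n) := by
  have hn0 : (0 : ℝ) < n := by exact_mod_cast hn
  have e : ((n + 1 : ℕ) : ℝ) = n * (1 + 1 / n) := by push_cast; field_simp
  rw [e, Real.mul_rpow hn0.le (by positivity)]
  gcongr
  have := rpow_one_add_le_one_add_mul_self (s := 1 / (n : ℝ))
    (by have : (0:ℝ) ≤ 1 / n := by positivity
        linarith) h0 h1
  rwa [mul_one_div] at this

/-- The highest degree is at least of the order `n ^ s` for every `s < min r 1`. -/
theorem IsGraphSequence.eventually_rpow_le (hG : P.IsGraphSequence μ G) (i : Fin P.T) {s : ℝ}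
    (hs0 : 0 < s) (hsr : s < P.r) (hs1 : s < 1) :
    ∀ᵐ ω ∂μ, ∀ᶠ n : ℕ in atTop, (n : ℝ) ^ s / 2 ≤ (G n ω).maxDegree i := by
  obtain ⟨δ, hδ, h⟩ := hG.exists_eventually_le_maxDegree i
  have hS := S_pos P
  have hp := P.p_pos i
  have hr := r_pos P
  have hK := one_le_maxIncr P
  have hE0 : 0 ≤ P.lowerErr i := by unfold lowerErr; positivity
  set γ := (P.r - s) / 2 with hγ
  have hγ0 : 0 < γ := by rw [hγ]; linarith
  set ν := max (64 * (P.r + 1) ^ 2 * P.maxIncr / γ) (8 * (P.lowerErr i + 1) / γ) with hν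
  have hν0 : 0 < ν := lt_max_of_lt_left (by positivity)
  -- `n ^ s` is negligible in comparison with `n`
  have hsmall : ∀ c : ℝ, 0 < c → ∀ᶠ n : ℕ in atTop, (n : ℝ) ^ s ≤ c * n := by
    intro c hc
    filter_upwards [eventually_le_rpow_of_lt (1 / c) hs1] with n hn
    rw [Real.rpow_one, div_mul_eq_mul_div, one_mul, div_le_iff₀ hc] at hn
    linarith
  set c₁ := γ * P.S / (4 * (P.k * P.d ^ 2)) with hc₁
  have hd0 : (0 : ℝ) < P.d := by exact_mod_cast lt_trans one_pos P.one_lt_d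
  have hk0 : (0 : ℝ) < P.k := by exact_mod_cast P.k_pos
  have hc₁0 : 0 < c₁ := by positivity
  have h1 := h (fun n => (n : ℝ) ^ s) (fun _ => s) (fun _ => γ) (fun _ => ν) ?_ ?_
    (fun _ => hγ0) ?_ ?_ ?_ (not_summable_const_div hγ0)
  · filter_upwards [h1, hG.tendsto_maxDegree i] with ω h2 h3
    have h4 := h2 (h3.eventually_ge_atTop ν) ?_ (1 / 2) (by norm_num)
    · filter_upwards [h4] with n hn
      linarith
    · filter_upwards [hsmall δ hδ] with n hn hlt
      exact Or.inl (hlt.le.trans hn)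
  · filter_upwards [eventually_ge_atTop 1] with n hn
    have hn0 : (0 : ℝ) < n := by exact_mod_cast hn
    refine ⟨by positivity, ?_, rpow_succ_le hs0.le hs1.le hn⟩
    gcongr
    exact_mod_cast Nat.le_succ n
  · filter_upwards [hsmall (P.p i * P.S) (by positivity), eventually_ge_atTop ⌈ν⌉₊]
      with n hn hn1
    exact ⟨hn, hs0.le, hν0, (Nat.le_ceil ν).trans (by exact_mod_cast hn1)⟩
  · filter_upwards [hsmall (P.p i * P.S * min 1 c₁) (by positivity), eventually_ge_atTop 1,
      tendsto_relErr.eventually_le_const (by positivity : 0 < γ / (8 * (P.lowerErr i + 1)))]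
      with n hn hn1 hrel
    have hn0 : (0 : ℝ) < n := by exact_mod_cast hn1
    have hy : (n : ℝ) ^ s / (P.p i * P.S * n) ≤ min 1 c₁ := by
      rw [div_le_iff₀ (by positivity)]; linarith
    have h2 := growth_sub_le (P := P) le_rfl (by positivity : 0 ≤ (n : ℝ) ^ s / (P.p i * P.S * n))
      (hy.trans (min_le_left _ _))
    rw [growth_zero] at h2
    have h3 : P.k * (P.d : ℝ) ^ 2 / P.S * ((n : ℝ) ^ s / (P.p i * P.S * n) - 0)
        ≤ P.k * (P.d : ℝ) ^ 2 / P.S * c₁ := by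
      rw [sub_zero]
      gcongr
      exact hy.trans (min_le_right _ _)
    have h4 : P.k * (P.d : ℝ) ^ 2 / P.S * c₁ = γ / 4 := by rw [hc₁]; field_simp
    have h5 : 1 / ν ≤ γ / (8 * (P.lowerErr i + 1)) := by
      rw [one_div_le hν0 (by positivity), one_div_div]
      exact le_max_right _ _
    have h6 : P.lowerErr i * (relErr n + 1 / ν)
        ≤ (P.lowerErr i + 1) * (γ / (8 * (P.lowerErr i + 1)) + γ / (8 * (P.lowerErr i + 1))) := by
      have := relErr_nonneg n
      gcongr
      linarith
    have h7 : (P.lowerErr i + 1) * (γ / (8 * (P.lowerErr i + 1)) + γ / (8 * (P.lowerErr i + 1)))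
        = γ / 4 := by field_simp; ring
    linarith
  · refine Eventually.of_forall fun n => ?_
    rw [mul_comm γ, ← div_le_iff₀ hγ0]
    exact le_max_left _ _
  · refine (Real.summable_one_div_nat_rpow.2 (by linarith : 1 < 1 + s)).congr fun n => ?_
    rcases Nat.eq_zero_or_pos n with rfl | hn
    · simp [Real.zero_rpow (by linarith : 1 + s ≠ 0)]
    · have hn0 : (0 : ℝ) < n := by exact_mod_cast hn
      rw [Real.rpow_add hn0, Real.rpow_one]

end Params

/-! ### The order of the highest degree -/

namespace Params

variable {P : Params}

/-- The constants that turn the drift of a degree into the drift of its `(l + 1)`-st power. -/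
theorem exists_pow_drift_le {r C K η : ℝ} (hr : 0 ≤ r) (hC : 0 ≤ C) (hK : 0 ≤ K) (hη : 0 < η)
    (l : ℕ) : ∃ C₂ : ℝ, 0 ≤ C₂ ∧ ∀ x ε : ℝ, 1 ≤ x → 0 ≤ ε → C * ε ≤ η →
      (x + K) ^ l * (r + C * (ε + 1 / x)) ≤ (r + 2 * η) * x ^ l + C₂ := by
  have hcont : Continuous fun z : ℝ => (1 + K * z) ^ l * (r + η + C * z) := by fun_prop
  have h0 : (fun z : ℝ => (1 + K * z) ^ l * (r + η + C * z)) 0 < r + 2 * η := by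
    simp; linarith
  obtain ⟨z₀, hz₀, hz⟩ := Metric.eventually_nhds_iff.1 (hcont.continuousAt.eventually_lt_const h0)
  refine ⟨(1 / z₀ + K) ^ l * (r + η + C), by positivity, fun x ε hx hε hCε => ?_⟩
  have hx0 : 0 < x := by linarith
  have hx1 : 1 / x ≤ 1 := by rw [div_le_one hx0]; exact hx
  have h1 : r + C * (ε + 1 / x) ≤ r + η + C * (1 / x) := by rw [mul_add]; linarith
  rcases lt_or_ge (1 / x) z₀ with h | h
  · have h2 := @hz (1 / x) (by rw [Real.dist_eq, sub_zero, abs_of_pos (by positivity)]; exact h)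
    have e : (x + K) ^ l = x ^ l * (1 + K * (1 / x)) ^ l := by
      rw [← mul_pow]; congr 1; field_simp
    have h3 : 0 ≤ (1 / z₀ + K) ^ l * (r + η + C) := by positivity
    calc (x + K) ^ l * (r + C * (ε + 1 / x)) ≤ (x + K) ^ l * (r + η + C * (1 / x)) := by gcongr
      _ = x ^ l * ((1 + K * (1 / x)) ^ l * (r + η + C * (1 / x))) := by rw [e]; ring
      _ ≤ x ^ l * (r + 2 * η) := by gcongr
      _ ≤ _ := by linarith
  · have h2 : x ≤ 1 / z₀ := by rw [le_one_div hx0 hz₀]; exact h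
    have h3 : C * (1 / x) ≤ C * 1 := by gcongr
    have h4 : 0 ≤ (r + 2 * η) * x ^ l := by positivity
    calc (x + K) ^ l * (r + C * (ε + 1 / x)) ≤ (1 / z₀ + K) ^ l * (r + η + C) := by
          gcongr (?_ + _) ^ l * ?_
          linarith
      _ ≤ _ := by linarith

theorem add_pow_succ_le {a b : ℝ} (ha : 0 ≤ a) (hb : 0 ≤ b) (l : ℕ) :
    (a + b) ^ (l + 1) ≤ a ^ (l + 1) + (l + 1) * (a + b) ^ l * b := by
  induction l with
  | zero => simp
  | succ l ih =>
    have h1 : a ^ (l + 1) ≤ (a + b) ^ (l + 1) := by gcongr; linarith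
    calc (a + b) ^ (l + 1 + 1) = (a + b) * (a + b) ^ (l + 1) := by ring
      _ ≤ (a + b) * (a ^ (l + 1) + (l + 1) * (a + b) ^ l * b) := by gcongr
      _ = a ^ (l + 1 + 1) + (b * a ^ (l + 1) + (l + 1) * (a + b) ^ (l + 1) * b) := by ring
      _ ≤ a ^ (l + 1 + 1) + (b * (a + b) ^ (l + 1) + (l + 1) * (a + b) ^ (l + 1) * b) := by gcongr
      _ = _ := by push_cast; ring

variable {Ω : Type*} [mΩ : MeasurableSpace Ω] {μ : Measure Ω} [IsProbabilityMeasure μ]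
  {G : (n : ℕ) → Ω → TypedGraph P.T n}

/-- The highest degree is at most `n ^ (r + ε)`, because a high moment of the degrees grows slower
than the corresponding power of `n ^ (r + ε)`. -/
theorem IsGraphSequence.eventually_lt_rpow (hG : P.IsGraphSequence μ G) (i : Fin P.T) {ε : ℝ}
    (hε : 0 < ε) :
    ∀ᵐ ω ∂μ, ∀ᶠ n : ℕ in atTop, ((G n ω).maxDegree i : ℝ) < (n : ℝ) ^ (P.r + ε) := by
  obtain ⟨C, hC, hdrift⟩ := eventually_mean_deg_sub_le P i
  have hr := r_pos P
  have hK := one_le_maxIncr P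
  obtain ⟨l, hl⟩ := exists_nat_gt (2 / ε)
  set q := l + 1 with hq
  have hq0 : (0 : ℝ) < q := by rw [hq]; positivity
  set s : ℝ := q * (P.r + ε / 2) with hs
  have hs1 : 1 < s := by
    have h1 : 2 < l * ε := by rwa [div_lt_iff₀ hε] at hl
    have h2 : (q : ℝ) = l + 1 := by rw [hq]; push_cast; ring
    rw [hs, h2]
    nlinarith [mul_nonneg (Nat.cast_nonneg (α := ℝ) l) hr.le]
  obtain ⟨C₂, hC₂, hpow⟩ := exists_pow_drift_le hr.le hC (by linarith : 0 ≤ P.maxIncr)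
    (by linarith : 0 < ε / 4) l
  set C₃ := q * (C₂ * (2 * (P.m + P.k))) + P.maxIncr ^ q with hC₃
  have hC₃0 : 0 ≤ C₃ := by positivity
  have hrel : ∀ᶠ n : ℕ in atTop, C * relErr n ≤ ε / 4 := by
    have := tendsto_relErr.const_mul C
    rw [mul_zero] at this
    exact this.eventually_le_const (by linarith)
  obtain ⟨n₀, hn₀⟩ := eventually_atTop.1 (hdrift.and (hrel.and (eventually_ge_atTop 2)))
  have h := hG.robbins_siegmund (fun n g => (∑ v ∈ typeVerts g i, (g.deg v : ℝ) ^ q) / (n : ℝ) ^ s)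
    (fun _ _ => 0) (fun n => {g | Typical g}) (c := fun n => C₃ * (1 / (n : ℝ) ^ s)) n₀
    (fun n g => by positivity) (fun _ _ => le_rfl) (fun n => by positivity)
    ((Real.summable_one_div_nat_rpow.2 hs1).mul_left _) ?_
  · filter_upwards [h, hG.ae_typical, hG.ae_regular] with ω h1 ht hreg
    obtain ⟨⟨L, hL⟩, -⟩ := h1 ht
    have hsq : s < q * (P.r + ε) := by rw [hs]; gcongr; linarith
    filter_upwards [ht, hL.eventually_le_const (lt_add_one L), eventually_ge_atTop 2,
      eventually_typical P, eventually_le_rpow_of_lt (L + 2) hsq] with n h2 h3 hn h4 h5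
    have hn0 : (0 : ℝ) < n := by exact_mod_cast (by omega : 0 < n)
    have hi : 0 < typeCount (G n ω) i := by have := h4 _ h2 i; omega
    obtain ⟨u, hu, hu'⟩ := exists_deg_eq_maxDegree hi
    have h6 : ((G n ω).maxDegree i : ℝ) ^ q ≤ (L + 1) * (n : ℝ) ^ s := by
      rw [div_le_iff₀ (by positivity)] at h3
      refine le_trans ?_ h3
      rw [← hu']
      exact Finset.single_le_sum (f := fun v => ((G n ω).deg v : ℝ) ^ q)
        (fun _ _ => by positivity) (mem_typeVerts.2 hu)
    have h7 : ((n : ℝ) ^ (P.r + ε)) ^ q = (n : ℝ) ^ (q * (P.r + ε)) := by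
      rw [← Real.rpow_mul_natCast hn0.le, mul_comm]
    refine lt_of_pow_lt_pow_left₀ q (by positivity) ?_
    rw [h7]
    have h8 : 0 < (n : ℝ) ^ s := by positivity
    linarith
  · intro n _ hn g ht hg
    obtain ⟨hd, hCε, hn2⟩ := hn₀ n hn
    have hn0 : (0 : ℝ) < n := by exact_mod_cast (by omega : 0 < n)
    set Φ := ∑ v ∈ typeVerts g i, (g.deg v : ℝ) ^ q with hΦ
    have hΦ0 : 0 ≤ Φ := Finset.sum_nonneg fun _ _ => by positivity
    have hpt : ∀ o : P.Outcome n, ∑ v ∈ typeVerts (P.next g o) i, ((P.next g o).deg v : ℝ) ^ q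
        ≤ Φ + ∑ v ∈ typeVerts g i, (q * (g.deg v + P.maxIncr) ^ l) * degIncr g o v
          + P.maxIncr ^ q := by
      intro o
      rw [sum_typeVerts_next, hΦ, ← Finset.sum_add_distrib]
      refine add_le_add (Finset.sum_le_sum fun v _ => ?_) ?_
      · have h1 : ((P.next g o).deg v.castSucc : ℝ) = g.deg v + degIncr g o v := by
          rw [degIncr]; ring
        have h2 := degIncr_nonneg (g := g) o v
        have h3 := degIncr_le (g := g) o v
        rw [h1]
        refine (add_pow_succ_le (Nat.cast_nonneg _) h2 l).trans ?_
        have e : (q : ℝ) = l + 1 := by rw [hq]; push_cast; ring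
        rw [e]
        gcongr
      · have := deg_last_le (g := g) o
        split_ifs
        · gcongr
        · positivity
    have hmean : P.mean g (fun o => ∑ v ∈ typeVerts (P.next g o) i, ((P.next g o).deg v : ℝ) ^ q)
        ≤ Φ * (1 + s / n) + C₃ := by
      refine (mean_mono g hpt).trans ?_
      rw [mean_add, mean_add, mean_const, mean_const, mean_sum]
      have h1 : ∀ v ∈ typeVerts g i,
          P.mean g (fun o => (q * (g.deg v + P.maxIncr) ^ l) * degIncr g o v)
          ≤ s / n * (g.deg v : ℝ) ^ q + q * C₂ / n * g.deg v := by
        intro v hv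
        rw [mean_mul]
        have hD : (1 : ℝ) ≤ g.deg v := by exact_mod_cast hg.2 hn2 v
        have h2 := hd g hg ht v (mem_typeVerts.1 hv) 0 le_rfl zero_le_one (by simp)
        rw [growth_zero] at h2
        have h3 := hpow (g.deg v) (relErr n) hD (relErr_nonneg n) hCε
        calc q * (g.deg v + P.maxIncr) ^ l * P.mean g (fun o => degIncr g o v)
            ≤ q * (g.deg v + P.maxIncr) ^ l
              * (g.deg v / n * (P.r + C * (relErr n + 1 / g.deg v))) := by gcongr; exact h2
          _ = q * (g.deg v / n) * ((g.deg v + P.maxIncr) ^ l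
              * (P.r + C * (relErr n + 1 / g.deg v))) := by ring
          _ ≤ q * (g.deg v / n) * ((P.r + 2 * (ε / 4)) * g.deg v ^ l + C₂) := by gcongr
          _ = _ := by rw [hs, hq, pow_succ]; ring
      have h2 := Finset.sum_le_sum h1
      rw [Finset.sum_add_distrib, ← Finset.mul_sum, ← Finset.mul_sum] at h2
      have h3 := sum_deg_le hg (by omega : 1 ≤ n) (typeVerts g i)
      have h4 : q * C₂ / n * ∑ v ∈ typeVerts g i, (g.deg v : ℝ)
          ≤ q * C₂ / n * (2 * (P.m + P.k) * n) := by gcongr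
      have h5 : q * C₂ / n * (2 * (P.m + P.k) * n) = q * (C₂ * (2 * (P.m + P.k))) := by field_simp
      rw [hC₃]
      linarith
    have e1 : P.mean g (fun o => (∑ v ∈ typeVerts (P.next g o) i, ((P.next g o).deg v : ℝ) ^ q)
        / ((n + 1 : ℕ) : ℝ) ^ s)
        = P.mean g (fun o => ∑ v ∈ typeVerts (P.next g o) i, ((P.next g o).deg v : ℝ) ^ q)
          / ((n + 1 : ℕ) : ℝ) ^ s := by
      simp only [div_eq_inv_mul]
      rw [mean_mul]
    rw [e1, sub_zero]
    have h1 : (n : ℝ) ^ s * (1 + s / n) ≤ ((n + 1 : ℕ) : ℝ) ^ s := by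
      have e : ((n + 1 : ℕ) : ℝ) = n * (1 + 1 / n) := by push_cast; field_simp
      rw [e, Real.mul_rpow hn0.le (by positivity)]
      gcongr
      have := one_add_mul_self_le_rpow_one_add (s := 1 / (n : ℝ))
        (by have : (0 : ℝ) ≤ 1 / n := by positivity
            linarith) hs1.le
      rwa [mul_one_div] at this
    have hns : 0 < (n : ℝ) ^ s := by positivity
    have hsn : 0 ≤ s / n := by positivity
    have h2 : (n : ℝ) ^ s ≤ ((n + 1 : ℕ) : ℝ) ^ s :=
      le_trans (le_mul_of_one_le_right hns.le (by linarith)) h1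
    calc _ ≤ (Φ * (1 + s / n) + C₃) / ((n + 1 : ℕ) : ℝ) ^ s := by gcongr
      _ = Φ * (1 + s / n) / ((n + 1 : ℕ) : ℝ) ^ s + C₃ / ((n + 1 : ℕ) : ℝ) ^ s := add_div _ _ _
      _ ≤ Φ * (1 + s / n) / ((n : ℝ) ^ s * (1 + s / n)) + C₃ / (n : ℝ) ^ s := by gcongr
      _ = _ := by field_simp

/-- An event that almost surely holds for all large `n` holds for all `n > n₀` with probability
tending to `1`. -/
theorem tendsto_measure_forall_lt {p : ℕ → Ω → Prop} (h : ∀ᵐ ω ∂μ, ∀ᶠ n in atTop, p n ω) :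
    Tendsto (fun n₀ : ℕ => μ {ω | ∀ n, n₀ < n → p n ω}) atTop (𝓝 1) := by
  have hm : Monotone fun n₀ : ℕ => {ω | ∀ n, n₀ < n → p n ω} := fun a b hab ω hω n hn =>
    hω n (lt_of_le_of_lt hab hn)
  have h1 := tendsto_measure_iUnion_atTop (μ := μ) hm
  have h2 : μ (⋃ n₀ : ℕ, {ω | ∀ n, n₀ < n → p n ω}) = 1 := by
    refine (measure_congr (eventuallyEq_univ.2 ?_)).trans measure_univ
    filter_upwards [h] with ω hω
    obtain ⟨N, hN⟩ := eventually_atTop.1 hω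
    exact Set.mem_iUnion.2 ⟨N, fun n hn => hN n hn.le⟩
  rwa [h2] at h1

theorem IsGraphSequence.tendsto_measure_of_r_lt_one (hG : P.IsGraphSequence μ G) (i : Fin P.T)
    (hr : P.r < 1) {ε : ℝ} (hε : 0 < ε) :
    Tendsto (fun n₀ : ℕ => μ {ω | ∀ n : ℕ, n₀ < n →
        (n : ℝ) ^ (P.r - ε) < ((G n ω).maxDegree i : ℝ) ∧
          ((G n ω).maxDegree i : ℝ) < (n : ℝ) ^ (P.r + ε)}) atTop (𝓝 1) := by
  refine tendsto_measure_forall_lt ?_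
  have hr0 := r_pos P
  set s := max (P.r - ε / 2) (P.r / 2) with hs
  have hs0 : 0 < s := lt_max_of_lt_right (by linarith)
  have hsr : s < P.r := max_lt (by linarith) (by linarith)
  have hsε : P.r - ε < s := lt_max_of_lt_left (by linarith)
  filter_upwards [hG.eventually_lt_rpow i hε, hG.eventually_rpow_le i hs0 hsr (hsr.trans hr)]
    with ω h1 h2
  filter_upwards [h1, h2, eventually_le_rpow_of_lt 3 hsε, eventually_ge_atTop 1] with n h3 h4 h5 hn
  refine ⟨?_, h3⟩
  have : 0 < (n : ℝ) ^ (P.r - ε) := Real.rpow_pos_of_pos (by exact_mod_cast hn) _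
  linarith

end Params

/-! ### A leader of linear degree is eventually unique -/

theorem sq_le_one_sub_pow {s : ℝ} (h1 : s ≤ 1) (l : ℕ) :
    s ^ 2 ≤ 1 - (1 - s) ^ (l + 2) - (l + 2) * (1 - s) ^ (l + 1) * s := by
  induction l with
  | zero => simp; nlinarith
  | succ l ih =>
    have h2 : 0 ≤ (l + 2) * (1 - s) ^ (l + 1) * s ^ 2 := by
      have : 0 ≤ 1 - s := by linarith
      positivity
    have e : 1 - (1 - s) ^ (l + 1 + 2) - ((l + 1 : ℕ) + 2) * (1 - s) ^ (l + 1 + 1) * s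
        = 1 - (1 - s) ^ (l + 2) - (l + 2) * (1 - s) ^ (l + 1) * s
          + (l + 2) * (1 - s) ^ (l + 1) * s ^ 2 := by push_cast; ring
    rw [e]; linarith

/-- If `L` leaders share the probability that the sample hits one of them, each of them gets more
than a vertex that is no leader and wins only if the sample contains no leader. The numbers `s` and
`t` are the probabilities that an element of the sample is a leader and the other vertex. -/
theorem sq_div_le_hit_sub {s t L : ℝ} {d : ℕ} (hd : 1 < d) (ht : 0 ≤ t) (hst : s + t ≤ 1)
    (hL : 0 < L) (htL : t ≤ s / L) :
    s ^ 2 / L ≤ (1 - (1 - s) ^ d) / L - ((1 - s) ^ d - (1 - s - t) ^ d) := by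
  obtain ⟨l, rfl⟩ : ∃ l, d = l + 2 := ⟨d - 2, by omega⟩
  have h1 := sq_le_one_sub_pow (by linarith : s ≤ 1) l
  have h2 := Params.add_pow_succ_le (by linarith : 0 ≤ 1 - s - t) ht (l + 1)
  rw [sub_add_cancel] at h2
  have h3 : ((l + 1 : ℕ) + 1) * (1 - s) ^ (l + 1) * t
      ≤ (l + 2) * (1 - s) ^ (l + 1) * s / L := by
    rw [mul_div_assoc]
    push_cast
    have : 0 ≤ 1 - s := by linarith
    rw [show (l : ℝ) + 1 + 1 = l + 2 by ring]
    gcongr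
  have h4 : s ^ 2 / L ≤ (1 - (1 - s) ^ (l + 2) - (l + 2) * (1 - s) ^ (l + 1) * s) / L := by gcongr
  rw [sub_div] at h4
  linarith

namespace Params

variable {P : Params}

section OneStep

variable {n : ℕ} {g : TypedGraph P.T n} {i : Fin P.T}

theorem degIncr_le_sub_of_mem_leaders (o : P.Outcome n) {u : Fin n} (hu : u ∈ leaders g i) :
    degIncr g o u ≤ ((P.next g o).maxDegree i : ℝ) - g.maxDegree i := by
  obtain ⟨h1, h2⟩ := mem_leaders.1 hu
  have h3 := deg_next_le_maxDegree o h1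
  rw [h2] at h3
  have h4 : ((g.maxDegree i + TypedGraph.attachHits o.2.1 u
      + TypedGraph.edgeHits o.2.2 u.castSucc : ℕ) : ℝ) ≤ ((P.next g o).maxDegree i : ℕ) := by
    exact_mod_cast h3
  push_cast at h4
  rw [degIncr_eq]; linarith

variable [NeZero n]

theorem draw_sub (t : Fin P.T) (w : Fin (n + 1)) (ρ ρ' : Fin (n + 1) → ℝ) :
    draw g t w (fun u => ρ u - ρ' u) = draw g t w ρ - draw g t w ρ' := by
  simp only [draw, Finset.sum_sub_distrib, sub_div, mul_sub]

theorem draw_div (t : Fin P.T) (w : Fin (n + 1)) (ρ : Fin (n + 1) → ℝ) (c : ℝ) :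
    draw g t w (fun u => ρ u / c) = draw g t w ρ / c := by
  simp only [draw, ← Finset.sum_div, div_right_comm _ c, ← mul_div_assoc]

/-- The advantage of the leaders over a vertex `v` that is no leader, in one draw. -/
theorem le_draw_sub_draw (h2 : ∀ j, 2 ≤ typeCount g j) (hg : P.Regular g) (hn : 2 ≤ n)
    (t : Fin P.T) {v w : Fin n} (hv : g.vtype v = i) (hvM : g.deg v < g.maxDegree i)
    (hw : g.vtype w = i) (hwv : w ≠ v) (hwl : w ∉ leaders g i) (hL : 0 < (leaders g i).card) :
    ((g.maxDegree i + P.β) / typeWeight g i) ^ 2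
      ≤ draw g t w.castSucc (fun x =>
          (if x ∈ (leaders g i).map Fin.castSuccEmb then 1 else 0) / (leaders g i).card
            - if x = v.castSucc then 1 else 0) := by
  set B := (leaders g i).map Fin.castSuccEmb with hB
  set L : ℝ := ((leaders g i).card : ℝ) with hLd
  have hL1 : 1 ≤ L := by rw [hLd]; exact_mod_cast hL
  have hW := typeWeight_pos hg hn hv
  have hpos := typeWeight_sub_wt_pos h2 hg hn w
  rw [hw] at hpos
  set s := ∑ x ∈ B, sampleProb g t w.castSucc x with hs
  set z := sampleProb g t w.castSucc v.castSucc with hz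
  have hsum : ∑ x ∈ leaders g i, wt g x = L * (g.maxDegree i + P.β) := by
    rw [Finset.sum_congr rfl fun x hx => wt_leader hx, Finset.sum_const, nsmul_eq_mul]
  have hs' : s = L * (g.maxDegree i + P.β) / (typeWeight g i - wt g w) := by
    rw [hs, hB, sum_sampleProb_map h2 hg hn t hw (A := leaders g i) (Finset.filter_subset _ _) hwl,
      hsum]
  have hz' : z = wt g v / (typeWeight g i - wt g w) := by
    rw [hz, sampleProb_castSucc h2 hg hn, if_pos ⟨hwv.symm, hv.trans hw.symm⟩, hw]
  have hvB : v.castSucc ∉ B := by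
    intro h
    obtain ⟨x, hx, hxv⟩ := Finset.mem_map.1 h
    rw [Fin.coe_castSuccEmb, Fin.castSucc_inj] at hxv
    rw [hxv] at hx
    exact hvM.ne (mem_leaders.1 hx).2
  have hwtv : wt g v ≤ g.maxDegree i + P.β := by
    have : (g.deg v : ℝ) ≤ g.maxDegree i := by exact_mod_cast hvM.le
    rw [wt]; linarith
  have hwv0 := wt_pos hg hn v
  have hzL : z ≤ s / L := by
    rw [hz', hs', mul_div_assoc, mul_div_cancel_left₀ _ (by linarith : L ≠ 0)]
    gcongr
  have hsz : s + z ≤ 1 := by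
    have := sum_sampleProb_le_one (g := g) t w.castSucc (insert v.castSucc B)
    rw [Finset.sum_insert hvB] at this
    linarith
  rw [draw_sub, draw_div]
  have h3 : 1 - (1 - s) ^ P.d ≤ draw g t w.castSucc (fun x => if x ∈ B then 1 else 0) :=
    le_draw_indicator g t w.castSucc B B fun y hy hyA => best_subset_leaders h2 hg hn hw hy hyA
  have h4 : draw g t w.castSucc (fun x => if x = v.castSucc then 1 else 0)
      ≤ (1 - s) ^ P.d - (1 - s - z) ^ P.d := by
    refine draw_single_le g t w.castSucc v.castSucc B hvB fun y hy hb => ?_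
    obtain ⟨j, hj⟩ := hy
    obtain ⟨x, hx, hxj⟩ := Finset.mem_map.1 hj
    have h5 := (Finset.mem_filter.1 hb).2 j
    rw [← hxj, Fin.coe_castSuccEmb, oldDeg_castSucc, oldDeg_castSucc, (mem_leaders.1 hx).2] at h5
    omega
  have h5 := sq_div_le_hit_sub P.one_lt_d (sampleProb_nonneg _ _ _ _) hsz (by linarith) hzL
  have h6 : ((g.maxDegree i + P.β) / typeWeight g i) ^ 2 ≤ s ^ 2 / L := by
    have h7 : L * ((g.maxDegree i + P.β) / typeWeight g i) ≤ s := by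
      rw [hs', mul_div_assoc]
      have := wt_pos hg hn w
      have : 0 ≤ (g.maxDegree i : ℝ) + P.β := by linarith
      gcongr
      linarith
    have h8 : 0 ≤ (g.maxDegree i + P.β) / typeWeight g i := div_nonneg (by linarith) hW.le
    rw [le_div_iff₀ (by linarith)]
    have h9 : (L * ((g.maxDegree i + P.β) / typeWeight g i)) ^ 2 ≤ s ^ 2 := by gcongr
    have h10 : ((g.maxDegree i + P.β) / typeWeight g i) ^ 2 * L
        ≤ ((g.maxDegree i + P.β) / typeWeight g i) ^ 2 * (L * L) := by
      gcongr
      nlinarith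
    nlinarith
  have h7 : (1 - (1 - s) ^ P.d) / L
      ≤ draw g t w.castSucc (fun x => if x ∈ B then 1 else 0) / L := by gcongr
  linarith

/-- The highest degree grows faster than the degree of a vertex that is no leader. The highest degree
is at least the average of the degrees of the present leaders, and the average leader is drawn more
often than `v`. The first ends that are leaders, `v`, or the new vertex are estimated trivially. -/
theorem le_mean_maxDegree_sub_degIncr (h2 : ∀ j, 2 ≤ typeCount g j) (hg : P.Regular g)
    (hn : 2 ≤ n) {v : Fin n} (hv : g.vtype v = i) (hvM : g.deg v < g.maxDegree i) :
    P.k * ((((typeCount g i : ℝ) - (leaders g i).card - 1)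
        * ((g.maxDegree i + P.β) / typeWeight g i) ^ 2 - 2 * ((leaders g i).card + 2)) / (n + 1))
      ≤ P.mean g (fun o => ((P.next g o).maxDegree i : ℝ) - g.maxDegree i - degIncr g o v) := by
  obtain ⟨u, hu, hu'⟩ := exists_deg_eq_maxDegree (g := g) (i := i) (by have := h2 i; omega)
  have hL : 0 < (leaders g i).card := Finset.card_pos.2 ⟨u, mem_leaders.2 ⟨hu, hu'⟩⟩
  set B := (leaders g i).map Fin.castSuccEmb with hB
  set L : ℝ := ((leaders g i).card : ℝ) with hLd
  have hL0 : 0 < L := by rw [hLd]; exact_mod_cast hL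
  set y := (g.maxDegree i + P.β) / typeWeight g i with hy
  set ρ : Fin (n + 1) × Fin (n + 1) → ℝ := fun x =>
    ((if x.2 ∈ B then 1 else 0) / L - if x.2 = v.castSucc then 1 else 0)
      - if x.1 = v.castSucc then 1 else 0 with hρ
  have hρ2 : ∀ x, -2 ≤ ρ x := by
    intro x
    have : (0 : ℝ) ≤ (if x.2 ∈ B then 1 else 0) / L := by split_ifs <;> positivity
    simp only [hρ]
    split_ifs at * <;> linarith
  have hb : ∀ t, (((typeCount g i : ℝ) - L - 1) * y ^ 2 - 2 * (L + 2)) / (n + 1)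
      ≤ ∑ x, edgeProb g t x * ρ x := by
    intro t
    rw [sum_edgeProb_mul, div_eq_inv_mul]
    refine mul_le_mul_of_nonneg_left ?_ (by positivity)
    rw [Fin.sum_univ_castSucc]
    have hd2 : ∀ w, -2 ≤ draw g t w (fun x => ρ (w, x)) := fun w => by
      rw [← draw_const g t w (-2)]
      exact draw_mono g fun x => hρ2 _
    -- the first ends that favour the leaders
    set C := (typeVerts g i) \ insert v (leaders g i) with hC
    have hCc : (typeCount g i : ℝ) - L - 1 ≤ C.card := by
      have h3 := Finset.le_card_sdiff (insert v (leaders g i)) (typeVerts g i)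
      rw [← hC] at h3
      have h4 := Finset.card_insert_le v (leaders g i)
      have h5 : ((typeVerts g i).card : ℝ) ≤ C.card + ((leaders g i).card + 1 : ℕ) := by
        exact_mod_cast (by omega)
      push_cast at h5
      have h6 : (typeCount g i : ℝ) = (typeVerts g i).card := rfl
      linarith
    have key : ∀ w : Fin n, (if w ∈ C then y ^ 2 else 0)
        - (if w ∈ insert v (leaders g i) then 2 else 0) ≤ draw g t w.castSucc
          (fun x => ρ (w.castSucc, x)) := by
      intro w
      by_cases hwi : w ∈ insert v (leaders g i)
      · have : w ∉ C := fun h => (Finset.mem_sdiff.1 h).2 hwi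
        rw [if_neg this, if_pos hwi]
        linarith [hd2 w.castSucc]
      · rw [if_neg hwi, sub_zero]
        have hwv : w ≠ v := fun h => hwi (h ▸ Finset.mem_insert_self _ _)
        have hwl : w ∉ leaders g i := fun h => hwi (Finset.mem_insert_of_mem h)
        have hwv' : w.castSucc ≠ v.castSucc := fun h => hwv (Fin.castSucc_inj.1 h)
        by_cases hwt : g.vtype w = i
        · rw [if_pos (Finset.mem_sdiff.2 ⟨mem_typeVerts.2 hwt, hwi⟩)]
          simp only [hρ, if_neg hwv', sub_zero]
          exact le_draw_sub_draw h2 hg hn t hv hvM hwt hwv hwl hL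
        · rw [if_neg fun h => hwt (mem_typeVerts.1 (Finset.mem_sdiff.1 h).1)]
          rw [draw_congr (ρ' := fun x => (if x ∈ B then 1 else 0) / L)]
          · exact draw_nonneg g fun x => by split_ifs <;> positivity
          · intro x hx
            have h3 := (newTypes_eq_of_sampleProb_ne_zero h2 hx).2
            have h4 : x ≠ v.castSucc := by
              rintro rfl
              simp only [newTypes_castSucc] at h3
              exact hwt (h3.symm.trans hv)
            simp only [hρ, if_neg hwv', if_neg h4, sub_zero]
    have h3 := Finset.sum_le_sum fun w (_ : w ∈ Finset.univ) => key w
    rw [Finset.sum_sub_distrib, Finset.sum_ite_mem, Finset.sum_ite_mem, Finset.univ_inter,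
      Finset.univ_inter, Finset.sum_const, Finset.sum_const, nsmul_eq_mul, nsmul_eq_mul] at h3
    have h4 : ((insert v (leaders g i)).card : ℝ) ≤ L + 1 := by
      rw [hLd]
      exact_mod_cast Finset.card_insert_le v (leaders g i)
    have h5 : ((typeCount g i : ℝ) - L - 1) * y ^ 2 ≤ C.card * y ^ 2 := by gcongr
    linarith [hd2 (Fin.last n)]
  have h3 := le_mean_edge (g := g) (ρ := fun _ => ρ) hb
  refine h3.trans ?_
  -- compare the highest degree with the average degree of the leaders
  have hatt : 0 ≤ P.mean g (fun o => (∑ x ∈ leaders g i, (TypedGraph.attachHits o.2.1 x : ℝ)) / L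
      - TypedGraph.attachHits o.2.1 v) := by
    have e : (fun o : P.Outcome n => (∑ x ∈ leaders g i, (TypedGraph.attachHits o.2.1 x : ℝ)) / L
        - TypedGraph.attachHits o.2.1 v) = fun o : P.Outcome n =>
        L⁻¹ * (∑ x ∈ leaders g i, (TypedGraph.attachHits o.2.1 x : ℝ))
          - TypedGraph.attachHits o.2.1 v := by funext o; rw [div_eq_inv_mul]
    rw [e, mean_sub, mean_mul, mean_sum, mean_attachHits hg hn v,
      Finset.sum_congr rfl fun x _ => mean_attachHits hg hn x,
      Finset.sum_congr rfl fun x hx => by rw [wt_leader hx], Finset.sum_const, nsmul_eq_mul,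
      ← hLd, inv_mul_cancel_left₀ hL0.ne', sub_nonneg]
    have h4 : (g.deg v : ℝ) ≤ g.maxDegree i := by exact_mod_cast hvM.le
    have := totWeight_pos hg hn
    rw [wt]
    gcongr
  have h4 : P.mean g (fun o => ∑ l, ρ (o.2.2 l))
      ≤ P.mean g (fun o => ((∑ x ∈ leaders g i, (TypedGraph.attachHits o.2.1 x : ℝ)) / L
        - TypedGraph.attachHits o.2.1 v) + ∑ l, ρ (o.2.2 l)) := by
    rw [mean_add]; linarith
  refine h4.trans (mean_mono g fun o => ?_)
  have h5 : (∑ x ∈ leaders g i, degIncr g o x) / L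
      ≤ ((P.next g o).maxDegree i : ℝ) - g.maxDegree i := by
    rw [div_le_iff₀ hL0]
    refine (Finset.sum_le_card_nsmul _ _ _ fun x hx => degIncr_le_sub_of_mem_leaders o hx).trans ?_
    rw [nsmul_eq_mul, mul_comm]
  have h6 : ∑ l, ρ (o.2.2 l) ≤ (∑ x ∈ leaders g i, (TypedGraph.edgeHits o.2.2 x.castSucc : ℝ)) / L
      - TypedGraph.edgeHits o.2.2 v.castSucc := by
    simp only [TypedGraph.edgeHits, Nat.cast_sum, Nat.cast_add, Nat.cast_ite, Nat.cast_one,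
      Nat.cast_zero]
    rw [Finset.sum_comm, Finset.sum_div, ← Finset.sum_sub_distrib]
    refine Finset.sum_le_sum fun l _ => ?_
    have h7 : (if (o.2.2 l).2 ∈ B then (1 : ℝ) else 0)
        ≤ ∑ x ∈ leaders g i, ((if (o.2.2 l).1 = x.castSucc then (1 : ℝ) else 0)
          + if (o.2.2 l).2 = x.castSucc then 1 else 0) := by
      split_ifs with h
      · obtain ⟨x, hx, hxl⟩ := Finset.mem_map.1 h
        refine le_trans ?_ (Finset.single_le_sum (fun _ _ => ?_) hx)
        · have hx2 : (o.2.2 l).2 = x.castSucc := hxl.symm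
          rw [if_pos hx2]
          split_ifs <;> norm_num
        · split_ifs <;> norm_num
      · exact Finset.sum_nonneg fun _ _ => by split_ifs <;> norm_num
    have h8 := div_le_div_of_nonneg_right h7 hL0.le
    simp only [hρ]
    linarith
  rw [degIncr_eq]
  simp only [degIncr_eq, Finset.sum_add_distrib, add_div] at h5
  linarith

/-- The highest degree grows faster than the degree of a leader `v`, if there is another leader `u`:
with positive probability, all edges of the vertex step end in `u`, and no edge of the edge step
meets `v`, since all of them start in vertices of other types. -/
theorem le_mean_maxDegree_sub_degIncr_of_leaders (h2 : ∀ j, 2 ≤ typeCount g j) (hg : P.Regular g)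
    (hn : 2 ≤ n) {u v : Fin n} (hu : u ∈ leaders g i) (hv : v ∈ leaders g i) (huv : v ≠ u) :
    ((g.maxDegree i + P.β) / totWeight P n) ^ P.m * (((n : ℝ) - typeCount g i) / (n + 1)) ^ P.k
      ≤ P.mean g (fun o => ((P.next g o).maxDegree i : ℝ) - g.maxDegree i - degIncr g o v) := by
  have hvi := (mem_leaders.1 hv).1
  have hprod := mean_prod g (fun x => if x = u then (1 : ℝ) else 0)
    (fun _ x => if x.1 = v.castSucc ∨ x.2 = v.castSucc then (0 : ℝ) else 1)
  have hb : ∀ t, ((n : ℝ) - typeCount g i) / (n + 1)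
      ≤ ∑ x, edgeProb g t x * if x.1 = v.castSucc ∨ x.2 = v.castSucc then (0 : ℝ) else 1 := by
    intro t
    rw [sum_edgeProb_mul, div_eq_inv_mul]
    refine mul_le_mul_of_nonneg_left ?_ (by positivity)
    rw [Fin.sum_univ_castSucc]
    refine le_add_of_le_of_nonneg ?_ (draw_nonneg g fun x => by split_ifs <;> norm_num)
    have key : ∀ w : Fin n, (1 - if g.vtype w = i then (1 : ℝ) else 0)
        ≤ draw g t w.castSucc
          (fun x => if w.castSucc = v.castSucc ∨ x = v.castSucc then (0 : ℝ) else 1) := by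
      intro w
      split_ifs with hw
      · rw [sub_self]
        exact draw_nonneg g fun x => by split_ifs <;> norm_num
      · rw [draw_congr (ρ' := fun _ => 1), draw_const, sub_zero]
        intro x hx
        have h3 := (newTypes_eq_of_sampleProb_ne_zero h2 hx).2
        rw [if_neg]
        rintro (h | rfl)
        · rw [Fin.castSucc_inj] at h
          exact hw (h ▸ hvi)
        · simp only [newTypes_castSucc] at h3
          exact hw (h3.symm.trans hvi)
    refine le_trans (le_of_eq ?_) (Finset.sum_le_sum fun w _ => key w)
    rw [Finset.sum_sub_distrib]
    simp [typeCount, typeVerts]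
  have hN : 0 ≤ ((n : ℝ) - typeCount g i) / (n + 1) := by
    have : (typeCount g i : ℝ) ≤ n := by exact_mod_cast typeCount_le i
    exact div_nonneg (by linarith) (by positivity)
  have e1 : ∑ x, attachProb g x * (if x = u then (1 : ℝ) else 0)
      = (g.maxDegree i + P.β) / totWeight P n := by
    simp [attachProb_eq hg hn, wt_leader hu]
  have h0 : 0 ≤ (g.maxDegree i + P.β) / totWeight P n := by
    rw [← wt_leader hu]
    exact div_nonneg (wt_pos hg hn u).le (totWeight_pos hg hn).le
  rw [e1] at hprod
  calc _ = ∑ t, P.p t * (((g.maxDegree i + P.β) / totWeight P n) ^ P.m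
        * (((n : ℝ) - typeCount g i) / (n + 1)) ^ P.k) := by
        rw [← Finset.sum_mul, P.p_sum, one_mul]
    _ ≤ _ := by
        refine Finset.sum_le_sum fun t _ => mul_le_mul_of_nonneg_left ?_ (P.p_pos t).le
        refine mul_le_mul_of_nonneg_left ?_ (pow_nonneg h0 _)
        exact pow_le_pow_left₀ hN (hb t) _
    _ = _ := hprod.symm
    _ ≤ _ := by
        refine mean_mono g fun o => ?_
        have hMv := degIncr_le_sub_of_mem_leaders (g := g) o hv
        have hMu := degIncr_le_sub_of_mem_leaders (g := g) o hu
        by_cases h1 : ∀ j, o.2.1 j = u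
        · by_cases h3 : ∃ l, (o.2.2 l).1 = v.castSucc ∨ (o.2.2 l).2 = v.castSucc
          · obtain ⟨l, hl⟩ := h3
            rw [Finset.prod_eq_zero (s := Finset.univ) (i := l) (f := fun l =>
              if (o.2.2 l).1 = v.castSucc ∨ (o.2.2 l).2 = v.castSucc then (0 : ℝ) else 1)
              (Finset.mem_univ l) (if_pos hl), mul_zero]
            linarith
          · push Not at h3
            have h4 : degIncr g o v = 0 := by
              rw [degIncr_eq]
              have h5 : TypedGraph.attachHits o.2.1 v = 0 :=
                Finset.sum_eq_zero fun j _ => if_neg (by rw [h1 j]; exact huv.symm)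
              have h6 : TypedGraph.edgeHits o.2.2 v.castSucc = 0 :=
                Finset.sum_eq_zero fun l _ => by simp [(h3 l).1, (h3 l).2]
              rw [h5, h6]; simp
            have h5 : 1 ≤ degIncr g o u := by
              rw [degIncr_eq]
              have h6 : TypedGraph.attachHits o.2.1 u = P.m := by
                simp [TypedGraph.attachHits, h1]
              rw [h6]
              have := one_le_m P
              have : (0 : ℝ) ≤ TypedGraph.edgeHits o.2.2 u.castSucc := Nat.cast_nonneg _
              linarith
            have h6 : (∏ j, if o.2.1 j = u then (1 : ℝ) else 0) = 1 :=
              Finset.prod_eq_one fun j _ => if_pos (h1 j)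
            have h7 : (∏ l, if (o.2.2 l).1 = v.castSucc ∨ (o.2.2 l).2 = v.castSucc then (0 : ℝ)
                else 1) = 1 :=
              Finset.prod_eq_one fun l _ => if_neg (by push Not; exact h3 l)
            rw [h6, h7]
            linarith
        · push Not at h1
          obtain ⟨j, hj⟩ := h1
          rw [Finset.prod_eq_zero (Finset.mem_univ j) (if_neg hj), zero_mul]
          linarith

end OneStep

/-- If the highest degree is linear in `n`, it grows faster, by a constant, than the degree of every
vertex except for one leader. -/
theorem exists_le_mean_maxDegree_sub_degIncr (P : Params) (i : Fin P.T) {δ : ℝ} (hδ : 0 < δ) :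
    ∃ η : ℝ, 0 < η ∧ ∀ᶠ n : ℕ in atTop, ∀ [NeZero n], ∀ g : TypedGraph P.T n,
      P.Regular g → Typical g → δ * n ≤ g.maxDegree i → ∀ u ∈ leaders g i, ∀ v,
      g.vtype v = i → v ≠ u →
      η ≤ P.mean g (fun o => ((P.next g o).maxDegree i : ℝ) - g.maxDegree i - degIncr g o v) := by
  have hS := S_pos P
  have hp := P.p_pos i
  have hp1 : 0 < 1 - P.p i := by linarith [P.p_lt_one i]
  have hk := one_le_k P
  have hm := one_le_m P
  have hβ := P.neg_one_lt_β
  set y := δ / (2 * P.S) with hy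
  have hy0 : 0 < y := by positivity
  set L₀ := 2 * (P.m + P.k) / δ with hL₀
  have hL₀0 : 0 < L₀ := by positivity
  refine ⟨min (P.p i * y ^ 2 / 8) (y ^ P.m * ((1 - P.p i) / 4) ^ P.k), by positivity, ?_⟩
  have hrel : ∀ᶠ n : ℕ in atTop, relErr n ≤ (1 - P.p i) / 4 :=
    tendsto_relErr.eventually_le_const (by positivity)
  filter_upwards [eventually_typical P, eventually_relErr_le P (c := 1 / 4) (by norm_num), hrel,
    eventually_ge_atTop 2, eventually_ge_atTop ⌈2 / δ⌉₊,
    eventually_ge_atTop ⌈8 * ((L₀ + 1) * y ^ 2 + 2 * (L₀ + 2)) / (P.p i * y ^ 2)⌉₊]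
    with n h1 h2 h3 hn hnδ hnL _ g hg ht hM u hu v hv hvu
  have h2' := h1 g ht
  have hn2 : (2 : ℝ) ≤ n := by exact_mod_cast hn
  have hn0 : (0 : ℝ) < n := by linarith
  have hnδ' : 2 ≤ δ * n := by
    have : 2 / δ ≤ n := (Nat.le_ceil _).trans (by exact_mod_cast hnδ)
    rw [div_le_iff₀ hδ] at this; linarith
  have hMβ : δ * n / 2 ≤ g.maxDegree i + P.β := by linarith
  have htot : totWeight P n ≤ P.S * n := by rw [totWeight]; linarith
  have htp := totWeight_pos hg hn
  have hW := typeWeight_pos hg hn hv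
  have hya : y ≤ (g.maxDegree i + P.β) / totWeight P n := by
    rw [le_div_iff₀ htp]
    calc y * totWeight P n ≤ y * (P.S * n) := by gcongr
      _ = δ * n / 2 := by rw [hy]; field_simp
      _ ≤ _ := hMβ
  by_cases hvl : v ∈ leaders g i
  · refine le_trans ?_ (le_mean_maxDegree_sub_degIncr_of_leaders h2' hg hn hu hvl hvu)
    refine (min_le_right _ _).trans ?_
    have h4 : (1 - P.p i) / 4 ≤ ((n : ℝ) - typeCount g i) / (n + 1) := by
      have h5 := (ht.count (by omega) i).2
      rw [le_div_iff₀ (by positivity)]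
      have h6 : (P.p i + relErr n) * n ≤ (P.p i + (1 - P.p i) / 4) * n := by gcongr
      nlinarith
    exact mul_le_mul (pow_le_pow_left₀ hy0.le hya _) (pow_le_pow_left₀ (by positivity) h4 _)
      (by positivity) (pow_nonneg (hy0.le.trans hya) _)
  · have hvM : g.deg v < g.maxDegree i :=
      lt_of_le_of_ne (deg_le_maxDegree hv) fun h => hvl (mem_leaders.2 ⟨hv, h⟩)
    refine le_trans ?_ (le_mean_maxDegree_sub_degIncr h2' hg hn hv hvM)
    refine (min_le_left _ _).trans ?_
    have hyW : y ≤ (g.maxDegree i + P.β) / typeWeight g i := by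
      refine hya.trans ?_
      have : 0 ≤ (g.maxDegree i : ℝ) + P.β := le_trans (by positivity) hMβ
      gcongr
      exact typeWeight_le hg hn i
    have hLL : ((leaders g i).card : ℝ) ≤ L₀ := by
      have h4 := sum_deg_le hg (by omega : 1 ≤ n) (leaders g i)
      rw [Finset.sum_congr rfl fun x hx => by rw [(mem_leaders.1 hx).2], Finset.sum_const,
        nsmul_eq_mul] at h4
      have h5 : ((leaders g i).card : ℝ) * (δ * n) ≤ (leaders g i).card * g.maxDegree i := by
        gcongr
      rw [hL₀, le_div_iff₀ hδ]
      refine le_of_mul_le_mul_right ?_ hn0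
      linarith
    set L : ℝ := ((leaders g i).card : ℝ) with hLd
    have hLn : (L₀ + 1) * y ^ 2 + 2 * (L₀ + 2) ≤ P.p i * y ^ 2 / 8 * n := by
      have h4 : 8 * ((L₀ + 1) * y ^ 2 + 2 * (L₀ + 2)) / (P.p i * y ^ 2) ≤ n :=
        (Nat.le_ceil _).trans (by exact_mod_cast hnL)
      rw [div_le_iff₀ (by positivity)] at h4
      linarith
    have hN : P.p i / 2 * (n + 1) ≤ typeCount g i := by
      have h4 := (ht.count (by omega) i).1
      have h5 : (P.p i - 1 / 4 * P.p i) * n ≤ (P.p i - relErr n) * n := by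
        gcongr; exact (h2 i).1
      nlinarith
    have hNL : 0 ≤ (typeCount g i : ℝ) - L - 1 := by
      have h4 : L₀ + 1 ≤ P.p i / 8 * n := by
        have : (L₀ + 1) * y ^ 2 ≤ (P.p i / 8 * n) * y ^ 2 := by linarith
        exact le_of_mul_le_mul_right this (by positivity)
      have : 0 ≤ P.p i * n := by positivity
      linarith
    set Y := (g.maxDegree i + P.β) / typeWeight g i with hYd
    have h6 : P.p i * y ^ 2 / 8
        ≤ (((typeCount g i : ℝ) - L - 1) * Y ^ 2 - 2 * (L + 2)) / (n + 1) := by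
      rw [le_div_iff₀ (by positivity)]
      have h7 : ((typeCount g i : ℝ) - L - 1) * y ^ 2 ≤ ((typeCount g i : ℝ) - L - 1) * Y ^ 2 := by
        gcongr
      have h8 : P.p i / 2 * (n + 1) * y ^ 2 ≤ typeCount g i * y ^ 2 := by gcongr
      have h9 : L * y ^ 2 ≤ L₀ * y ^ 2 := by gcongr
      have h10 : 0 ≤ P.p i * y ^ 2 := by positivity
      nlinarith
    calc P.p i * y ^ 2 / 8
        ≤ 1 * ((((typeCount g i : ℝ) - L - 1) * Y ^ 2 - 2 * (L + 2)) / (n + 1)) := by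
          rw [one_mul]; exact h6
      _ ≤ _ := by
          refine mul_le_mul_of_nonneg_right hk (le_trans (by positivity) h6)

/-- The exponential moment of the lead, `∑ v, exp (-l * (M - deg v))`. It is at least the number of
leaders. -/
def leadMoment {n : ℕ} (g : TypedGraph P.T n) (i : Fin P.T) (l : ℝ) : ℝ :=
  ∑ v ∈ typeVerts g i, Real.exp (-l * (g.maxDegree i - g.deg v))

theorem card_leaders_le_leadMoment {n : ℕ} (g : TypedGraph P.T n) (i : Fin P.T) (l : ℝ) :
    ((leaders g i).card : ℝ) ≤ leadMoment g i l := by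
  have h1 : ((leaders g i).card : ℝ)
      = ∑ v ∈ leaders g i, Real.exp (-l * (g.maxDegree i - g.deg v)) := by
    rw [Finset.sum_congr rfl fun v hv => by rw [(mem_leaders.1 hv).2, sub_self, mul_zero,
      Real.exp_zero], Finset.sum_const, nsmul_eq_mul, mul_one]
  rw [h1]
  exact Finset.sum_le_sum_of_subset_of_nonneg (Finset.filter_subset _ _)
    fun _ _ _ => (Real.exp_pos _).le

theorem abs_maxDegree_sub_degIncr_le {n : ℕ} {g : TypedGraph P.T n} {i : Fin P.T}
    (o : P.Outcome n) (v : Fin n) :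
    |((P.next g o).maxDegree i : ℝ) - g.maxDegree i - degIncr g o v| ≤ P.maxIncr := by
  obtain ⟨h1, h2⟩ := maxDegree_sub_mem (g := g) (i := i) o
  have h3 := degIncr_nonneg (g := g) o v
  have h4 := degIncr_le (g := g) o v
  rw [abs_le]
  constructor <;> linarith

/-- A bounded increment with positive mean has an exponential moment less than `1`. -/
theorem mean_exp_le {n : ℕ} [NeZero n] {g : TypedGraph P.T n} {ψ : P.Outcome n → ℝ} {K η l : ℝ}
    (hψ : ∀ o, |ψ o| ≤ K) (hη : η ≤ P.mean g ψ) (hl0 : 0 < l) (hlK : l * K ≤ 1)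
    (hlη : 2 * (l * K ^ 2) ≤ η) :
    P.mean g (fun o => Real.exp (-l * ψ o)) ≤ 1 - l * η / 2 := by
  have h1 : ∀ o, Real.exp (-l * ψ o) ≤ (1 + (l * K) ^ 2) - l * ψ o := by
    intro o
    have h2 : |-l * ψ o| ≤ l * K := by
      rw [abs_mul, abs_neg, abs_of_pos hl0]
      exact mul_le_mul_of_nonneg_left (hψ o) hl0.le
    have h3 := (abs_le.1 (Real.abs_exp_sub_one_sub_id_le (h2.trans hlK))).2
    have h4 : (-l * ψ o) ^ 2 ≤ (l * K) ^ 2 := by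
      rw [← sq_abs]; exact pow_le_pow_left₀ (abs_nonneg _) h2 2
    linarith
  refine (mean_mono g h1).trans ?_
  rw [mean_sub, mean_const, mean_mul]
  have h5 := mul_le_mul_of_nonneg_left hη hl0.le
  have h6 := mul_le_mul_of_nonneg_left hlη hl0.le
  nlinarith

variable {Ω : Type*} [mΩ : MeasurableSpace Ω] {μ : Measure Ω} [IsProbabilityMeasure μ]
  {G : (n : ℕ) → Ω → TypedGraph P.T n}

/-- If the highest degree is linear in `n`, then eventually there is a single leader. -/
theorem IsGraphSequence.eventually_card_leaders (hG : P.IsGraphSequence μ G) (i : Fin P.T) {δ : ℝ}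
    (hδ : 0 < δ) :
    ∀ᵐ ω ∂μ, (∀ᶠ n in atTop, δ * n ≤ (G n ω).maxDegree i) →
      ∀ᶠ n in atTop, (leaders (G n ω) i).card = 1 := by
  obtain ⟨η, hη, hgap⟩ := exists_le_mean_maxDegree_sub_degIncr P i hδ
  have hK := one_le_maxIncr P
  set K := P.maxIncr with hKd
  have hK0 : 0 < K := by linarith
  set l := min (1 / K) (η / (2 * K ^ 2)) with hl
  have hl0 : 0 < l := by positivity
  have hlK : l * K ≤ 1 := by
    have : l * K ≤ 1 / K * K := by gcongr; exact min_le_left _ _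
    rwa [one_div_mul_cancel hK0.ne'] at this
  have hlη : 2 * (l * K ^ 2) ≤ η := by
    have : l * K ^ 2 ≤ η / (2 * K ^ 2) * K ^ 2 := by gcongr; exact min_le_right _ _
    have e : η / (2 * K ^ 2) * K ^ 2 = η / 2 := by field_simp
    linarith
  obtain ⟨n₀, hn₀⟩ := eventually_atTop.1 (hgap.and ((eventually_typical P).and
    (eventually_ge_atTop 2)))
  have hθ : 0 < l * η / 2 := by positivity
  -- One leader contributes `1` to `leadMoment`. On average, the rest shrinks by a constant factor, up
  -- to the contribution of the new vertex, which is far behind.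
  have h := hG.robbins_siegmund (fun _ g => max (leadMoment g i l - 1) 0)
    (fun _ g => l * η / 2 * max (leadMoment g i l - 1) 0)
    (fun n => {g | Typical g ∧ δ * n ≤ g.maxDegree i})
    (c := fun n => Real.exp (-l * (δ * n - K))) n₀ (fun _ _ => le_max_right _ _)
    (fun _ g => mul_nonneg hθ.le (le_max_right _ _)) (fun _ => (Real.exp_pos _).le) ?_ ?_
  · filter_upwards [h, hG.ae_typical] with ω h1 ht hM
    obtain ⟨-, hs⟩ := h1 (ht.and hM)
    have h2 := hs.tendsto_atTop_zero
    filter_upwards [h2.eventually_lt_const hθ, ht, eventually_ge_atTop n₀] with n h3 h4 h5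
    have h6 : max (leadMoment (G n ω) i l - 1) 0 < 1 := by
      by_contra h7
      push Not at h7
      nlinarith
    have h7 := card_leaders_le_leadMoment (G n ω) i l
    have h8 : ((leaders (G n ω) i).card : ℝ) < 2 := by
      linarith [le_max_left (leadMoment (G n ω) i l - 1) 0]
    have h9 : (leaders (G n ω) i).card < 2 := by exact_mod_cast h8
    obtain ⟨u, hu, hu'⟩ := exists_deg_eq_maxDegree (g := G n ω) (i := i)
      (by have := (hn₀ n h5).2.1 _ h4 i; omega)
    have h10 : 0 < (leaders (G n ω) i).card := Finset.card_pos.2 ⟨u, mem_leaders.2 ⟨hu, hu'⟩⟩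
    omega
  · have h1 : Real.exp (-l * δ) < 1 := by
      rw [Real.exp_lt_one_iff]
      nlinarith
    refine ((summable_geometric_of_lt_one (Real.exp_pos _).le h1).mul_left
      (Real.exp (l * K))).congr fun n => ?_
    rw [← Real.exp_nat_mul, ← Real.exp_add]
    congr 1; ring
  · rintro n _ hn g ⟨ht, hM⟩ hg
    obtain ⟨hg1, ht2, hn2⟩ := hn₀ n hn
    have h2' := ht2 g ht
    obtain ⟨u, hu, hu'⟩ := exists_deg_eq_maxDegree (g := g) (i := i)
      (by have := h2' i; omega)
    have hut : u ∈ typeVerts g i := mem_typeVerts.2 hu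
    have hul : u ∈ leaders g i := mem_leaders.2 ⟨hu, hu'⟩
    have hY : leadMoment g i l - 1
        = ∑ v ∈ (typeVerts g i).erase u, Real.exp (-l * (g.maxDegree i - g.deg v)) := by
      rw [leadMoment, ← Finset.add_sum_erase _ _ hut, hu']
      simp
    have hY0 : 0 ≤ leadMoment g i l - 1 := by
      rw [hY]; exact Finset.sum_nonneg fun _ _ => (Real.exp_pos _).le
    rw [max_eq_left hY0]
    have hpt : ∀ o, max (leadMoment (P.next g o) i l - 1) 0
        ≤ ∑ v ∈ (typeVerts g i).erase u, Real.exp (-l * (g.maxDegree i - g.deg v))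
          * Real.exp (-l * (((P.next g o).maxDegree i : ℝ) - g.maxDegree i - degIncr g o v))
          + Real.exp (-l * (δ * n - K)) := by
      intro o
      refine max_le ?_ (by positivity)
      have h3 : (∑ v ∈ (typeVerts g i).erase u, Real.exp (-l * (g.maxDegree i - g.deg v))
          * Real.exp (-l * (((P.next g o).maxDegree i : ℝ) - g.maxDegree i - degIncr g o v)))
          = ∑ v ∈ (typeVerts g i).erase u, Real.exp (-l * ((P.next g o).maxDegree i
            - (P.next g o).deg v.castSucc)) := by
        refine Finset.sum_congr rfl fun v _ => ?_
        rw [← Real.exp_add, degIncr]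
        congr 1; ring
      have h4 : Real.exp (-l * ((P.next g o).maxDegree i - (P.next g o).deg u.castSucc)) ≤ 1 := by
        rw [Real.exp_le_one_iff]
        have h5 : ((P.next g o).deg u.castSucc : ℝ) ≤ (P.next g o).maxDegree i := by
          exact_mod_cast deg_le_maxDegree ((vtype_next_castSucc o u).trans hu)
        nlinarith
      have h5 : (if o.1 = i then Real.exp (-l * ((P.next g o).maxDegree i
          - (P.next g o).deg (Fin.last n))) else 0) ≤ Real.exp (-l * (δ * n - K)) := by
        split_ifs
        · rw [Real.exp_le_exp]
          have h6 := deg_last_le (g := g) o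
          have h7 := (maxDegree_sub_mem (g := g) (i := i) o).1
          have h8 : δ * n - K ≤ (P.next g o).maxDegree i - (P.next g o).deg (Fin.last n) := by
            linarith
          nlinarith
        · positivity
      rw [h3, leadMoment, sum_typeVerts_next, ← Finset.add_sum_erase _ _ hut]
      linarith
    refine (mean_mono g hpt).trans ?_
    rw [mean_add, mean_const, mean_sum]
    refine add_le_add_left ?_ _
    have e : leadMoment g i l - 1 - l * η / 2 * (leadMoment g i l - 1)
        = ∑ v ∈ (typeVerts g i).erase u, Real.exp (-l * (g.maxDegree i - g.deg v))
          * (1 - l * η / 2) := by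
      rw [← Finset.sum_mul, ← hY]; ring
    rw [e]
    refine Finset.sum_le_sum fun v hv => ?_
    obtain ⟨hvu, hvt⟩ := Finset.mem_erase.1 hv
    rw [mean_mul]
    refine mul_le_mul_of_nonneg_left ?_ (Real.exp_pos _).le
    exact mean_exp_le (fun o => abs_maxDegree_sub_degIncr_le o v)
      (hg1 g hg ht hM u hul v (mem_typeVerts.1 hvt) hvu) hl0 hlK hlη

end Params

/-! ### The equation `f x = x` -/

theorem hitRatio_lt {d : ℕ} (hd : 1 < d) {x y : ℝ} (hxy : x < y) (hy : y ≤ 1) :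
    hitRatio d y < hitRatio d x :=
  Finset.sum_lt_sum (fun j _ => pow_le_pow_left₀ (by linarith) (by linarith) j)
    ⟨1, Finset.mem_range.2 hd, by simpa using hxy⟩

theorem hitRatio_one {d : ℕ} (hd : 1 < d) : hitRatio d 1 = 1 := by
  have := mul_hitRatio d 1
  rw [one_mul] at this
  rw [this, sub_self, zero_pow (by omega), sub_zero]

/-- Here `d` has to be even: for odd `d ≥ 3`, `hitRatio d z` is large for large `z`. -/
theorem hitRatio_lt_one {d : ℕ} (hd : Even d) {z : ℝ} (hz : 1 < z) : hitRatio d z < 1 := by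
  have h1 := mul_hitRatio d z
  have h2 := hd.pow_nonneg (1 - z)
  nlinarith

namespace Params

variable {P : Params}

theorem continuous_growth (P : Params) : Continuous P.growth := by
  unfold growth hitRatio
  fun_prop

theorem growth_lt {x y : ℝ} (hxy : x < y) (hy : y ≤ 1) : P.growth y < P.growth x := by
  have := S_pos P
  have := one_le_k P
  have := hitRatio_lt P.one_lt_d hxy hy
  unfold growth
  gcongr

theorem growth_lt_one_of_hitRatio_le {z : ℝ} (h : hitRatio P.d z ≤ 1) : P.growth z < 1 := by
  have hS := S_pos P
  have hk := one_le_k P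
  have hm := one_le_m P
  have hβ := P.neg_one_lt_β
  rw [growth, div_lt_one hS, S]
  nlinarith

theorem f_eq (x : ℝ) : P.f x = x * P.growth (x / P.S) := by
  rw [f, ← mul_hitRatio, growth]; ring

/-- In terms of the share `y = x / S`, the equation `f x = x` says that a vertex of degree
`p i * x * n` has relative drift `1 / n`. -/
theorem f_eq_self_iff {x : ℝ} (hx : 0 < x) : P.f x = x ↔ P.growth (x / P.S) = 1 := by
  rw [f_eq, mul_eq_left₀ hx.ne']

theorem exists_growth_eq_one (hr : 1 < P.r) : ∃ y, 0 < y ∧ y < 1 ∧ P.growth y = 1 := by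
  have h1 : P.growth 1 < 1 := growth_lt_one_of_hitRatio_le (hitRatio_one P.one_lt_d).le
  have h0 : 1 < P.growth 0 := by rwa [growth_zero]
  obtain ⟨y, hy, hy1⟩ := intermediate_value_Ioo' zero_le_one P.continuous_growth.continuousOn
    ⟨h1, h0⟩
  exact ⟨y, hy.1, hy.2, hy1⟩

theorem eq_of_growth_eq_one {x y : ℝ} (hx : x ≤ 1) (hy : y ≤ 1) (hgx : P.growth x = 1)
    (hgy : P.growth y = 1) : x = y := by
  rcases lt_trichotomy x y with h | h | h
  · have := growth_lt (P := P) h hy; linarith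
  · exact h
  · have := growth_lt (P := P) h hx; linarith

/-! ### Degrees of linear order -/

variable {Ω : Type*} [mΩ : MeasurableSpace Ω] {μ : Measure Ω}

/-- Almost sure convergence follows from almost sure eventual bounds. -/
theorem ae_tendsto_of_eventually_bounds {u : ℕ → Ω → ℝ} {a : ℝ} (hu : ∀ n ω, 0 ≤ u n ω)
    (h1 : ∀ θ, 0 < θ → θ < a → ∀ᵐ ω ∂μ, ∀ ε : ℝ, 0 < ε → ∀ᶠ n in atTop, (1 - ε) * θ ≤ u n ω)
    {b : ℝ} (hab : a < b)
    (h2 : ∀ θ, a < θ → θ < b → ∀ᵐ ω ∂μ, ∀ ε : ℝ, 0 < ε → ∀ᶠ n in atTop, u n ω ≤ (1 + ε) * θ)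
    (ha : 0 < a) :
    ∀ᵐ ω ∂μ, Tendsto (fun n => u n ω) atTop (𝓝 a) := by
  obtain ⟨x, -, hx, hxa⟩ := exists_seq_strictMono_tendsto' ha
  obtain ⟨y, -, hy, hya⟩ := exists_seq_strictAnti_tendsto' hab
  filter_upwards [ae_all_iff.2 fun k => h1 (x k) (hx k).1 (hx k).2,
    ae_all_iff.2 fun k => h2 (y k) (hy k).1 (hy k).2] with ω hω1 hω2
  refine tendsto_order.2 ⟨fun c hc => ?_, fun c hc => ?_⟩
  · rcases lt_or_ge c 0 with h0 | h0
    · exact Eventually.of_forall fun n => h0.trans_le (hu n ω)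
    obtain ⟨k, hk⟩ := (hxa.eventually_const_lt hc).exists
    have hxk := (hx k).1
    filter_upwards [hω1 k ((1 - c / x k) / 2) (by
      have : c / x k < 1 := (div_lt_one hxk).2 hk
      linarith)] with n hn
    refine lt_of_lt_of_le ?_ hn
    have e : (1 - (1 - c / x k) / 2) * x k = (x k + c) / 2 := by field_simp; ring
    rw [e]; linarith
  · obtain ⟨k, hk⟩ := (hya.eventually_lt_const hc).exists
    have hyk : 0 < y k := ha.trans (hy k).1
    filter_upwards [hω2 k ((c / y k - 1) / 2) (by
      have : 1 < c / y k := (one_lt_div hyk).2 hk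
      linarith)] with n hn
    refine lt_of_le_of_lt hn ?_
    have e : (1 + (c / y k - 1) / 2) * y k = (y k + c) / 2 := by field_simp; ring
    rw [e]; linarith

variable [IsProbabilityMeasure μ] {G : (n : ℕ) → Ω → TypedGraph P.T n}

theorem tendsto_rpow_neg_natCast {s : ℝ} (hs : 0 < s) :
    Tendsto (fun n : ℕ => (n : ℝ) ^ (-s)) atTop (𝓝 0) :=
  (tendsto_rpow_neg_atTop hs).comp tendsto_natCast_atTop_atTop

theorem tendsto_rpow_natCast {s : ℝ} (hs : 0 < s) :
    Tendsto (fun n : ℕ => (n : ℝ) ^ s) atTop atTop :=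
  (tendsto_rpow_atTop hs).comp tendsto_natCast_atTop_atTop

theorem one_div_rpow_half (n : ℕ) : 1 / ((n : ℝ) ^ (1 / 2 : ℝ) / 2)
    = 2 * (n : ℝ) ^ (-(1 / 2) : ℝ) := by
  rw [Real.rpow_neg (Nat.cast_nonneg _), one_div_div, div_eq_mul_inv]

theorem rpow_half_div_two_le {n : ℕ} (hn : 1 ≤ n) : (n : ℝ) ^ (1 / 2 : ℝ) / 2 ≤ n := by
  have h1 : (1 : ℝ) ≤ n := by exact_mod_cast hn
  have h2 := Real.rpow_le_rpow_of_exponent_le h1 (by norm_num : (1 / 2 : ℝ) ≤ 1)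
  rw [Real.rpow_one] at h2
  linarith

/-- Lower bounds for the highest degree by `θ * n`, as long as there is a single leader or the highest
degree is at most `δ * n`. -/
theorem IsGraphSequence.exists_eventually_le_linear (hG : P.IsGraphSequence μ G) (i : Fin P.T) :
    ∃ δ : ℝ, 0 < δ ∧ ∀ θ : ℝ, 0 < θ → θ ≤ P.p i * P.S → 1 < P.growth (θ / (P.p i * P.S)) →
      ∀ᵐ ω ∂μ, (∀ᶠ n in atTop, ((G n ω).maxDegree i : ℝ) < θ * n →
          ((G n ω).maxDegree i : ℝ) ≤ δ * n ∨ (leaders (G n ω) i).card = 1) →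
        ∀ ε : ℝ, 0 < ε → ∀ᶠ n in atTop, (1 - ε) * (θ * n) ≤ (G n ω).maxDegree i := by
  obtain ⟨δ, hδ, h⟩ := hG.exists_eventually_le_maxDegree i
  refine ⟨δ, hδ, fun θ hθ hθS hgr => ?_⟩
  have hq0 : 0 < P.p i * P.S := mul_pos (P.p_pos i) (S_pos P)
  have hr : 1 < P.r :=
    hgr.trans_le (growth_le_r (by positivity) ((div_le_one hq0).2 hθS))
  set γ := (P.growth (θ / (P.p i * P.S)) - 1) / 2 with hγ
  have hγ0 : 0 < γ := by rw [hγ]; linarith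
  have h1 := h (fun n => θ * n) (fun _ => 1) (fun _ => γ) (fun n => (n : ℝ) ^ (1 / 2 : ℝ) / 2)
    ?_ ?_ (fun _ => hγ0) ?_ ?_ ?_ (not_summable_const_div hγ0)
  · filter_upwards [h1, hG.eventually_rpow_le i (s := 1 / 2) (by norm_num) (by linarith)
      (by norm_num)] with ω h2 h3 h4
    exact h2 h3 h4
  · filter_upwards [eventually_ge_atTop 1] with n hn
    have hn0 : (0 : ℝ) < n := by exact_mod_cast hn
    refine ⟨by positivity, ?_, le_of_eq ?_⟩
    · push_cast; nlinarith
    · push_cast; field_simp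
  · filter_upwards [eventually_ge_atTop 1] with n hn
    have hn0 : (0 : ℝ) < n := by exact_mod_cast hn
    exact ⟨by gcongr, zero_le_one, by positivity, rpow_half_div_two_le hn⟩
  · have h2 : Tendsto (fun n : ℕ => P.lowerErr i * (relErr n + 2 * (n : ℝ) ^ (-(1 / 2) : ℝ))) atTop
        (𝓝 0) := by
      have := (tendsto_relErr.add ((tendsto_rpow_neg_natCast
        (s := 1 / 2) (by norm_num)).const_mul 2)).const_mul (P.lowerErr i)
      simpa using this
    filter_upwards [h2.eventually_le_const hγ0, eventually_ge_atTop 1] with n h3 hn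
    have hn0 : (0 : ℝ) < n := by exact_mod_cast hn
    rw [mul_div_mul_right _ _ hn0.ne', one_div_rpow_half]
    linarith
  · filter_upwards [(tendsto_rpow_natCast (s := 1 / 2) (by norm_num)).eventually_ge_atTop
      (2 * (64 * (P.r + 1) ^ 2 * P.maxIncr / γ))] with n hn
    have h2 : 64 * (P.r + 1) ^ 2 * P.maxIncr / γ ≤ (n : ℝ) ^ (1 / 2 : ℝ) / 2 := by linarith
    rw [div_le_iff₀ hγ0] at h2
    linarith
  · refine ((Real.summable_one_div_nat_pow.2 one_lt_two).mul_left (1 / θ)).congr fun n => ?_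
    rw [one_div_mul_one_div]
    congr 1; ring

theorem IsGraphSequence.eventually_maxDegree_le_linear (hG : P.IsGraphSequence μ G) (i : Fin P.T)
    {θ : ℝ} (hθ : 0 < θ) (hθS : θ ≤ P.p i * P.S) (hgr : P.growth (θ / (P.p i * P.S)) < 1) :
    ∀ᵐ ω ∂μ, ∀ ε : ℝ, 0 < ε → ∀ᶠ n in atTop,
      ((G n ω).maxDegree i : ℝ) ≤ (1 + ε) * (θ * (n : ℝ)) := by
  obtain ⟨C, hC, h⟩ := hG.exists_eventually_maxDegree_le i
  set γ := (1 - P.growth (θ / (P.p i * P.S))) / 2 with hγ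
  have hγ0 : 0 < γ := by rw [hγ]; linarith
  have hlin : Tendsto (fun n : ℕ => θ * (n : ℝ)) atTop atTop :=
    tendsto_natCast_atTop_atTop.const_mul_atTop hθ
  refine h (fun n => θ * n) (fun _ => 1) (fun _ => γ) 1 ?_ ?_ (fun _ => hγ0) ?_ ?_
    (not_summable_const_div hγ0) zero_le_one
  · filter_upwards [eventually_ge_atTop 1, hlin.eventually_ge_atTop P.maxIncr] with n hn h1
    have hn0 : (0 : ℝ) < n := by exact_mod_cast hn
    have e : θ * ((n + 1 : ℕ) : ℝ) = θ * n * (1 + 1 / n) := by push_cast; field_simp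
    refine ⟨h1, ?_, e.ge, e.le⟩
    push_cast; nlinarith
  · exact Eventually.of_forall fun n => by gcongr
  · have h2 : Tendsto (fun n : ℕ => C * (relErr n + 1 / (θ * (n : ℝ)))) atTop (𝓝 0) := by
      have := (tendsto_relErr.add (tendsto_const_nhds (x := (1 : ℝ)) |>.div_atTop hlin)).const_mul C
      simpa using this
    filter_upwards [h2.eventually_le_const hγ0, eventually_ge_atTop 1] with n h3 hn
    have hn0 : (0 : ℝ) < n := by exact_mod_cast hn
    rw [mul_div_mul_right _ _ hn0.ne']
    linarith
  · refine ((Real.summable_one_div_nat_pow.2 one_lt_two).mul_left (1 / θ ^ 2)).congr fun n => ?_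
    rw [one_div_mul_one_div]
    congr 1; ring

theorem IsGraphSequence.ae_tendsto_maxDegree_div (hG : P.IsGraphSequence μ G) (i : Fin P.T)
    {y : ℝ} (hy0 : 0 < y) (hy1 : y < 1) (hgr : P.growth y = 1) :
    ∀ᵐ ω ∂μ, Tendsto (fun n => ((G n ω).maxDegree i : ℝ) / n) atTop (𝓝 (P.p i * P.S * y)) := by
  have hq0 : 0 < P.p i * P.S := mul_pos (P.p_pos i) (S_pos P)
  refine ae_tendsto_of_eventually_bounds (b := P.p i * P.S) (fun n ω => by positivity) ?_
    (mul_lt_of_lt_one_right hq0 hy1) ?_ (by positivity)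
  · obtain ⟨δ, hδ, h⟩ := hG.exists_eventually_le_linear i
    have hlt : ∀ θ, 0 < θ → θ < P.p i * P.S * y → θ ≤ P.p i * P.S ∧
        1 < P.growth (θ / (P.p i * P.S)) := by
      intro θ hθ hθy
      have h1 : θ / (P.p i * P.S) < y := by rw [div_lt_iff₀ hq0]; linarith
      refine ⟨?_, ?_⟩
      · rw [div_lt_iff₀ hq0] at h1; nlinarith
      · rw [← hgr]; exact growth_lt h1 hy1.le
    -- a rough linear lower bound, which implies that there is eventually a single leader
    set δ' := min δ (P.p i * P.S * y / 2) with hδ'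
    have hδ'0 : 0 < δ' := by positivity
    have hδ'y : δ' < P.p i * P.S * y := by
      refine (min_le_right _ _).trans_lt ?_
      have : 0 < P.p i * P.S * y := by positivity
      linarith
    have hrough := h δ' hδ'0 (hlt δ' hδ'0 hδ'y).1 (hlt δ' hδ'0 hδ'y).2
    intro θ hθ hθy
    filter_upwards [hrough, h θ hθ (hlt θ hθ hθy).1 (hlt θ hθ hθy).2,
      hG.eventually_card_leaders i (half_pos hδ'0)] with ω h1 h2 h3 ε hε
    have h4 := h1 (Eventually.of_forall fun n hn => Or.inl (hn.le.trans (by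
      gcongr; exact min_le_left _ _))) (1 / 2) (by norm_num)
    have h5 := h3 (h4.mono fun n hn => le_trans (le_of_eq (by ring)) hn)
    filter_upwards [h2 (h5.mono fun n hn _ => Or.inr hn) ε hε, eventually_gt_atTop 0]
      with n hn hn0
    have hn0 : (0 : ℝ) < n := by exact_mod_cast hn0
    rw [le_div_iff₀ hn0]; linarith
  · intro θ hθy hθq
    have hθ : 0 < θ := lt_trans (by positivity) hθy
    have h1 : y < θ / (P.p i * P.S) := by rw [lt_div_iff₀ hq0]; linarith
    have h2 : θ / (P.p i * P.S) ≤ 1 := (div_le_one hq0).2 hθq.le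
    filter_upwards [hG.eventually_maxDegree_le_linear i hθ hθq.le
      (hgr ▸ growth_lt h1 h2)] with ω h3 ε hε
    filter_upwards [h3 ε hε, eventually_gt_atTop 0] with n hn hn0
    have hn0 : (0 : ℝ) < n := by exact_mod_cast hn0
    rw [div_le_iff₀ hn0]; linarith

end Params

/-! ### Degrees of order `n / log n` -/

theorem one_sub_pow_le {y : ℝ} (h0 : 0 ≤ y) (h1 : y ≤ 1) (j : ℕ) :
    (1 - y) ^ j ≤ 1 - j * y + (j * y) ^ 2 := by
  induction j with
  | zero => simp
  | succ j ih =>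
    have h2 : 0 ≤ (j : ℝ) * y := by positivity
    have h3 : (1 - y) ^ (j + 1) ≤ (1 - y) * (1 - j * y + (j * y) ^ 2) := by
      rw [pow_succ']
      exact mul_le_mul_of_nonneg_left ih (by linarith)
    refine h3.trans ?_
    push_cast
    have h4 : 0 ≤ y * (j * y) ^ 2 := by positivity
    nlinarith [mul_nonneg h0 h2, sq_nonneg y]

theorem sum_range_cast (d : ℕ) : ∑ j ∈ Finset.range d, (j : ℝ) = d * (d - 1) / 2 := by
  induction d with
  | zero => simp
  | succ d ih => rw [Finset.sum_range_succ, ih]; push_cast; ring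

theorem le_hitRatio {d : ℕ} {y : ℝ} (h1 : y ≤ 1) :
    d - d * (d - 1) / 2 * y ≤ hitRatio d y := by
  have h2 : ∀ j ∈ Finset.range d, 1 - j * y ≤ (1 - y) ^ j := fun j _ => by
    have := one_add_mul_le_pow (by linarith : -2 ≤ -y) j
    rw [← sub_eq_add_neg] at this
    linarith
  refine le_trans (le_of_eq ?_) (Finset.sum_le_sum h2)
  rw [Finset.sum_sub_distrib, ← Finset.sum_mul, sum_range_cast]
  simp

theorem hitRatio_le_quadratic {d : ℕ} {y : ℝ} (h0 : 0 ≤ y) (h1 : y ≤ 1) :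
    hitRatio d y ≤ d - d * (d - 1) / 2 * y + d ^ 3 * y ^ 2 := by
  have h2 : ∀ j ∈ Finset.range d, (1 - y) ^ j ≤ 1 - j * y + (d * y) ^ 2 := fun j hj => by
    have h3 : (j : ℝ) ≤ d := by exact_mod_cast (Finset.mem_range.1 hj).le
    refine (one_sub_pow_le h0 h1 j).trans ?_
    gcongr
  refine (Finset.sum_le_sum h2).trans (le_of_eq ?_)
  rw [Finset.sum_add_distrib, Finset.sum_sub_distrib, ← Finset.sum_mul, sum_range_cast]
  simp
  ring

theorem tendsto_log_pow_mul_rpow (k : ℕ) {s : ℝ} (hs : 0 < s) :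
    Tendsto (fun n : ℕ => Real.log n ^ k * (n : ℝ) ^ (-s)) atTop (𝓝 0) := by
  have h := (isLittleO_log_rpow_rpow_atTop (k : ℝ) hs).tendsto_div_nhds_zero.comp
    tendsto_natCast_atTop_atTop
  refine h.congr fun n => ?_
  simp only [Function.comp_apply]
  rw [Real.rpow_natCast, Real.rpow_neg (Nat.cast_nonneg _), div_eq_mul_inv]

theorem tendsto_log_natCast : Tendsto (fun n : ℕ => Real.log n) atTop atTop :=
  Real.tendsto_log_atTop.comp tendsto_natCast_atTop_atTop

theorem log_succ_sub {n : ℕ} (hn : 1 ≤ n) :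
    1 / ((n : ℝ) + 1) ≤ Real.log (n + 1 : ℕ) - Real.log n ∧
      Real.log (n + 1 : ℕ) - Real.log n ≤ 1 / n := by
  have hn0 : (0 : ℝ) < n := by exact_mod_cast hn
  have e : Real.log (n + 1 : ℕ) - Real.log n = Real.log (1 + 1 / n) := by
    rw [← Real.log_div (by positivity) hn0.ne']
    congr 1
    push_cast
    field_simp
  rw [e]
  constructor
  · have := Real.one_sub_inv_le_log_of_pos (by positivity : 0 < 1 + 1 / (n : ℝ))
    refine le_trans (le_of_eq ?_) this
    field_simp; ring
  · have := Real.log_le_sub_one_of_pos (by positivity : 0 < 1 + 1 / (n : ℝ))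
    linarith

/-- The partial sums of `1 / (n * log n)` exceed those of the increments of `log (log n)`. -/
theorem not_summable_div_log {c : ℝ} (hc : 0 < c) :
    ¬ Summable fun n : ℕ => c / Real.log (n + 2 : ℕ) / n := by
  intro h
  have h1 := ((summable_nat_add_iff 1).2 h).mul_left (1 / c)
  set f : ℕ → ℝ := fun n => Real.log (Real.log (n + 3 : ℕ)) with hf
  have hlog : ∀ n : ℕ, 0 < Real.log (n + 3 : ℕ) := fun n =>
    Real.log_pos (by push_cast; linarith [Nat.cast_nonneg (α := ℝ) n])
  have hmono : ∀ n : ℕ, Real.log (n + 3 : ℕ) ≤ Real.log (n + 3 + 1 : ℕ) := fun n =>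
    Real.log_le_log (by positivity) (by exact_mod_cast Nat.le_succ _)
  have h2 : ∀ n, 0 ≤ f (n + 1) - f n := fun n => by
    rw [sub_nonneg]
    refine Real.log_le_log (hlog n) ?_
    have := hmono n
    rwa [show n + 3 + 1 = n + 1 + 3 by ring] at this
  have h3 : ∀ n, f (n + 1) - f n ≤ 1 / c * (c / Real.log (n + 1 + 2 : ℕ) / (n + 1 : ℕ)) := by
    intro n
    have h4 := (log_succ_sub (by omega : 1 ≤ n + 3)).2
    have hl := hlog n
    have e : f (n + 1) - f n = Real.log (Real.log (n + 3 + 1 : ℕ) / Real.log (n + 3 : ℕ)) := by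
      rw [Real.log_div (hl.trans_le (hmono n)).ne' hl.ne', hf]
    rw [e]
    have h5 := Real.log_le_sub_one_of_pos (div_pos (hl.trans_le (hmono n)) hl)
    refine h5.trans ?_
    have h6 : Real.log (n + 3 + 1 : ℕ) / Real.log (n + 3 : ℕ) - 1
        = (Real.log (n + 3 + 1 : ℕ) - Real.log (n + 3 : ℕ)) / Real.log (n + 3 : ℕ) := by
      field_simp
    rw [h6, show n + 1 + 2 = n + 3 by ring]
    have h7 : 1 / ((n + 3 : ℕ) : ℝ) ≤ 1 / (n + 1 : ℕ) := by
      gcongr; omega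
    calc _ ≤ 1 / ((n + 1 : ℕ) : ℝ) / Real.log (n + 3 : ℕ) :=
          div_le_div_of_nonneg_right (h4.trans h7) hl.le
      _ = _ := by field_simp
  have h4 : Summable fun n => f (n + 1) - f n := Summable.of_nonneg_of_le h2 h3 h1
  have h5 := h4.hasSum.tendsto_sum_nat
  simp only [Finset.sum_range_sub] at h5
  have h6 : Tendsto (fun n => f n - f 0) atTop atTop := by
    refine tendsto_atTop_add_const_right _ _ ?_
    exact Real.tendsto_log_atTop.comp
      (tendsto_log_natCast.comp (tendsto_add_atTop_nat 3))
  exact not_tendsto_nhds_of_tendsto_atTop h6 _ h5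

namespace Params

variable {P : Params}

/-- The rate at which `growth` decreases at `0`. -/
def slope (P : Params) : ℝ := P.k * P.d * (P.d - 1) / (2 * P.S)

theorem le_growth {y : ℝ} (h1 : y ≤ 1) : P.r - P.slope * y ≤ P.growth y := by
  have hS := S_pos P
  have hk := one_le_k P
  have h2 := le_hitRatio (d := P.d) h1
  have e : P.r - P.slope * y = (P.m + P.k * (P.d - P.d * (P.d - 1) / 2 * y)) / P.S := by
    rw [r, slope]; field_simp; ring
  rw [e, growth]
  gcongr

theorem growth_le {y : ℝ} (h0 : 0 ≤ y) (h1 : y ≤ 1) :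
    P.growth y ≤ P.r - P.slope * y + P.k * P.d ^ 3 / P.S * y ^ 2 := by
  have hS := S_pos P
  have hk := one_le_k P
  have h2 := hitRatio_le_quadratic (d := P.d) h0 h1
  have e : P.r - P.slope * y + P.k * P.d ^ 3 / P.S * y ^ 2
      = (P.m + P.k * (P.d - P.d * (P.d - 1) / 2 * y + P.d ^ 3 * y ^ 2)) / P.S := by
    rw [r, slope]; field_simp; ring
  rw [e, growth]
  gcongr

/-- The relative growth of `n / log n`. -/
theorem div_log_step {θ : ℝ} (hθ : 0 < θ) {n : ℕ} (hn : 1 ≤ n) (hL : 1 ≤ Real.log n) :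
    θ * n / Real.log n ≤ θ * (n + 1 : ℕ) / Real.log (n + 1 : ℕ) ∧
    θ * (n + 1 : ℕ) / Real.log (n + 1 : ℕ)
      ≤ θ * n / Real.log n * (1 + (1 - 1 / Real.log (n + 1 : ℕ)) / n) ∧
    θ * n / Real.log n * (1 + (1 - (1 + 1 / n) / Real.log (n + 1 : ℕ)) / n)
      ≤ θ * (n + 1 : ℕ) / Real.log (n + 1 : ℕ) := by
  have hn0 : (0 : ℝ) < n := by exact_mod_cast hn
  obtain ⟨h1, h2⟩ := log_succ_sub hn
  set L := Real.log n with hLd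
  set L' := Real.log (n + 1 : ℕ) with hLd'
  have hL0 : 0 < L := by linarith
  have hLL : L ≤ L' := by
    have : 0 ≤ 1 / ((n : ℝ) + 1) := by positivity
    linarith
  have hL0' : 0 < L' := by linarith
  rw [div_le_iff₀ (by positivity)] at h1
  rw [le_div_iff₀ hn0] at h2
  push_cast
  refine ⟨?_, ?_, ?_⟩
  · rw [div_le_div_iff₀ hL0 hL0']
    have : θ * (n * L') ≤ θ * ((n + 1) * L) := mul_le_mul_of_nonneg_left (by linarith) hθ.le
    linarith
  · have e : θ * n / L * (1 + (1 - 1 / L') / n) = θ * ((n + 1) * L' - 1) / (L * L') := by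
      field_simp; ring
    rw [e, div_le_div_iff₀ hL0' (by positivity)]
    have : θ * L' * ((n + 1) * L) ≤ θ * L' * ((n + 1) * L' - 1) :=
      mul_le_mul_of_nonneg_left (by linarith) (by positivity)
    linarith
  · have e : θ * n / L * (1 + (1 - (1 + 1 / n) / L') / n)
        = θ * ((n + 1) * L' - (1 + 1 / n)) / (L * L') := by
      field_simp; ring
    rw [e, div_le_div_iff₀ (by positivity) hL0']
    have h3 : (n + 1) * L' - (1 + 1 / n) ≤ (n + 1) * L := by
      have : ((n : ℝ) + 1) * (L' - L) ≤ (n + 1) / n := by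
        rw [le_div_iff₀ hn0]; nlinarith
      have e2 : ((n : ℝ) + 1) / n = 1 + 1 / n := by field_simp
      linarith
    have : θ * L' * ((n + 1) * L' - (1 + 1 / n)) ≤ θ * L' * ((n + 1) * L) := by gcongr
    linarith

variable {Ω : Type*} [mΩ : MeasurableSpace Ω] {μ : Measure Ω} [IsProbabilityMeasure μ]
  {G : (n : ℕ) → Ω → TypedGraph P.T n}

theorem eventually_div_log_le {θ c : ℝ} (hc : 0 < c) :
    ∀ᶠ n : ℕ in atTop, θ * n / Real.log n ≤ c * n := by
  filter_upwards [tendsto_log_natCast.eventually_ge_atTop (max 1 (θ / c))] with n hn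
  have h1 : 0 < Real.log n := lt_of_lt_of_le one_pos ((le_max_left _ _).trans hn)
  have h2 : θ ≤ c * Real.log n := by
    have := (le_max_right _ _).trans hn
    rw [div_le_iff₀ hc] at this
    linarith
  rw [div_le_iff₀ h1]
  nlinarith [Nat.cast_nonneg (α := ℝ) n]

/-- The relative growth of `θ * n / log n` is about `(1 - 1 / log n) / n`, and the relative drift of a
vertex of this degree is about `(1 - ρ / log n) / n`, where `ρ = slope * θ / (p i * S)`. -/
theorem IsGraphSequence.eventually_le_div_log (hG : P.IsGraphSequence μ G) (i : Fin P.T)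
    (hr : P.r = 1) {θ : ℝ} (hθ : 0 < θ) (hgr : P.slope * (θ / (P.p i * P.S)) < 1) :
    ∀ᵐ ω ∂μ, ∀ ε : ℝ, 0 < ε → ∀ᶠ n : ℕ in atTop,
      (1 - ε) * (θ * n / Real.log n) ≤ (G n ω).maxDegree i := by
  obtain ⟨δ, hδ, h⟩ := hG.exists_eventually_le_maxDegree i
  have hq0 : 0 < P.p i * P.S := mul_pos (P.p_pos i) (S_pos P)
  set ρ := P.slope * (θ / (P.p i * P.S)) with hρ
  set c := (1 - ρ) / 2 with hc
  have hc0 : 0 < c := by rw [hc]; linarith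
  have hlog2 : ∀ n : ℕ, 0 < Real.log (n + 2 : ℕ) := fun n =>
    Real.log_pos (by push_cast; linarith [Nat.cast_nonneg (α := ℝ) n])
  have h1 := h (fun n => θ * n / Real.log n) (fun n => 1 - 1 / Real.log (n + 1 : ℕ))
    (fun n => c / Real.log (n + 2 : ℕ)) (fun n => (n : ℝ) ^ (1 / 2 : ℝ) / 2)
    ?_ ?_ (fun n => div_pos hc0 (hlog2 n)) ?_ ?_ ?_ (not_summable_div_log hc0)
  · filter_upwards [h1, hG.eventually_rpow_le i (s := 1 / 2) (by norm_num)
      (by rw [hr]; norm_num) (by norm_num)] with ω h2 h3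
    exact h2 h3 ((eventually_div_log_le (θ := θ) hδ).mono fun n hn hlt => Or.inl (hlt.le.trans hn))
  · filter_upwards [eventually_ge_atTop 1, tendsto_log_natCast.eventually_ge_atTop 1] with n hn hL
    obtain ⟨h2, h3, -⟩ := div_log_step hθ hn hL
    have hn0 : (0 : ℝ) < n := by exact_mod_cast hn
    exact ⟨by positivity, h2, h3⟩
  · filter_upwards [eventually_ge_atTop 1, eventually_div_log_le (θ := θ) hq0,
      (tendsto_log_natCast.comp (tendsto_add_atTop_nat 1)).eventually_ge_atTop 1] with n hn h2 h3
    have hn0 : (0 : ℝ) < n := by exact_mod_cast hn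
    simp only [Function.comp_apply] at h3
    refine ⟨h2, ?_, by positivity, rpow_half_div_two_le hn⟩
    rw [sub_nonneg, div_le_one (by linarith)]
    exact h3
  · have herr : Tendsto (fun n : ℕ => P.lowerErr i * (Real.log n ^ 1 * (n : ℝ) ^ (-(1 / 4) : ℝ)
        + 2 * (Real.log n ^ 1 * (n : ℝ) ^ (-(1 / 2) : ℝ)))) atTop (𝓝 0) := by
      have := ((tendsto_log_pow_mul_rpow 1 (s := 1 / 4) (by norm_num)).add
        ((tendsto_log_pow_mul_rpow 1 (s := 1 / 2) (by norm_num)).const_mul 2)).const_mul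
          (P.lowerErr i)
      simpa using this
    filter_upwards [eventually_ge_atTop 1, tendsto_log_natCast.eventually_ge_atTop 1,
      eventually_div_log_le (θ := θ) hq0, herr.eventually_le_const (half_pos hc0),
      eventually_ge_atTop ⌈2 / c⌉₊] with n hn hL h2 h3 hnc
    have hn0 : (0 : ℝ) < n := by exact_mod_cast hn
    have hcn : 1 / (n : ℝ) ≤ c / 2 := by
      have : 2 / c ≤ n := (Nat.le_ceil _).trans (by exact_mod_cast hnc)
      rw [one_div_le hn0 (by positivity), one_div_div]
      exact this
    have hLS := log_succ_sub hn
    have hL2 : Real.log n ≤ Real.log (n + 2 : ℕ) :=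
      Real.log_le_log hn0 (by push_cast; linarith)
    have hy1 : θ * n / Real.log n / (P.p i * P.S * n) ≤ 1 := (div_le_one (by positivity)).2 h2
    have h4 := le_growth (P := P) hy1
    rw [hr] at h4
    set L := Real.log n with hLd
    set L' := Real.log (n + 1 : ℕ) with hLd'
    have hL0 : 0 < L := by linarith
    have hLL : L ≤ L' := by
      have : 0 ≤ 1 / ((n : ℝ) + 1) := by positivity
      linarith
    have hL0' : 0 < L' := by linarith
    have e1 : P.slope * (θ * n / L / (P.p i * P.S * n)) = ρ / L := by
      rw [hρ]; field_simp
    rw [e1] at h4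
    have h5 : c / Real.log (n + 2 : ℕ) ≤ c / L := by gcongr
    have h6 : (1 - c / 2) / L ≤ 1 / L' := by
      rw [div_le_div_iff₀ hL0 hL0']
      have : (1 - c / 2) * L' ≤ L' - 1 / n := by
        have : c / 2 * 1 ≤ c / 2 * L' := by gcongr; linarith
        linarith
      linarith [hLS.2]
    have h7 : P.lowerErr i * (relErr n + 1 / ((n : ℝ) ^ (1 / 2 : ℝ) / 2)) ≤ c / 2 / L := by
      rw [le_div_iff₀ hL0, one_div_rpow_half, relErr]
      refine le_trans (le_of_eq ?_) h3
      ring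
    have h8 : (1 - c / 2) / L - c / L - ρ / L - c / 2 / L = 0 := by
      rw [hc]; field_simp; ring
    linarith
  · have h2 : Tendsto (fun n : ℕ => Real.log (n + 2 : ℕ) ^ 1 * ((n + 2 : ℕ) : ℝ) ^ (-(1 / 2) : ℝ))
        atTop (𝓝 0) :=
      (tendsto_log_pow_mul_rpow 1 (s := 1 / 2) (by norm_num)).comp (tendsto_add_atTop_nat 2)
    have hC : 0 < 64 * (P.r + 1) ^ 2 * P.maxIncr := by
      have := r_pos P; have := one_le_maxIncr P; positivity
    filter_upwards [h2.eventually_le_const (by positivity :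
      0 < c / (4 * (64 * (P.r + 1) ^ 2 * P.maxIncr))), eventually_ge_atTop 1] with n hn hn1
    have hn0 : (0 : ℝ) < n := by exact_mod_cast hn1
    set C := 64 * (P.r + 1) ^ 2 * P.maxIncr with hCd
    have h3 : ((n + 2 : ℕ) : ℝ) ^ (1 / 2 : ℝ) ≤ 2 * (n : ℝ) ^ (1 / 2 : ℝ) := by
      have e : (2 : ℝ) * (n : ℝ) ^ (1 / 2 : ℝ) = (4 * n : ℝ) ^ (1 / 2 : ℝ) := by
        rw [Real.mul_rpow (by norm_num) hn0.le]
        congr 1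
        rw [← Real.sqrt_eq_rpow, show (4 : ℝ) = 2 ^ 2 by norm_num, Real.sqrt_sq (by norm_num)]
      rw [e]
      have : (1 : ℝ) ≤ n := by exact_mod_cast hn1
      gcongr
      push_cast; linarith
    rw [pow_one, Real.rpow_neg (by positivity), ← div_eq_mul_inv, div_le_iff₀ (by positivity)] at hn
    rw [div_mul_eq_mul_div, le_div_iff₀ (hlog2 n)]
    have h4 : c / (4 * C) * ((n + 2 : ℕ) : ℝ) ^ (1 / 2 : ℝ)
        ≤ c / (4 * C) * (2 * (n : ℝ) ^ (1 / 2 : ℝ)) := by gcongr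
    calc C * Real.log (n + 2 : ℕ) ≤ C * (c / (4 * C) * (2 * (n : ℝ) ^ (1 / 2 : ℝ))) := by
          gcongr; exact hn.trans h4
      _ = _ := by field_simp; ring
  · have h2 : ∀ᶠ n : ℕ in atTop, Real.log n ≤ (n : ℝ) ^ (1 / 2 : ℝ) := by
      filter_upwards [(tendsto_log_pow_mul_rpow 1 (s := 1 / 2) (by norm_num)).eventually_le_const
        one_pos, eventually_ge_atTop 1] with n hn hn1
      have hn0 : (0 : ℝ) < n := by exact_mod_cast hn1
      rw [pow_one, Real.rpow_neg hn0.le, ← div_eq_mul_inv, div_le_one (by positivity)] at hn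
      exact hn
    refine Summable.of_norm_bounded_eventually_nat ((Real.summable_one_div_nat_rpow.2
      (by norm_num : (1 : ℝ) < 3 / 2)).mul_left (1 / θ)) ?_
    filter_upwards [h2, eventually_ge_atTop 1] with n hn hn1
    have hn0 : (0 : ℝ) < n := by exact_mod_cast hn1
    have hl : 0 ≤ Real.log n := Real.log_natCast_nonneg n
    rw [Real.norm_of_nonneg (by positivity)]
    have e : (n : ℝ) ^ (1 / 2 : ℝ) * (n : ℝ) ^ (3 / 2 : ℝ) = n * n := by
      rw [← Real.rpow_add hn0, ← sq, ← Real.rpow_natCast]; norm_num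
    have e2 : 1 / (n * (θ * n / Real.log n)) = 1 / θ * (Real.log n / (n * n)) := by
      field_simp
    rw [e2, ← e]
    have h3 : Real.log n / ((n : ℝ) ^ (1 / 2 : ℝ) * (n : ℝ) ^ (3 / 2 : ℝ))
        ≤ (n : ℝ) ^ (1 / 2 : ℝ) / ((n : ℝ) ^ (1 / 2 : ℝ) * (n : ℝ) ^ (3 / 2 : ℝ)) := by gcongr
    refine mul_le_mul_of_nonneg_left (h3.trans (le_of_eq ?_)) (by positivity)
    field_simp

/-- The counterpart of `IsGraphSequence.eventually_le_div_log` for larger `θ`. -/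
theorem IsGraphSequence.eventually_le_mul_div_log (hG : P.IsGraphSequence μ G) (i : Fin P.T)
    (hr : P.r = 1) {θ : ℝ} (hθ : 0 < θ) (hgr : 1 < P.slope * (θ / (P.p i * P.S))) :
    ∀ᵐ ω ∂μ, ∀ ε : ℝ, 0 < ε → ∀ᶠ n : ℕ in atTop,
      ((G n ω).maxDegree i : ℝ) ≤ (1 + ε) * (θ * n / Real.log n) := by
  obtain ⟨C, hC, h⟩ := hG.exists_eventually_maxDegree_le i
  have hq0 : 0 < P.p i * P.S := mul_pos (P.p_pos i) (S_pos P)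
  set ρ := P.slope * (θ / (P.p i * P.S)) with hρ
  set c := (ρ - 1) / 2 with hc
  have hc0 : 0 < c := by rw [hc]; linarith
  have hlog2 : ∀ n : ℕ, 0 < Real.log (n + 2 : ℕ) := fun n =>
    Real.log_pos (by push_cast; linarith [Nat.cast_nonneg (α := ℝ) n])
  set E := P.k * P.d ^ 3 / P.S * (θ / (P.p i * P.S)) ^ 2 with hE
  have hsmall : ∀ᶠ n : ℕ in atTop, Real.log n ^ 2 * (n : ℝ) ^ (-(1 / 2) : ℝ) ≤ 1 :=
    (tendsto_log_pow_mul_rpow 2 (s := 1 / 2) (by norm_num)).eventually_le_const one_pos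
  have hsq : ∀ᶠ n : ℕ in atTop, Real.log n ^ 2 ≤ (n : ℝ) ^ (1 / 2 : ℝ) := by
    filter_upwards [hsmall, eventually_ge_atTop 1] with n hn hn1
    have hn0 : (0 : ℝ) < n := by exact_mod_cast hn1
    rwa [Real.rpow_neg hn0.le, ← div_eq_mul_inv, div_le_one (by positivity)] at hn
  have htop : Tendsto (fun n : ℕ => θ * n / Real.log n) atTop atTop := by
    refine tendsto_atTop_mono' _ ?_ ((tendsto_rpow_natCast (s := 1 / 2)
      (by norm_num)).const_mul_atTop hθ)
    filter_upwards [hsq, tendsto_log_natCast.eventually_ge_atTop 1, eventually_ge_atTop 1]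
      with n hn hL hn1
    have hn0 : (0 : ℝ) < n := by exact_mod_cast hn1
    rw [le_div_iff₀ (by linarith), mul_assoc]
    have h1 : Real.log n ≤ (n : ℝ) ^ (1 / 2 : ℝ) := by nlinarith
    have e : (n : ℝ) = (n : ℝ) ^ (1 / 2 : ℝ) * (n : ℝ) ^ (1 / 2 : ℝ) := by
      rw [← Real.rpow_add hn0]; norm_num
    calc θ * ((n : ℝ) ^ (1 / 2 : ℝ) * Real.log n)
        ≤ θ * ((n : ℝ) ^ (1 / 2 : ℝ) * (n : ℝ) ^ (1 / 2 : ℝ)) := by gcongr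
      _ = θ * n := by rw [← e]
  refine h (fun n => θ * n / Real.log n) (fun n => 1 - (1 + 1 / n) / Real.log (n + 1 : ℕ))
    (fun n => c / Real.log (n + 2 : ℕ)) 1 ?_ (eventually_div_log_le (θ := θ) hq0)
    (fun n => div_pos hc0 (hlog2 n)) ?_ ?_ (not_summable_div_log hc0) zero_le_one
  · filter_upwards [eventually_ge_atTop 1, tendsto_log_natCast.eventually_ge_atTop 1,
      htop.eventually_ge_atTop P.maxIncr] with n hn hL hK
    obtain ⟨h2, h3, h4⟩ := div_log_step hθ hn hL
    have hn0 : (0 : ℝ) < n := by exact_mod_cast hn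
    refine ⟨hK, h2, h4, h3.trans ?_⟩
    have hl : 0 ≤ Real.log (n + 1 : ℕ) := Real.log_natCast_nonneg _
    have : 0 ≤ θ * n / Real.log n := by positivity
    gcongr
    have : 0 ≤ 1 / Real.log (n + 1 : ℕ) := by positivity
    linarith
  · have herr : Tendsto (fun n : ℕ => E * (1 / Real.log n) + C * (Real.log n ^ 1
        * (n : ℝ) ^ (-(1 / 4) : ℝ) + 1 / θ * (Real.log n ^ 2 * (n : ℝ) ^ (-1 : ℝ)))
        + (n : ℝ) ^ (-1 : ℝ)) atTop (𝓝 0) := by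
      have h1 : Tendsto (fun n : ℕ => 1 / Real.log n) atTop (𝓝 0) :=
        tendsto_const_nhds.div_atTop tendsto_log_natCast
      have := ((h1.const_mul E).add (((tendsto_log_pow_mul_rpow 1 (s := 1 / 4)
        (by norm_num)).add ((tendsto_log_pow_mul_rpow 2 (s := 1)
        (by norm_num)).const_mul (1 / θ))).const_mul C)).add
        (tendsto_rpow_neg_natCast (s := 1) one_pos)
      simpa using this
    filter_upwards [eventually_ge_atTop 1, tendsto_log_natCast.eventually_ge_atTop 1,
      eventually_div_log_le (θ := θ) hq0, herr.eventually_le_const hc0] with n hn hL h2 h3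
    have hn0 : (0 : ℝ) < n := by exact_mod_cast hn
    have hLS := log_succ_sub hn
    have hL2 : Real.log n ≤ Real.log (n + 2 : ℕ) :=
      Real.log_le_log hn0 (by push_cast; linarith)
    have hy1 : θ * n / Real.log n / (P.p i * P.S * n) ≤ 1 := (div_le_one (by positivity)).2 h2
    have h4 := growth_le (P := P) (by positivity) hy1
    rw [hr] at h4
    set L := Real.log n with hLd
    set L' := Real.log (n + 1 : ℕ) with hLd'
    have hL0 : 0 < L := by linarith
    have hLL : L ≤ L' := by
      have : 0 ≤ 1 / ((n : ℝ) + 1) := by positivity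
      linarith
    have e1 : P.slope * (θ * n / L / (P.p i * P.S * n)) = ρ / L := by
      rw [hρ]; field_simp
    have e2 : P.k * P.d ^ 3 / P.S * (θ * n / L / (P.p i * P.S * n)) ^ 2 = E * (1 / L) / L := by
      rw [hE]; field_simp
    rw [e1, e2] at h4
    have h5 : c / Real.log (n + 2 : ℕ) ≤ c / L := by gcongr
    have h6 : (1 + 1 / (n : ℝ)) / L' ≤ (1 + (n : ℝ) ^ (-1 : ℝ)) / L := by
      rw [Real.rpow_neg_one, ← one_div]; gcongr
    have h7 : C * (relErr n + 1 / (θ * n / L)) = C * (L ^ 1 * (n : ℝ) ^ (-(1 / 4) : ℝ)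
        + 1 / θ * (L ^ 2 * (n : ℝ) ^ (-1 : ℝ))) / L := by
      rw [relErr, Real.rpow_neg_one]; field_simp
    have h8 := div_le_div_of_nonneg_right h3 hL0.le
    rw [add_div, add_div] at h8
    rw [h7]
    have h9 : ρ / L - 1 / L - c / L - c / L = 0 := by rw [hc]; field_simp; ring
    have h10 : (1 + (n : ℝ) ^ (-1 : ℝ)) / L = 1 / L + (n : ℝ) ^ (-1 : ℝ) / L := add_div _ _ _
    rw [h10] at h6
    linarith
  · refine Summable.of_norm_bounded_eventually_nat ((Real.summable_one_div_nat_rpow.2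
      (by norm_num : (1 : ℝ) < 3 / 2)).mul_left (1 / θ ^ 2)) ?_
    filter_upwards [hsq, eventually_ge_atTop 1] with n hn hn1
    have hn0 : (0 : ℝ) < n := by exact_mod_cast hn1
    rw [Real.norm_of_nonneg (by positivity)]
    have e : (n : ℝ) ^ (1 / 2 : ℝ) * (n : ℝ) ^ (3 / 2 : ℝ) = n ^ 2 := by
      rw [← Real.rpow_add hn0, ← Real.rpow_natCast]; norm_num
    have e2 : 1 / (θ * n / Real.log n) ^ 2 = 1 / θ ^ 2 * (Real.log n ^ 2 / n ^ 2) := by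
      field_simp
    rw [e2, ← e]
    have h3 : Real.log n ^ 2 / ((n : ℝ) ^ (1 / 2 : ℝ) * (n : ℝ) ^ (3 / 2 : ℝ))
        ≤ (n : ℝ) ^ (1 / 2 : ℝ) / ((n : ℝ) ^ (1 / 2 : ℝ) * (n : ℝ) ^ (3 / 2 : ℝ)) := by gcongr
    refine mul_le_mul_of_nonneg_left (h3.trans (le_of_eq ?_)) (by positivity)
    field_simp

theorem IsGraphSequence.ae_tendsto_maxDegree_mul_log_div (hG : P.IsGraphSequence μ G)
    (i : Fin P.T) (hr : P.r = 1) :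
    ∀ᵐ ω ∂μ, Tendsto (fun n => ((G n ω).maxDegree i : ℝ) * Real.log n / n) atTop
      (𝓝 (2 * P.p i * P.S ^ 2 / (P.k * P.d * (P.d - 1)))) := by
  have hp := P.p_pos i
  have hS := S_pos P
  have hk := one_le_k P
  have hd : (1 : ℝ) < P.d := by exact_mod_cast P.one_lt_d
  have hd1 : 0 < (P.d : ℝ) - 1 := by linarith
  set a := 2 * P.p i * P.S ^ 2 / (P.k * P.d * (P.d - 1)) with ha
  have ha0 : 0 < a := by positivity
  have hslope : ∀ θ, P.slope * (θ / (P.p i * P.S)) = θ / a := by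
    intro θ; rw [slope, ha]; field_simp
  refine ae_tendsto_of_eventually_bounds (fun n ω => ?_) ?_ (lt_add_one a) ?_ ha0
  · have := Real.log_natCast_nonneg n
    positivity
  · intro θ hθ hθa
    filter_upwards [hG.eventually_le_div_log i hr hθ
      (by rw [hslope, div_lt_one ha0]; exact hθa)] with ω h1 ε hε
    filter_upwards [h1 ε hε, eventually_ge_atTop 1, tendsto_log_natCast.eventually_ge_atTop 1]
      with n hn hn1 hL
    have hn0 : (0 : ℝ) < n := by exact_mod_cast hn1
    rw [le_div_iff₀ hn0]
    rw [← mul_div_assoc, div_le_iff₀ (by linarith)] at hn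
    linarith
  · intro θ hθa _
    have hθ : 0 < θ := ha0.trans hθa
    filter_upwards [hG.eventually_le_mul_div_log i hr hθ
      (by rw [hslope, one_lt_div ha0]; exact hθa)] with ω h1 ε hε
    filter_upwards [h1 ε hε, eventually_ge_atTop 1, tendsto_log_natCast.eventually_ge_atTop 1]
      with n hn hn1 hL
    have hn0 : (0 : ℝ) < n := by exact_mod_cast hn1
    rw [div_le_iff₀ hn0]
    rw [← mul_div_assoc, le_div_iff₀ (by linarith)] at hn
    linarith

end Params

end ChoiceEdgeStep

end

theorem theorem1 (P : ChoiceEdgeStep.Params) {Ω : Type*} [MeasurableSpace Ω] (μ : Measure Ω)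
    [IsProbabilityMeasure μ] (G : (n : ℕ) → Ω → ChoiceEdgeStep.TypedGraph P.T n)
    (hG : P.IsGraphSequence μ G) (i : Fin P.T) :
    (P.r < 1 → ∀ ε : ℝ, 0 < ε →
      Tendsto (fun n₀ : ℕ => μ {ω | ∀ n : ℕ, n₀ < n →
        (n : ℝ) ^ (P.r - ε) < ((G n ω).maxDegree i : ℝ) ∧
          ((G n ω).maxDegree i : ℝ) < (n : ℝ) ^ (P.r + ε)}) atTop (𝓝 1)) ∧
    (P.r = 1 → ∀ᵐ ω ∂μ,
      liminf (fun n : ℕ => ((((G n ω).maxDegree i : ℝ) * Real.log n / n : ℝ) : EReal)) atTop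
        = ((2 * P.p i * P.S ^ 2 / (P.k * P.d * (P.d - 1)) : ℝ) : EReal)) ∧
    (1 < P.r → ∃ x : ℝ, 0 < x ∧ x ≤ P.S ∧ P.f x = x ∧
      (∀ y : ℝ, 0 < y → y ≤ P.S → P.f y = y → y = x) ∧
      (Even P.d → ∀ y : ℝ, 0 < y → P.f y = y → y = x) ∧
      ∀ᵐ ω ∂μ, liminf (fun n : ℕ => ((((G n ω).maxDegree i : ℝ) / n : ℝ) : EReal)) atTop
        = ((P.p i * x : ℝ) : EReal)) := by
  refine ⟨fun hr ε hε => hG.tendsto_measure_of_r_lt_one i hr hε, fun hr => ?_, fun hr => ?_⟩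
  · filter_upwards [hG.ae_tendsto_maxDegree_mul_log_div i hr] with ω hω
    exact ((continuous_coe_real_ereal.tendsto _).comp hω).liminf_eq
  -- with the share `y = x / S`, the equation `f x = x` reads `growth y = 1`
  · have hS := ChoiceEdgeStep.Params.S_pos P
    obtain ⟨y, hy0, hy1, hy⟩ := ChoiceEdgeStep.Params.exists_growth_eq_one hr
    have hunique : ∀ z : ℝ, 0 < z → z ≤ P.S → P.f z = z → z = P.S * y := fun z hz hzS hfz => by
      rw [ChoiceEdgeStep.Params.f_eq_self_iff hz] at hfz
      have := ChoiceEdgeStep.Params.eq_of_growth_eq_one ((div_le_one hS).2 hzS)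
        hy1.le hfz hy
      rw [← this, mul_div_cancel₀ _ hS.ne']
    refine ⟨P.S * y, by positivity, by nlinarith, ?_, hunique, fun hd z hz hfz => ?_, ?_⟩
    · rw [ChoiceEdgeStep.Params.f_eq_self_iff (by positivity), mul_div_cancel_left₀ _ hS.ne', hy]
    · refine hunique z hz (not_lt.1 fun hzS => ?_) hfz
      rw [ChoiceEdgeStep.Params.f_eq_self_iff hz] at hfz
      exact (ChoiceEdgeStep.Params.growth_lt_one_of_hitRatio_le
        (ChoiceEdgeStep.hitRatio_lt_one hd ((one_lt_div hS).2 hzS)).le).ne hfz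
    · filter_upwards [hG.ae_tendsto_maxDegree_div i hy0 hy1 hy] with ω hω
      rw [← mul_assoc]
      exact ((continuous_coe_real_ereal.tendsto _).comp hω).liminf_eq
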